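/- **Lorenz maps.** Let $l<0<r$ and $\rho>1$. A *Lorenz map* on $[l,r]$ with critical exponent $\rho$ is a continuous map $f:[l,r]\setminus\{0\}\to[l,r]$ that is strictly increasing on $[l,0)$ and on $(0,r]$, with $\lim_{x\uparrow0}f(x)=r$ and $\lim_{x\downarrow0}f(x)=l$, such that $f(x)=\varphi(|x|^\rho)$ for $x\in(l,0)$ and $f(x)=\psi(|x|^\rho)$ for $x\in(0,r)$, where $\varphi,\psi$ are analytic on complex neighbourhoods of $[0,|l|^\rho]$ and $[0,r^\rho]$ respectively and symmetric ($\varphi(\bar z)=\overline{\varphi(z)}$, and likewise $\psi$). **Renormalization.** A Lorenz map $f$ on $I=[l,r]$ is *renormalizable* if there is a maximal (i.e. largest) closed interval $U=[p,q]\subsetneq I$ containing $0$ in its interior such that the first-return map $\tilde f$ of $f$ to $U$ is a Lorenz map on $U$ (with the same $\rho$). With $h(x)=(p/l)\,x$, its renormalization is the Lorenz map $\mathcal Rf=h^{-1}\circ\tilde f\circ h$ on $h^{-1}(U)=[l,lq/p]$. A *branch* of $f^n$ is a maximal open interval on which $f^n$ is defined and monotone; its word is $\sigma_0\dots\sigma_{n-1}$,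 where $\sigma_j=0$ if $f^j$ maps the branch into $(l,0)$ and $\sigma_j=1$ if $f^j$ maps it into $(0,r)$. The renormalization has *type* $(\alpha,\beta)$, where $\alpha,\beta$ are words of lengths $a,b\ge2$, if the first-return time to $U$ is $a$ on $L=U\cap(l,0)$ and $b$ on $R=U\cap(0,r)$, $L$ is contained in a branch of $f^a$ with word $\alpha$, and $R$ in a branch of $f^b$ with word $\beta$. The restriction of $\mathcal R$ to the Lorenz maps with renormalization of type $(\alpha,\beta)$ is denoted $\mathcal R_{\alpha,\beta}$. **The Banach space.** Let $X$ be the real Banach space of functions $f(z)=\sum_{k\ge0}a_kz^k$ on the unit disk with $a_k\in\mathbb R$ and $\|f\|=\sum|a_k|<\infty$, let $Y=X\times X$ with $\|(f,g)\|=\|f\|+\|g\|$, and put $s=2.2$, $t=0.5$. A pair $(f,g)\in Y$ represents the map on $[-1,r]$, $r=\varphi(0)$, given by $x\mapsto\varphi(x^2)$ for $x<0$ and $x\mapsto\psi(x^2)$ for $x>0$, where $$\varphi(z)=f\big((z-1)/s\big),\qquad \psi(z)=-1+z\,g(z/t),$$ provided that $r^2<t$ and that this is a Lorenz map with critical exponent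 $\rho=2$. In these coordinates $\mathcal R_{\alpha,\beta}$ becomes a partially defined (single-valued) operator on $Y$: its domain is the set of all $F\in Y$ representing a Lorenz map with a renormalization of type $(\alpha,\beta)$ that is again represented by an element of $Y$; this element, which is unique, is the value at $F$. **Theorem (Main Theorem).** Let $\alpha=\{0,1\}$, $\beta=\{1,0,0\}$ and $\rho=2$. The restricted renormalization operator $\mathcal R_{\alpha,\beta}$ has a hyperbolic fixed point. That is, there is $F_\star\in Y$ such that the operator $\mathcal R_{\alpha,\beta}$ on $Y$ is defined on a neighbourhood of $F_\star$, is continuously Fréchet differentiable near $F_\star$, satisfies $\mathcal R_{\alpha,\beta}F_\star=F_\star$, and its derivative at $F_\star$ is a compact operator whose spectrum (that of its complexification) does not meet the unit circle. -/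

import Mathlib

namespace LorenzRenorm

open Set Filter Topology

noncomputable section

/-! ### Lorenz maps

A map on `[l, r] \ {0}` is given by a total function `f : ℝ → ℝ`; its values elsewhere (in
particular `f 0`) are irrelevant to everything below. -/

/-- On `J`, `f` has the form `f x = φ (|x| ^ ρ)`, where `φ` is a symmetric analytic function on a
complex neighbourhood `N` of the interval `[0, m]`. -/
def HasAnalyticPart (ρ m : ℝ) (J : Set ℝ) (f : ℝ → ℝ) : Prop :=
  ∃ (φ : ℂ → ℂ) (N : Set ℂ), IsOpen N ∧ (∀ u ∈ Icc 0 m, (u : ℂ) ∈ N) ∧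
    DifferentiableOn ℂ φ N ∧
    (∀ z ∈ N, starRingEnd ℂ z ∈ N ∧ φ (starRingEnd ℂ z) = starRingEnd ℂ (φ z)) ∧
    ∀ x ∈ J, (f x : ℂ) = φ ((|x| ^ ρ : ℝ) : ℂ)

/-- `f` is a Lorenz map on `[l, r]` with critical exponent `ρ`. -/
structure IsLorenzMap (ρ l r : ℝ) (f : ℝ → ℝ) : Prop where
  one_lt_exponent : 1 < ρ
  left_neg : l < 0
  right_pos : 0 < r
  mapsTo : MapsTo f (Icc l r \ {0}) (Icc l r)
  continuousOn : ContinuousOn f (Icc l r \ {0})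
  strictMonoOn_left : StrictMonoOn f (Ico l 0)
  strictMonoOn_right : StrictMonoOn f (Ioc 0 r)
  tendsto_left : Tendsto f (𝓝[<] 0) (𝓝 r)
  tendsto_right : Tendsto f (𝓝[>] 0) (𝓝 l)
  analytic_left : HasAnalyticPart ρ (|l| ^ ρ) (Ioo l 0) f
  analytic_right : HasAnalyticPart ρ (r ^ ρ) (Ioo 0 r) f

/-! ### First-return maps and renormalization -/

/-- The first-return time of `x` to `U` (`0` if `x` never returns). If `0 ∈ U`, the orbit of `x`
up to its first return does not pass through `0` before that time. -/
def returnTime (f : ℝ → ℝ) (U : Set ℝ) (x : ℝ) : ℕ :=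
  sInf {n : ℕ | 0 < n ∧ f^[n] x ∈ U}

/-- The first-return map to `U`. -/
def firstReturn (f : ℝ → ℝ) (U : Set ℝ) (x : ℝ) : ℝ :=
  f^[returnTime f U x] x

/-- The first-return map of `f` to `[p, q]` is defined on `[p, q] \ {0}` and is a Lorenz map
on `[p, q]`. -/
def ReturnIsLorenz (ρ : ℝ) (f : ℝ → ℝ) (p q : ℝ) : Prop :=
  (∀ x ∈ Icc p q \ {0}, ∃ n : ℕ, 0 < n ∧ f^[n] x ∈ Icc p q) ∧
    IsLorenzMap ρ p q (firstReturn f (Icc p q))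

/-- `[p, q]` is the maximal (that is, the largest) proper subinterval of `[l, r]` to which the
first-return map of `f` is a Lorenz map. -/
def IsRenormInterval (ρ l r : ℝ) (f : ℝ → ℝ) (p q : ℝ) : Prop :=
  Icc p q ⊂ Icc l r ∧ ReturnIsLorenz ρ f p q ∧
    ∀ p' q' : ℝ, Icc p' q' ⊂ Icc l r → ReturnIsLorenz ρ f p' q' → Icc p' q' ⊆ Icc p q

/-- `B` is a nonempty open interval in `[l, r]` on which `f ^ n` is defined (the orbits of its
points do not meet `0` before time `n`) and monotone. -/
def IsMonotoneInterval (l r : ℝ) (f : ℝ → ℝ) (n : ℕ) (B : Set ℝ) : Prop :=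
  (∃ c d : ℝ, c < d ∧ B = Ioo c d) ∧ B ⊆ Icc l r ∧
    (∀ j < n, ∀ x ∈ B, f^[j] x ≠ 0) ∧ MonotoneOn f^[n] B

/-- `B` is a branch of `f ^ n`. -/
def IsBranch (l r : ℝ) (f : ℝ → ℝ) (n : ℕ) (B : Set ℝ) : Prop :=
  Maximal (IsMonotoneInterval l r f n) B

/-- The word on the symbols `0`, `1` associated to the branch `B` of `f ^ n`, `n = w.length`,
is `w`. -/
def HasWord (l r : ℝ) (f : ℝ → ℝ) (B : Set ℝ) (w : List (Fin 2)) : Prop :=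
  ∀ (j : ℕ) (hj : j < w.length),
    f^[j] '' B ⊆ if w[j] = 0 then Ioo l 0 else Ioo 0 r

/-- The renormalization of `f` with return interval `[p, q]` is of type `(α, β)`. -/
def HasRenormType (l r : ℝ) (f : ℝ → ℝ) (p q : ℝ) (α β : List (Fin 2)) : Prop :=
  2 ≤ α.length ∧ 2 ≤ β.length ∧
  (∀ x ∈ Icc p q ∩ Ioo l 0, returnTime f (Icc p q) x = α.length) ∧
  (∀ x ∈ Icc p q ∩ Ioo 0 r, returnTime f (Icc p q) x = β.length) ∧
  (∃ A, IsBranch l r f α.length A ∧ Icc p q ∩ Ioo l 0 ⊆ A ∧ HasWord l r f A α) ∧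
  (∃ B, IsBranch l r f β.length B ∧ Icc p q ∩ Ioo 0 r ⊆ B ∧ HasWord l r f B β)

/-- The Lorenz map `f` on `[l, r]` has a renormalization of type `(α, β)`, and its renormalization
is the Lorenz map `g` on `[l, r']`: with the return interval `[p, q]` and the linear map
`h x = (p / l) * x`, which sends `l` to `p`, one has `g = h⁻¹ ∘ (first return) ∘ h` on the
interval `[l, r'] = h⁻¹ [p, q]`. -/
def IsRenormalization (ρ : ℝ) (α β : List (Fin 2)) (l r : ℝ) (f : ℝ → ℝ) (r' : ℝ) (g : ℝ → ℝ) :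
    Prop :=
  IsLorenzMap ρ l r f ∧ IsLorenzMap ρ l r' g ∧
  ∃ p q : ℝ, IsRenormInterval ρ l r f p q ∧ HasRenormType l r f p q α β ∧
    p / l * r' = q ∧
    ∀ x ∈ Icc l r' \ {0}, g x = (p / l)⁻¹ * firstReturn f (Icc p q) (p / l * x)

/-! ### The Banach space of analytic Lorenz maps with critical exponent `2` -/

/-- Symmetric analytic functions `∑ aₖ zᵏ` on the unit disk with `aₖ` real and norm `∑ |aₖ|`
finite, given by their Taylor coefficients. -/
abbrev X := lp (fun _ : ℕ => ℝ) 1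

/-- Pairs of such functions, with the norm `‖(f, g)‖ = ‖f‖ + ‖g‖`. -/
abbrev Y := WithLp 1 (X × X)

/-- The value at a real point of the function with Taylor coefficients `a`. -/
def value (a : X) (x : ℝ) : ℝ := ∑' k : ℕ, a k * x ^ k

/-- Radius of the disk `|z - 1| < s` on which the left analytic part is defined. -/
def s : ℝ := 11 / 5

/-- Radius of the disk `|z| < t` on which the right analytic part is defined. -/
def t : ℝ := 1 / 2

/-- The left analytic part `φ z = f ((z - 1) / s)` of the map with coordinates `y = (f, g)`. -/
def leftPart (y : Y) (u : ℝ) : ℝ := value y.fst ((u - 1) / s)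

/-- The right analytic part `ψ z = -1 + z * g (z / t)` of the map with coordinates
`y = (f, g)`. -/
def rightPart (y : Y) (u : ℝ) : ℝ := -1 + u * value y.snd (u / t)

/-- The map with coordinates `y`: `φ (x ^ 2)` to the left of `0`, `ψ (x ^ 2)` to the right. -/
def toMap (y : Y) (x : ℝ) : ℝ := if x < 0 then leftPart y (x ^ 2) else rightPart y (x ^ 2)

/-- The right endpoint `r = φ 0` of the domain `[-1, r]` of the map with coordinates `y`. -/
def rightEnd (y : Y) : ℝ := leftPart y 0

/-- In the coordinates of `Y`: the point `y` represents a Lorenz map on `[-1, r]` with critical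
exponent `2` which has a renormalization of type `(α, β)`, and this renormalization is the Lorenz
map represented by `y'`. The inequalities say that the intervals `[0, r ^ 2]` lie in the
disk `|z| < t`. -/
def RenormRel (α β : List (Fin 2)) (y y' : Y) : Prop :=
  rightEnd y ^ 2 < t ∧ rightEnd y' ^ 2 < t ∧
    IsRenormalization 2 α β (-1) (rightEnd y) (toMap y) (rightEnd y') (toMap y')

/-- The domain in `Y` of the restricted renormalization operator of type `(α, β)`. -/
def renormDomain (α β : List (Fin 2)) : Set Y := {y | ∃ y', RenormRel α β y y'}

open Classical in
/-- The restricted renormalization operator of type `(α, β)` in the coordinates of `Y`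
(with value `0` outside its domain); see `renormRel_unique`. -/
def renormOp (α β : List (Fin 2)) (y : Y) : Y :=
  if h : ∃ y', RenormRel α β y y' then h.choose else 0

/-! ### Hyperbolic fixed points -/

section Hyperbolic

variable {E : Type*} [NormedAddCommGroup E] [NormedSpace ℝ E]

/-- The operator `A - μ` on the complexification `E ⊕ iE` of the real space `E`, where `(u, v)`
stands for `u + iv`. -/
def complexShift (A : E →L[ℝ] E) (μ : ℂ) : (E × E) →L[ℝ] (E × E) :=
  (A ∘L ContinuousLinearMap.fst ℝ E E - μ.re • ContinuousLinearMap.fst ℝ E E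
      + μ.im • ContinuousLinearMap.snd ℝ E E).prod
    (A ∘L ContinuousLinearMap.snd ℝ E E - μ.re • ContinuousLinearMap.snd ℝ E E
      - μ.im • ContinuousLinearMap.fst ℝ E E)

/-- The (complex) spectrum of a bounded operator on a real Banach space, that is, the spectrum of
its complexification. -/
def complexSpectrum (A : E →L[ℝ] E) : Set ℂ := {μ | ¬ IsUnit (complexShift A μ)}

/-- `x` is a hyperbolic fixed point of the operator `T` with domain `D`: `T` is defined and
continuously Fréchet differentiable near `x`, `T x = x`, and the spectrum of the derivative of `T`
at `x` does not meet the unit circle. -/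
structure IsHyperbolicFixedPoint (D : Set E) (T : E → E) (x : E) : Prop where
  mem_nhds : D ∈ 𝓝 x
  fixed : T x = x
  contDiffAt : ContDiffAt ℝ 1 T x
  hyperbolic : Disjoint (complexSpectrum (fderiv ℝ T x)) (Metric.sphere (0 : ℂ) 1)

end Hyperbolic

/-! ### The renormalization operator is single valued -/

theorem value_hasFPowerSeries (a : X) :
    HasFPowerSeriesAt (value a) (FormalMultilinearSeries.ofScalars ℝ (fun k => a k)) 0 := by
  set p := FormalMultilinearSeries.ofScalars ℝ (fun k => a k) with hp
  have hsum : Summable fun k => ‖a k‖ := by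
    have h := (lp.memℓp a).summable (by simp)
    simpa using h
  have hr : ((1 : NNReal) : ENNReal) ≤ p.radius := by
    apply p.le_radius_of_summable
    simpa [hp, FormalMultilinearSeries.ofScalars_norm] using hsum
  have hpos : 0 < p.radius := lt_of_lt_of_le (by simp) hr
  have h := (p.hasFPowerSeriesOnBall hpos).hasFPowerSeriesAt
  have he : value a = p.sum := by
    funext x
    simp [value, FormalMultilinearSeries.sum, hp, mul_comm]
  rw [he]
  exact h

theorem coeff_unique (a b : X) (h : ∃ᶠ x in 𝓝[≠] (0 : ℝ), value a x = value b x) : a = b := by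
  have ha := value_hasFPowerSeries a
  have hb := value_hasFPowerSeries b
  have h1 := (ha.analyticAt.frequently_eq_iff_eventually_eq hb.analyticAt).1 h
  have h2 := ha.eq_formalMultilinearSeries_of_eventually hb h1
  ext k
  have := congrArg (fun p => FormalMultilinearSeries.coeff p k) h2
  simpa using this

theorem renormRel_unique {α β : List (Fin 2)} {y y₁ y₂ : Y} (h₁ : RenormRel α β y y₁)
    (h₂ : RenormRel α β y y₂) : y₁ = y₂ := by
  obtain ⟨-, -, -, L₁, p, q, I₁, -, e₁, E₁⟩ := h₁
  obtain ⟨-, -, -, L₂, p', q', I₂, -, e₂, E₂⟩ := h₂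
  have hp := I₁.2.1.2.left_neg
  have hq := I₁.2.1.2.right_pos
  have hp' := I₂.2.1.2.left_neg
  have hq' := I₂.2.1.2.right_pos
  have s₁ := (Icc_subset_Icc_iff (by linarith)).1 (I₁.2.2 _ _ I₂.1 I₂.2.1)
  have s₂ := (Icc_subset_Icc_iff (by linarith)).1 (I₂.2.2 _ _ I₁.1 I₁.2.1)
  obtain rfl : p = p' := le_antisymm s₁.1 s₂.1
  obtain rfl : q = q' := le_antisymm s₂.2 s₁.2
  have hr : rightEnd y₁ = rightEnd y₂ := by
    have h0 : p / (-1) ≠ 0 := by simpa using hp.ne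
    exact mul_left_cancel₀ h0 (e₁.trans e₂.symm)
  have hr0 := L₁.right_pos
  rw [← hr] at E₂
  have key : ∀ x ∈ Icc (-1) (rightEnd y₁) \ {0}, toMap y₁ x = toMap y₂ x :=
    fun x hx => (E₁ x hx).trans (E₂ x hx).symm
  have hfst : y₁.fst = y₂.fst := by
    apply coeff_unique
    have hev : ∀ᶠ w in 𝓝[<] (0 : ℝ), value y₁.fst w = value y₂.fst w := by
      filter_upwards [Ioo_mem_nhdsLT (show (-(5 / 11) : ℝ) < 0 by norm_num)] with w hw
      have h1 : 0 < 1 + s * w := by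
        have := hw.1
        unfold s
        linarith
      have h2 : 1 + s * w ≤ 1 := by
        have := hw.2
        unfold s
        linarith
      have hx0 : 0 < √(1 + s * w) := Real.sqrt_pos.2 h1
      have hx1 : √(1 + s * w) ≤ 1 := Real.sqrt_le_one.2 h2
      have := key (-√(1 + s * w)) ⟨⟨by linarith, by linarith⟩, by simpa using hx0.ne'⟩
      have hw' : s * w / s = w := by
        unfold s
        ring
      simpa [toMap, leftPart, hx0, Real.sq_sqrt h1.le, hw'] using this
    exact hev.frequently.filter_mono (nhdsLT_le_nhdsNE 0)
  have hsnd : y₁.snd = y₂.snd := by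
    apply coeff_unique
    have hev : ∀ᶠ w in 𝓝[>] (0 : ℝ), value y₁.snd w = value y₂.snd w := by
      filter_upwards [Ioo_mem_nhdsGT (show (0 : ℝ) < rightEnd y₁ ^ 2 / t by
        unfold t
        positivity)] with w hw
      have ht : (0 : ℝ) < t := by
        unfold t
        norm_num
      have h1 : 0 < t * w := mul_pos ht hw.1
      have h2 : t * w ≤ rightEnd y₁ ^ 2 := by
        have := (lt_div_iff₀ ht).1 hw.2
        linarith
      have hx0 : 0 < √(t * w) := Real.sqrt_pos.2 h1
      have hx1 : √(t * w) ≤ rightEnd y₁ := (Real.sqrt_le_left hr0.le).2 h2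
      have := key (√(t * w)) ⟨⟨by linarith, hx1⟩, by simpa using hx0.ne'⟩
      have hw' : t * w / t = w := by field_simp
      simpa [toMap, rightPart, hx0.le.not_gt, Real.sq_sqrt h1.le, hw', ht.ne', hw.1.ne'] using this
    exact hev.frequently.filter_mono (nhdsGT_le_nhdsNE 0)
  exact WithLp.ofLp_injective 1 (Prod.ext hfst hsnd)

end

end LorenzRenorm

/-! Write φ, ψ for the two analytic parts of the map with coordinates (f, g). For type (01, 100) the
return interval is [p, q] with p = φ(φ(1)²) and q = ψ(r²). With λ = -p the renormalization has the
parts λ⁻¹ ψ(φ(λ²u)²) and λ⁻¹ φ(φ(ψ(λ²u)²)²). In the coordinates of `Y` this is the operator `opT`,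
an expression in the Banach algebra `X` (the Cauchy product on ℓ¹) made of sums, products, the
inverse of a constant, a backward shift, and compositions f ∘ h, g ∘ h. When ‖h‖ < 1, composition is
C¹ in both arguments and f ↦ f ∘ h is a norm limit of finite-rank operators. Hence `opT` is C¹ with
compact derivative wherever its inner functions have norm below 1 and λ is invertible
(`Admissible`).

The fixed point comes from a Newton-like iteration with rigorous numerics. Let y₀ be a polynomial
approximation, M = `frame` an isomorphism whose columns are three approximate eigenvectors and
otherwise multiples of monomials, and D = `damping` diagonal with entries θ = -1/22, -1/11, 1, 1,
.... With P = D M⁻¹ = `precond`, the map x ↦ x + P(T(y₀ + Mx) - (y₀ + Mx)) has derivative 1 +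
D(M⁻¹T'M - 1). An eigenvalue μ of T' in a coordinate direction becomes 1 + θ(μ - 1). This vanishes
at μ = 23 and μ = 12, the approximate expanding eigenvalues, and equals μ in the remaining
directions, which are contracted. On ℓ¹ the operator norm is the supremum of the column norms.
Integer ball arithmetic, evaluated by the kernel, bounds every column by 3/4 on a whole
neighbourhood of y₀, all degrees from 12 on being treated at once (`columnsOK_eq`,
`norm_column_le`). The preconditioned residual is at most a fifth of the radius (`residualOK_eq`),
so the contraction principle applies (`exists_fixed_of_columns`).

The same column bound gives hyperbolicity, without locating any eigenvalue. If T'u = μu in the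
complexification with |μ| = 1, then 1 + D(M⁻¹T'M - 1) multiplies the i-th coordinate of M⁻¹u by 1 +
θᵢ(μ - 1). This factor has modulus at least 1: for θᵢ ≤ 0 because Re μ ≤ 1, and for θᵢ = 1 because
it is μ. As the operator has norm at most 3/4, u = 0; compactness turns the absence of eigenvectors
into invertibility (`disjoint_complexSpectrum_of_columns`).

It remains to see that `opT` is the renormalization operator near the fixed point. Finitely many
inequalities on critical orbits, again checked by ball arithmetic (`Good`, `Near.good`), make every
nearby point a Lorenz map and fix the itineraries. The first-return map to [p, q] is then a
rescaling of the map of `opT y`, and `ReturnIsLorenz.subset_Icc` shows that no return interval is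
larger. Thus `opT y` is the unique renormalization of y (`Good.renormRel`), and fixed point,
smoothness and spectrum carry over. -/

namespace LorenzRenorm

open Set Filter Topology

noncomputable section

/-! ### The convolution algebra `X` -/

namespace X

theorem summable_abs (a : X) : Summable fun k => |a k| := by
  have h := (lp.memℓp a).summable (by simp)
  simpa using h

theorem norm_eq (a : X) : ‖a‖ = ∑' k, |a k| := by
  simpa using lp.norm_eq_tsum_rpow (p := 1) (by simp) a

theorem hasSum_abs (a : X) : HasSum (fun k => |a k|) ‖a‖ := by
  rw [norm_eq]
  exact (summable_abs a).hasSum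

/-- The element of `X` with given absolutely summable coefficients. -/
def mk (a : ℕ → ℝ) (h : Summable fun k => |a k|) : X :=
  ⟨a, memℓp_gen (by simpa using h)⟩

@[simp] theorem mk_apply (a : ℕ → ℝ) (h : Summable fun k => |a k|) (k : ℕ) : mk a h k = a k := rfl

theorem add_apply' (a b : X) (k : ℕ) : (a + b : X) k = a k + b k := rfl

theorem sub_apply' (a b : X) (k : ℕ) : (a - b : X) k = a k - b k := rfl

theorem smul_apply' (c : ℝ) (a : X) (k : ℕ) : (c • a : X) k = c * a k := rfl

theorem abs_apply_le (a : X) (k : ℕ) : |a k| ≤ ‖a‖ := by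
  simpa using lp.norm_apply_le_norm (p := 1) (by simp) a k

/-- The coefficients of the Cauchy product. -/
def conv (a b : X) (n : ℕ) : ℝ := ∑ kl ∈ Finset.HasAntidiagonal.antidiagonal n, a kl.1 * b kl.2

theorem summable_conv (a b : X) : Summable fun n => |conv a b n| :=
  summable_norm_sum_mul_antidiagonal_of_summable_norm (f := fun k => a k) (g := fun k => b k)
    (summable_abs a) (summable_abs b)

/-- The power series of an element of `X`. -/
def toPS (a : X) : PowerSeries ℝ := PowerSeries.mk fun k => a k

/-- The ring axioms for the Cauchy product on `X` are pulled back from formal power series along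
this embedding. -/
theorem toPS_injective : Function.Injective toPS := by
  intro a b h
  ext k
  have := congrArg (PowerSeries.coeff k) h
  simpa [toPS] using this

scoped instance : Mul X := ⟨fun a b => mk (conv a b) (summable_conv a b)⟩

scoped instance : One X := ⟨lp.single (E := fun _ : ℕ => ℝ) 1 0 1⟩

theorem coeff_mul (a b : X) (n : ℕ) :
    (a * b : X) n = ∑ kl ∈ Finset.HasAntidiagonal.antidiagonal n, a kl.1 * b kl.2 := rfl

theorem coeff_one (n : ℕ) : (1 : X) n = if n = 0 then 1 else 0 := by
  change lp.single (E := fun _ : ℕ => ℝ) 1 0 (1 : ℝ) n = _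
  rw [lp.single_apply]
  simp [Pi.single_apply]

theorem toPS_mul (a b : X) : toPS (a * b) = toPS a * toPS b := by
  ext n
  rw [PowerSeries.coeff_mul]
  simp only [toPS, PowerSeries.coeff_mk]
  exact coeff_mul a b n

theorem toPS_one : toPS 1 = 1 := by
  ext n
  simp [toPS, PowerSeries.coeff_one, coeff_one]

theorem toPS_add (a b : X) : toPS (a + b) = toPS a + toPS b := by
  ext n
  simp [toPS]

theorem toPS_zero : toPS 0 = 0 := by
  ext n
  simp [toPS]

scoped instance : CommRing X :=
  { (inferInstance : AddCommGroup X) with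
    mul := (· * ·)
    one := 1
    mul_assoc := fun a b c => toPS_injective (by simp only [toPS_mul, mul_assoc])
    one_mul := fun a => toPS_injective (by simp only [toPS_mul, toPS_one, one_mul])
    mul_one := fun a => toPS_injective (by simp only [toPS_mul, toPS_one, mul_one])
    left_distrib := fun a b c => toPS_injective (by simp only [toPS_mul, toPS_add, mul_add])
    right_distrib := fun a b c => toPS_injective (by simp only [toPS_mul, toPS_add, add_mul])
    zero_mul := fun a => toPS_injective (by simp only [toPS_mul, toPS_zero, zero_mul])
    mul_zero := fun a => toPS_injective (by simp only [toPS_mul, toPS_zero, mul_zero])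
    mul_comm := fun a b => toPS_injective (by simp only [toPS_mul, mul_comm]) }

theorem norm_mul_le' (a b : X) : ‖a * b‖ ≤ ‖a‖ * ‖b‖ := by
  rw [norm_eq, norm_eq a, norm_eq b,
    tsum_mul_tsum_eq_tsum_sum_antidiagonal_of_summable_norm (summable_abs a).norm
      (summable_abs b).norm]
  have h := summable_norm_sum_mul_antidiagonal_of_summable_norm (summable_abs a).norm
      (summable_abs b).norm
  refine (summable_conv a b).tsum_le_tsum (fun n => ?_) (Summable.of_norm h)
  rw [coeff_mul]
  refine le_trans (Finset.abs_sum_le_sum_abs _ _) (le_of_eq ?_)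
  simp only [abs_mul]

scoped instance : NormedCommRing X :=
  { (inferInstance : NormedAddCommGroup X), (inferInstance : CommRing X) with
    norm_mul_le := norm_mul_le' }

theorem smul_mul (c : ℝ) (a b : X) : (c • a) * b = c • (a * b) := by
  ext n
  rw [coeff_mul, smul_apply', coeff_mul, Finset.mul_sum]
  refine Finset.sum_congr rfl fun kl _ => ?_
  rw [smul_apply', mul_assoc]

scoped instance : NormedAlgebra ℝ X :=
  { Algebra.ofModule smul_mul (fun c a b => by rw [mul_comm, smul_mul, mul_comm]) with
    norm_smul_le := fun c a => (norm_smul c a).le }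

scoped instance : NormOneClass X := ⟨by
  change ‖(lp.single 1 0 (1 : ℝ) : X)‖ = 1
  rw [lp.norm_single (by simp)]
  simp⟩

/-- The monomial of degree one. -/
def Z : X := lp.single (E := fun _ : ℕ => ℝ) 1 1 1

theorem Z_apply (n : ℕ) : Z n = if n = 1 then 1 else 0 := by
  change lp.single (E := fun _ : ℕ => ℝ) 1 1 (1 : ℝ) n = _
  rw [lp.single_apply]
  simp [Pi.single_apply]

theorem norm_Z : ‖Z‖ = 1 := by
  change ‖(lp.single 1 1 (1 : ℝ) : X)‖ = 1
  rw [lp.norm_single (by simp)]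
  simp

theorem Z_mul_zero (a : X) : (Z * a) 0 = 0 := by
  rw [coeff_mul]
  simp [Z_apply]

theorem Z_mul_succ (a : X) (n : ℕ) : (Z * a) (n + 1) = a n := by
  rw [coeff_mul, Finset.sum_eq_single (1, n)]
  · simp [Z_apply]
  · rintro ⟨i, j⟩ hij hne
    have : i ≠ 1 := by
      rintro rfl
      rw [Finset.HasAntidiagonal.mem_antidiagonal] at hij
      apply hne
      congr 1
      simp only at hij
      omega
    simp [Z_apply, this]
  · intro h
    exact absurd (Finset.HasAntidiagonal.mem_antidiagonal.2 (add_comm 1 n)) h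

theorem Z_pow_apply (k n : ℕ) : (Z ^ k) n = if n = k then 1 else 0 := by
  induction k generalizing n with
  | zero => simp [coeff_one]
  | succ k ih =>
    rw [pow_succ']
    cases n with
    | zero => rw [Z_mul_zero]; simp
    | succ n => rw [Z_mul_succ, ih]; simp

theorem single_eq (k : ℕ) (c : ℝ) : (lp.single 1 k c : X) = c • Z ^ k := by
  ext n
  rw [lp.single_apply]
  simp [Pi.single_apply, Z_pow_apply]

theorem hasSum_Z_pow (a : X) : HasSum (fun k => a k • Z ^ k) a := by
  simpa only [single_eq] using lp.hasSum_single (p := 1) (by simp) a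

theorem norm_Z_pow (k : ℕ) : ‖Z ^ k‖ = 1 := by
  have := single_eq k 1
  rw [one_smul] at this
  rw [← this, lp.norm_single (by simp)]
  simp

/-- The `k`-th coefficient. -/
def coeff (k : ℕ) : X →L[ℝ] ℝ := lp.evalCLM ℝ (fun _ : ℕ => ℝ) 1 k

@[simp] theorem coeff_apply (k : ℕ) (a : X) : coeff k a = a k := rfl

/-- The constant term, as an element of `X`. -/
def constPart : X →L[ℝ] X := (coeff 0).smulRight 1

@[simp] theorem constPart_apply (a : X) : constPart a = a 0 • (1 : X) := rfl

theorem norm_constPart_le (a : X) : ‖constPart a‖ ≤ ‖a‖ := by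
  rw [constPart_apply, norm_smul, norm_one, mul_one]
  exact abs_apply_le a 0

theorem summable_shift (a : X) : Summable fun k => |a (k + 1)| :=
  (summable_nat_add_iff 1).2 (summable_abs a)

theorem sum_shift (a : X) : |a 0| + ∑' k, |a (k + 1)| = ‖a‖ := by
  rw [norm_eq, (summable_abs a).tsum_eq_zero_add]

/-- The backward shift `a ↦ (a - a 0) / z`. -/
def shift : X →L[ℝ] X :=
  LinearMap.mkContinuous
    { toFun := fun a => mk (fun k => a (k + 1)) (summable_shift a)
      map_add' := fun a b => by ext k; simp
      map_smul' := fun c a => by ext k; simp } 1 (fun a => by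
    rw [one_mul, ← sum_shift a, norm_eq]
    change ∑' k, |a (k + 1)| ≤ _
    linarith [abs_nonneg (a 0)])

@[simp] theorem shift_apply (a : X) (k : ℕ) : shift a k = a (k + 1) := rfl

theorem norm_shift_le (a : X) : ‖shift a‖ ≤ ‖a‖ := by
  rw [← sum_shift a, norm_eq]
  simp only [shift_apply]
  linarith [abs_nonneg (a 0)]

theorem eq_add_Z_mul_shift (a : X) : a = a 0 • (1 : X) + Z * shift a := by
  ext n
  cases n with
  | zero =>
    rw [add_apply', smul_apply', Z_mul_zero, coeff_one]
    simp
  | succ n =>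
    rw [add_apply', smul_apply', Z_mul_succ, coeff_one]
    simp

theorem shift_smul_one (c : ℝ) : shift (c • (1 : X)) = 0 := by
  ext n
  simp [coeff_one]

theorem shift_Z_mul (a : X) : shift (Z * a) = a := by
  ext n
  simp [Z_mul_succ]

end X

open scoped X

/-! ### Values -/

theorem summable_value (a : X) {x : ℝ} (hx : |x| ≤ 1) : Summable fun k => ‖a k * x ^ k‖ := by
  refine (X.summable_abs a).of_nonneg_of_le (fun _ => norm_nonneg _) fun k => ?_
  rw [Real.norm_eq_abs, abs_mul, abs_pow]
  exact mul_le_of_le_one_right (abs_nonneg _) (pow_le_one₀ (abs_nonneg _) hx)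

theorem abs_value_le (a : X) {x : ℝ} (hx : |x| ≤ 1) : |value a x| ≤ ‖a‖ := by
  rw [X.norm_eq]
  refine (norm_tsum_le_tsum_norm (f := fun k => a k * x ^ k) (summable_value a hx)).trans ?_
  refine (summable_value a hx).tsum_le_tsum (fun k => ?_) (X.summable_abs a)
  rw [Real.norm_eq_abs, abs_mul, abs_pow]
  exact mul_le_of_le_one_right (abs_nonneg _) (pow_le_one₀ (abs_nonneg _) hx)

theorem value_add (a b : X) {x : ℝ} (hx : |x| ≤ 1) : value (a + b) x = value a x + value b x := by
  have h := (summable_value a hx).of_norm.tsum_add (summable_value b hx).of_norm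
  rw [value, value, value, ← h]
  exact tsum_congr fun k => add_mul _ _ _

theorem value_smul (c : ℝ) (a : X) (x : ℝ) : value (c • a) x = c * value a x := by
  rw [value, value, ← tsum_mul_left]
  exact tsum_congr fun k => mul_assoc _ _ _

/-- Evaluation at a point of `[-1, 1]`. -/
def evalAt {x : ℝ} (hx : |x| ≤ 1) : X →L[ℝ] ℝ :=
  LinearMap.mkContinuous
    { toFun := fun a => value a x
      map_add' := fun a b => value_add a b hx
      map_smul' := fun c a => value_smul c a x } 1 (fun a => by
    rw [one_mul]
    exact abs_value_le a hx)

@[simp] theorem evalAt_apply {x : ℝ} (hx : |x| ≤ 1) (a : X) : evalAt hx a = value a x := rfl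

theorem value_mul (a b : X) {x : ℝ} (hx : |x| ≤ 1) : value (a * b) x = value a x * value b x := by
  have h := tsum_mul_tsum_eq_tsum_sum_antidiagonal_of_summable_norm
    (f := fun k => a k * x ^ k) (g := fun k => b k * x ^ k) (summable_value a hx)
    (summable_value b hx)
  rw [value, value, value, h]
  refine tsum_congr fun n => ?_
  rw [X.coeff_mul, Finset.sum_mul]
  refine Finset.sum_congr rfl fun kl hkl => ?_
  rw [← Finset.HasAntidiagonal.mem_antidiagonal.1 hkl, pow_add]
  ring

theorem value_one (x : ℝ) : value 1 x = 1 := by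
  unfold value
  rw [tsum_eq_single 0]
  · simp [X.coeff_one]
  · intro k hk
    simp [X.coeff_one, hk]

theorem value_Z (x : ℝ) : value X.Z x = x := by
  unfold value
  rw [tsum_eq_single 1]
  · simp [X.Z_apply]
  · intro k hk
    simp [X.Z_apply, hk]

theorem value_pow (a : X) {x : ℝ} (hx : |x| ≤ 1) (k : ℕ) : value (a ^ k) x = value a x ^ k := by
  induction k with
  | zero => simp [value_one]
  | succ k ih => rw [pow_succ, pow_succ, value_mul _ _ hx, ih]

theorem value_sub (a b : X) {x : ℝ} (hx : |x| ≤ 1) : value (a - b) x = value a x - value b x :=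
  map_sub (evalAt hx) a b

theorem value_neg (a : X) {x : ℝ} (hx : |x| ≤ 1) : value (-a) x = -value a x :=
  map_neg (evalAt hx) a

theorem value_zero_right (a : X) : value a 0 = a 0 := by
  unfold value
  rw [tsum_eq_single 0]
  · simp
  · intro k hk
    simp [hk]

theorem value_shift (a : X) {x : ℝ} (hx : |x| ≤ 1) : value a x = a 0 + x * value (X.shift a) x := by
  conv_lhs => rw [X.eq_add_Z_mul_shift a]
  rw [value_add _ _ hx, value_smul, value_one, value_mul _ _ hx, value_Z, mul_one]

end

end LorenzRenorm

namespace LorenzRenorm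

open Set Filter Topology

open scoped X

noncomputable section

/-! ### Composition in `X` -/

/-- The composition `f ∘ h = ∑ fₖ hᵏ`. -/
def comp (f h : X) : X := ∑' k, f k • h ^ k

/-- The composition `f' ∘ h = ∑ k fₖ hᵏ⁻¹`. -/
def dcomp (f h : X) : X := ∑' k, (f k * k) • h ^ (k - 1)

theorem norm_smul_pow_le (f : X) {h : X} (hh : ‖h‖ ≤ 1) (k : ℕ) : ‖f k • h ^ k‖ ≤ |f k| := by
  rw [norm_smul, Real.norm_eq_abs]
  exact mul_le_of_le_one_right (abs_nonneg _)
    ((norm_pow_le h k).trans (pow_le_one₀ (norm_nonneg _) hh))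

theorem summable_comp (f : X) {h : X} (hh : ‖h‖ ≤ 1) : Summable fun k => f k • h ^ k :=
  Summable.of_norm_bounded (X.summable_abs f) (norm_smul_pow_le f hh)

theorem norm_comp_le (f : X) {h : X} (hh : ‖h‖ ≤ 1) : ‖comp f h‖ ≤ ‖f‖ :=
  tsum_of_norm_bounded (X.hasSum_abs f) (norm_smul_pow_le f hh)

/-- Composition with `h` from the right, as a continuous linear map. -/
def compL {h : X} (hh : ‖h‖ ≤ 1) : X →L[ℝ] X :=
  LinearMap.mkContinuous
    { toFun := fun f => comp f h
      map_add' := fun f g => by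
        rw [comp, comp, comp, ← (summable_comp f hh).tsum_add (summable_comp g hh)]
        exact tsum_congr fun k => add_smul _ _ _
      map_smul' := fun c f => by
        rw [RingHom.id_apply, comp, comp, ← (summable_comp f hh).tsum_const_smul]
        exact tsum_congr fun k => mul_smul _ _ _ } 1 (fun f => by
    rw [one_mul]
    exact norm_comp_le f hh)

@[simp] theorem compL_apply {h : X} (hh : ‖h‖ ≤ 1) (f : X) : compL hh f = comp f h := rfl

theorem comp_add (f g : X) {h : X} (hh : ‖h‖ ≤ 1) : comp (f + g) h = comp f h + comp g h :=
  map_add (compL hh) f g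

theorem comp_sub (f g : X) {h : X} (hh : ‖h‖ ≤ 1) : comp (f - g) h = comp f h - comp g h :=
  map_sub (compL hh) f g

theorem comp_smul (c : ℝ) (f : X) {h : X} (hh : ‖h‖ ≤ 1) : comp (c • f) h = c • comp f h :=
  map_smul (compL hh) c f

theorem comp_Z_pow (k : ℕ) (h : X) : comp (X.Z ^ k) h = h ^ k := by
  rw [comp, tsum_eq_single k]
  · simp [X.Z_pow_apply]
  · intro n hn
    simp [X.Z_pow_apply, hn]

theorem comp_one (h : X) : comp 1 h = 1 := by
  simpa using comp_Z_pow 0 h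

theorem comp_Z_mul (f : X) {h : X} (hh : ‖h‖ ≤ 1) : comp (X.Z * f) h = h * comp f h := by
  rw [comp, (summable_comp _ hh).tsum_eq_zero_add, X.Z_mul_zero, zero_smul, zero_add, comp,
    ← (summable_comp f hh).tsum_mul_left]
  refine tsum_congr fun k => ?_
  rw [X.Z_mul_succ, pow_succ', mul_smul_comm]

theorem value_comp (f : X) {h : X} (hh : ‖h‖ ≤ 1) {x : ℝ} (hx : |x| ≤ 1) :
    value (comp f h) x = value f (value h x) := by
  rw [← evalAt_apply hx, comp, (evalAt hx).map_tsum (summable_comp f hh), value]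
  refine tsum_congr fun k => ?_
  rw [evalAt_apply, value_smul, value_pow _ hx]

/-- Each of the k terms of 1 + x + ... + xᵏ⁻¹ is at least xᵏ⁻¹, and the sum is at most the full
geometric series. This is the source of the factor (1 - ‖h‖)⁻¹ in the bound for f' ∘ h. -/
theorem nat_mul_pow_le {x : ℝ} (h0 : 0 ≤ x) (h1 : x < 1) (k : ℕ) :
    k * x ^ (k - 1) ≤ (1 - x)⁻¹ := by
  have h2 : (k : ℝ) * x ^ (k - 1) ≤ ∑ i ∈ Finset.range k, x ^ i := by
    rw [← nsmul_eq_mul]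
    have := Finset.card_nsmul_le_sum (Finset.range k) (fun i => x ^ i) (x ^ (k - 1)) fun i hi => ?_
    · rwa [Finset.card_range] at this
    exact pow_le_pow_of_le_one h0 h1.le (Nat.le_sub_one_of_lt (Finset.mem_range.1 hi))
  refine h2.trans ?_
  rw [← tsum_geometric_of_lt_one h0 h1]
  exact (summable_geometric_of_lt_one h0 h1).sum_le_tsum _ fun i _ => pow_nonneg h0 i

theorem norm_dcomp_term_le (f : X) {h : X} (hh : ‖h‖ < 1) (k : ℕ) :
    ‖(f k * k) • h ^ (k - 1)‖ ≤ |f k| * (1 - ‖h‖)⁻¹ := by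
  rw [norm_smul, Real.norm_eq_abs, abs_mul, Nat.abs_cast, mul_assoc]
  refine mul_le_mul_of_nonneg_left ?_ (abs_nonneg _)
  exact (mul_le_mul_of_nonneg_left (norm_pow_le h _) (Nat.cast_nonneg k)).trans
    (nat_mul_pow_le (norm_nonneg _) hh k)

theorem summable_dcomp (f : X) {h : X} (hh : ‖h‖ < 1) :
    Summable fun k => (f k * k) • h ^ (k - 1) :=
  Summable.of_norm_bounded ((X.summable_abs f).mul_right _) (norm_dcomp_term_le f hh)

theorem norm_dcomp_le (f : X) {h : X} (hh : ‖h‖ < 1) : ‖dcomp f h‖ ≤ ‖f‖ * (1 - ‖h‖)⁻¹ :=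
  tsum_of_norm_bounded ((X.hasSum_abs f).mul_right _) (norm_dcomp_term_le f hh)

theorem dcomp_add (f g : X) {h : X} (hh : ‖h‖ < 1) : dcomp (f + g) h = dcomp f h + dcomp g h := by
  rw [dcomp, dcomp, dcomp, ← (summable_dcomp f hh).tsum_add (summable_dcomp g hh)]
  refine tsum_congr fun k => ?_
  rw [X.add_apply', add_mul, add_smul]

theorem dcomp_smul (c : ℝ) (f : X) {h : X} (hh : ‖h‖ < 1) : dcomp (c • f) h = c • dcomp f h := by
  rw [dcomp, dcomp, ← (summable_dcomp f hh).tsum_const_smul]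
  refine tsum_congr fun k => ?_
  rw [X.smul_apply', mul_assoc, mul_smul]

theorem dcomp_sub (f g : X) {h : X} (hh : ‖h‖ < 1) : dcomp (f - g) h = dcomp f h - dcomp g h := by
  rw [sub_eq_add_neg, ← neg_one_smul ℝ g, dcomp_add _ _ hh, dcomp_smul _ _ hh, neg_one_smul,
    sub_eq_add_neg]

theorem dcomp_one (h : X) : dcomp 1 h = 0 := by
  rw [dcomp, tsum_eq_single 0]
  · simp
  · intro n hn
    simp [X.coeff_one, hn]

/-- The product rule (z f)' = f + z f', composed with h. Recursion on it computes f' ∘ h for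
polynomials. -/
theorem dcomp_Z_mul (f : X) {h : X} (hh : ‖h‖ < 1) :
    dcomp (X.Z * f) h = comp f h + h * dcomp f h := by
  have h1 : ∀ k, ((X.Z * f) (k + 1) * ((k + 1 : ℕ) : ℝ)) • h ^ (k + 1 - 1) =
      f k • h ^ k + h * ((f k * k) • h ^ (k - 1)) := by
    intro k
    rw [X.Z_mul_succ, Nat.add_sub_cancel, Nat.cast_add, Nat.cast_one, mul_add, mul_one, add_smul,
      add_comm]
    congr 1
    rw [mul_smul_comm]
    cases k with
    | zero => simp
    | succ k => rw [Nat.add_sub_cancel, ← pow_succ']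
  rw [dcomp, (summable_dcomp _ hh).tsum_eq_zero_add, X.Z_mul_zero, zero_mul, zero_smul, zero_add,
    tsum_congr h1, (summable_comp f hh.le).tsum_add ((summable_dcomp f hh).mul_left h),
    (summable_dcomp f hh).tsum_mul_left]
  rfl

/-! ### The derivative of the composition -/

/-- The derivative of `(f, h) ↦ fₖ hᵏ`. -/
def compTermDeriv (k : ℕ) (p : X × X) : X × X →L[ℝ] X :=
  ((X.coeff k).comp (ContinuousLinearMap.fst ℝ X X)).smulRight (p.2 ^ k) +
    (ContinuousLinearMap.mul ℝ X ((p.1 k * k) • p.2 ^ (k - 1))).comp (ContinuousLinearMap.snd ℝ X X)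

theorem compTermDeriv_apply (k : ℕ) (p q : X × X) :
    compTermDeriv k p q = q.1 k • p.2 ^ k + (p.1 k * k) • p.2 ^ (k - 1) * q.2 := rfl

theorem hasFDerivAt_compTerm (k : ℕ) (p : X × X) :
    HasFDerivAt (fun p : X × X => p.1 k • p.2 ^ k) (compTermDeriv k p) p := by
  have h1 : HasFDerivAt (fun p : X × X => p.1 k)
      ((X.coeff k).comp (ContinuousLinearMap.fst ℝ X X)) p :=
    ((X.coeff k).comp (ContinuousLinearMap.fst ℝ X X)).hasFDerivAt
  have h2 : HasFDerivAt (fun p : X × X => p.2 ^ k) _ p :=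
    (ContinuousLinearMap.snd ℝ X X).hasFDerivAt.pow k
  refine (h1.smul h2).congr_fderiv ?_
  ext q
  · simp [compTermDeriv_apply]
  · simp only [compTermDeriv_apply, ContinuousLinearMap.coe_comp, Function.comp_apply]
    simp [mul_smul, nsmul_eq_mul, Nat.cast_smul_eq_nsmul, mul_assoc]

theorem norm_compTermDeriv_le {R ρ : ℝ} {p : X × X} (h1 : ‖p.1‖ ≤ R) (h2 : ‖p.2‖ ≤ ρ)
    (k : ℕ) : ‖compTermDeriv k p‖ ≤ ρ ^ k + R * (k * ρ ^ (k - 1)) := by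
  have hρ : 0 ≤ ρ := (norm_nonneg _).trans h2
  have hR : 0 ≤ R := (norm_nonneg _).trans h1
  refine ContinuousLinearMap.opNorm_le_bound _ (by positivity) fun q => ?_
  rw [compTermDeriv_apply, add_mul]
  refine (norm_add_le _ _).trans (add_le_add ?_ ?_)
  · rw [norm_smul, mul_comm]
    refine mul_le_mul ?_ ((X.abs_apply_le _ _).trans (norm_fst_le q)) (norm_nonneg _) (by positivity)
    exact (norm_pow_le _ _).trans (pow_le_pow_left₀ (norm_nonneg _) h2 _)
  · refine (norm_mul_le _ _).trans ?_
    refine mul_le_mul ?_ (norm_snd_le q) (norm_nonneg _) (by positivity)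
    rw [norm_smul, Real.norm_eq_abs, abs_mul, Nat.abs_cast, mul_assoc]
    refine mul_le_mul ((X.abs_apply_le _ _).trans h1) ?_ (by positivity) hR
    refine mul_le_mul_of_nonneg_left ?_ (Nat.cast_nonneg k)
    exact (norm_pow_le _ _).trans (pow_le_pow_left₀ (norm_nonneg _) h2 _)

theorem summable_bound (R : ℝ) {ρ : ℝ} (h0 : 0 < ρ) (h1 : ρ < 1) :
    Summable fun k : ℕ => ρ ^ k + R * (k * ρ ^ (k - 1)) := by
  refine (summable_geometric_of_lt_one h0.le h1).add (Summable.mul_left _ ?_)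
  have h := (summable_pow_mul_geometric_of_norm_lt_one 1 (r := ρ)
    (by rwa [Real.norm_eq_abs, abs_of_pos h0])).mul_left ρ⁻¹
  refine h.congr fun k => ?_
  cases k with
  | zero => simp
  | succ k =>
    rw [Nat.add_sub_cancel, pow_succ ρ k]
    field_simp

/-- The derivative of `(f, h) ↦ f ∘ h`. -/
def compDeriv (p : X × X) : X × X →L[ℝ] X := ∑' k, compTermDeriv k p

theorem compDeriv_apply {p : X × X} (hp : ‖p.2‖ < 1) (q : X × X) :
    compDeriv p q = comp q.1 p.2 + dcomp p.1 p.2 * q.2 := by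
  obtain ⟨ρ, hρ1, hρ2⟩ := exists_between hp
  have hs : Summable fun k => compTermDeriv k p :=
    Summable.of_norm_bounded (summable_bound ‖p.1‖ ((norm_nonneg _).trans_lt hρ1) hρ2)
      (norm_compTermDeriv_le le_rfl hρ1.le)
  rw [compDeriv, ← ContinuousLinearMap.apply_apply q (∑' k, compTermDeriv k p),
    (ContinuousLinearMap.apply ℝ X q).map_tsum hs]
  simp only [ContinuousLinearMap.apply_apply, compTermDeriv_apply]
  rw [(summable_comp q.1 hp.le).tsum_add ((summable_dcomp p.1 hp).mul_right q.2),
    (summable_dcomp p.1 hp).tsum_mul_right]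
  rfl

theorem isOpen_and_preconnected (R ρ : ℝ) :
    IsOpen (Metric.ball (0 : X) R ×ˢ Metric.ball (0 : X) ρ) ∧
      IsPreconnected (Metric.ball (0 : X) R ×ˢ Metric.ball (0 : X) ρ) :=
  ⟨Metric.isOpen_ball.prod Metric.isOpen_ball,
    ((convex_ball 0 R).prod (convex_ball 0 ρ)).isPreconnected⟩

/-- Termwise differentiation of ∑ fₖ hᵏ. On a product of balls of radii R and ρ < 1 the derivatives
of the terms are dominated by the summable ρᵏ + R k ρᵏ⁻¹; the product is convex, hence preconnected.
-/
theorem hasFDerivAt_comp {p : X × X} (hp : ‖p.2‖ < 1) :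
    HasFDerivAt (fun p : X × X => comp p.1 p.2) (compDeriv p) p := by
  obtain ⟨ρ, hρ1, hρ2⟩ := exists_between hp
  obtain ⟨R, hR⟩ := exists_gt ‖p.1‖
  have hmem : p ∈ Metric.ball (0 : X) R ×ˢ Metric.ball (0 : X) ρ := by
    simpa [mem_ball_zero_iff] using And.intro hR hρ1
  refine hasFDerivAt_tsum_of_isPreconnected
    (summable_bound R ((norm_nonneg _).trans_lt hρ1) hρ2) (isOpen_and_preconnected R ρ).1
    (isOpen_and_preconnected R ρ).2 (fun k q _ => hasFDerivAt_compTerm k q) (fun k q hq => ?_) hmem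
    (summable_comp p.1 hp.le) hmem
  simp only [mem_prod, mem_ball_zero_iff] at hq
  exact norm_compTermDeriv_le hq.1.le hq.2.le k

theorem contDiffAt_comp {p : X × X} (hp : ‖p.2‖ < 1) :
    ContDiffAt ℝ 1 (fun p : X × X => comp p.1 p.2) p := by
  obtain ⟨ρ, hρ1, hρ2⟩ := exists_between hp
  obtain ⟨R, hR⟩ := exists_gt ‖p.1‖
  have hmem : p ∈ Metric.ball (0 : X) R ×ˢ Metric.ball (0 : X) ρ := by
    simpa [mem_ball_zero_iff] using And.intro hR hρ1
  refine contDiffAt_one_iff.2 ⟨compDeriv, _, (isOpen_and_preconnected R ρ).1.mem_nhds hmem, ?_, ?_⟩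
  · refine continuousOn_tsum (fun k => Continuous.continuousOn ?_)
      (summable_bound R ((norm_nonneg _).trans_lt hρ1) hρ2) (fun k q hq => ?_)
    · have h1 : Continuous fun p : X × X => p.1 k := (X.coeff k).continuous.comp continuous_fst
      have h2 : Continuous fun p : X × X => p.2 ^ k := continuous_snd.pow k
      have h3 : Continuous fun p : X × X => (p.1 k * k) • p.2 ^ (k - 1) :=
        (h1.mul continuous_const).smul (continuous_snd.pow (k - 1))
      refine Continuous.add ?_ ?_
      · exact ((ContinuousLinearMap.smulRightL ℝ (X × X) X
          ((X.coeff k).comp (ContinuousLinearMap.fst ℝ X X))).continuous).comp h2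
      · exact ((ContinuousLinearMap.mul ℝ X).continuous.comp h3).clm_comp continuous_const
    · simp only [mem_prod, mem_ball_zero_iff] at hq
      exact norm_compTermDeriv_le hq.1.le hq.2.le k
  · intro q hq
    simp only [mem_prod, mem_ball_zero_iff] at hq
    exact hasFDerivAt_comp (hq.2.trans hρ2)

/-! ### Compactness -/

theorem isCompactOperator_smulRight {E F : Type*} [NormedAddCommGroup E] [NormedSpace ℝ E]
    [NormedAddCommGroup F] [NormedSpace ℝ F] (l : E →L[ℝ] ℝ) (v : F) :
    IsCompactOperator (l.smulRight v) := by
  have h1 : IsCompactOperator ((1 : ℝ →L[ℝ] ℝ).smulRight v) := isCompactOperator_id.clm_comp _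
  exact h1.comp_clm l

/-- The operator f ↦ ∑ fₖ hᵏ is a sum of rank-one operators of norm at most ‖h‖ᵏ, so its partial
sums converge in norm. -/
theorem isCompactOperator_compL {h : X} (hh : ‖h‖ < 1) : IsCompactOperator (compL hh.le) := by
  have hs : Summable fun k => (X.coeff k).smulRight (h ^ k) := by
    refine Summable.of_norm_bounded (summable_geometric_of_lt_one (norm_nonneg h) hh) fun k => ?_
    refine ContinuousLinearMap.opNorm_le_bound _ (by positivity) fun f => ?_
    rw [ContinuousLinearMap.smulRight_apply, norm_smul, mul_comm]
    exact mul_le_mul (norm_pow_le _ _) (X.abs_apply_le _ _) (norm_nonneg _) (by positivity)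
  have heq : ∑' k, (X.coeff k).smulRight (h ^ k) = compL hh.le := by
    ext1 f
    rw [← ContinuousLinearMap.apply_apply f (∑' k, (X.coeff k).smulRight (h ^ k)),
      (ContinuousLinearMap.apply ℝ X f).map_tsum hs]
    rfl
  have ht := hs.hasSum
  rw [heq] at ht
  refine isCompactOperator_of_tendsto ht (Eventually.of_forall fun t => ?_)
  induction t using Finset.induction_on with
  | empty =>
    rw [Finset.sum_empty]
    exact isCompactOperator_zero
  | insert k t hk ih =>
    rw [Finset.sum_insert hk]
    exact (isCompactOperator_smulRight _ _).add ih

end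

end LorenzRenorm

namespace LorenzRenorm

open Set Filter Topology

open scoped X

noncomputable section

/-! ### Functions with compact derivative -/

/-- `v` is continuously differentiable at `y`, with the compact derivative `D`. -/
structure HasCompactDeriv (v : Y → X) (D : Y →L[ℝ] X) (y : Y) : Prop where
  hasFDerivAt : HasFDerivAt v D y
  contDiffAt : ContDiffAt ℝ 1 v y
  isCompact : IsCompactOperator D

theorem isCompactOperator_comp {E F G : Type*} [NormedAddCommGroup E] [NormedSpace ℝ E]
    [NormedAddCommGroup F] [NormedSpace ℝ F] [NormedAddCommGroup G] [NormedSpace ℝ G]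
    (A : F →L[ℝ] G) {D : E →L[ℝ] F} (h : IsCompactOperator D) : IsCompactOperator (A.comp D) :=
  h.clm_comp A

theorem isCompactOperator_add {E F : Type*} [NormedAddCommGroup E] [NormedSpace ℝ E]
    [NormedAddCommGroup F] [NormedSpace ℝ F] {D D' : E →L[ℝ] F} (h : IsCompactOperator D)
    (h' : IsCompactOperator D') : IsCompactOperator (D + D') :=
  h.add h'

namespace HasCompactDeriv

variable {v w : Y → X} {D D' : Y →L[ℝ] X} {y : Y}

theorem add (hv : HasCompactDeriv v D y) (hw : HasCompactDeriv w D' y) :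
    HasCompactDeriv (fun y => v y + w y) (D + D') y :=
  ⟨hv.1.add hw.1, hv.2.add hw.2, hv.3.add hw.3⟩

theorem sub_const (hv : HasCompactDeriv v D y) (c : X) :
    HasCompactDeriv (fun y => v y - c) D y :=
  ⟨hv.1.sub_const c, hv.2.sub contDiffAt_const, hv.3⟩

theorem clm (hv : HasCompactDeriv v D y) (A : X →L[ℝ] X) :
    HasCompactDeriv (fun y => A (v y)) (A.comp D) y :=
  ⟨A.hasFDerivAt.comp y hv.1, A.contDiff.contDiffAt.comp y hv.2, hv.3.clm_comp A⟩

theorem neg (hv : HasCompactDeriv v D y) : HasCompactDeriv (fun y => -v y) (-D) y :=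
  ⟨hv.1.neg, hv.2.neg, hv.3.neg⟩

theorem smul (hv : HasCompactDeriv v D y) (c : ℝ) : HasCompactDeriv (fun y => c • v y) (c • D) y :=
  ⟨hv.1.const_smul c, hv.2.const_smul c, hv.3.smul c⟩

theorem mul (hv : HasCompactDeriv v D y) (hw : HasCompactDeriv w D' y) :
    HasCompactDeriv (fun y => v y * w y) ((ContinuousLinearMap.mul ℝ X (v y)).comp D' +
      (ContinuousLinearMap.mul ℝ X (w y)).comp D) y := by
  refine ⟨(hv.1.mul hw.1).congr_fderiv ?_, hv.2.mul hw.2,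
    isCompactOperator_add (isCompactOperator_comp _ hw.3) (isCompactOperator_comp _ hv.3)⟩
  ext1 η
  simp

/-- This is where compactness is gained: the coordinate projection `P` has no compact derivative of
its own, but it enters the derivative only through f ↦ f ∘ v, which is compact as ‖v‖ < 1. The other
term contains the compact `D`. -/
theorem comp {P : Y →L[ℝ] X} (hv : HasCompactDeriv v D y) (h : ‖v y‖ < 1) :
    HasCompactDeriv (fun y => LorenzRenorm.comp (P y) (v y))
      ((compDeriv (P y, v y)).comp (P.prod D)) y := by
  have h1 : HasFDerivAt (fun y => (P y, v y)) (P.prod D) y := P.hasFDerivAt.prodMk hv.1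
  have h3 : HasFDerivAt (fun p : X × X => LorenzRenorm.comp p.1 p.2) (compDeriv (P y, v y))
      (P y, v y) := hasFDerivAt_comp h
  have h4 : ContDiffAt ℝ 1 (fun p : X × X => LorenzRenorm.comp p.1 p.2) (P y, v y) :=
    contDiffAt_comp h
  refine ⟨h3.comp (f := fun y => (P y, v y)) y h1,
    h4.comp (f := fun y => (P y, v y)) y (P.contDiff.contDiffAt.prodMk hv.2), ?_⟩
  have h2 : (compDeriv (P y, v y)).comp (P.prod D) = (compL h.le).comp P +
      (ContinuousLinearMap.mul ℝ X (dcomp (P y) (v y))).comp D := by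
    ext1 η
    simp [compDeriv_apply (p := (P y, v y)) h]
  rw [h2]
  exact isCompactOperator_add ((isCompactOperator_compL h).comp_clm P)
    (isCompactOperator_comp _ hv.3)

theorem inverse (hv : HasCompactDeriv v D y) (h : IsUnit (v y)) :
    HasCompactDeriv (fun y => Ring.inverse (v y))
      (-(ContinuousLinearMap.mul ℝ X (Ring.inverse (v y) * Ring.inverse (v y))).comp D) y := by
  obtain ⟨x, hx⟩ := h
  have hc : ContDiffAt ℝ 1 (Ring.inverse : X → X) (v y) := by
    rw [← hx]
    exact contDiffAt_ringInverse ℝ x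
  have hd : HasFDerivAt (Ring.inverse : X → X)
      (-ContinuousLinearMap.mulLeftRight ℝ X ↑x⁻¹ ↑x⁻¹) (v y) := by
    rw [← hx]
    exact hasFDerivAt_ringInverse x
  refine ⟨(hd.comp y hv.1).congr_fderiv ?_, hc.comp y hv.2, (isCompactOperator_comp _ hv.3).neg⟩
  ext1 η
  rw [← hx, Ring.inverse_unit]
  simp [mul_right_comm]

end HasCompactDeriv

/-! ### The renormalization operator in coordinates -/

/-- The left Taylor series of a point of `Y`. -/
def fstL : Y →L[ℝ] X := WithLp.fstL 1 ℝ X X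

/-- The right Taylor series of a point of `Y`. -/
def sndL : Y →L[ℝ] X := WithLp.sndL 1 ℝ X X

@[simp] theorem fstL_apply (y : Y) : fstL y = y.fst := rfl

@[simp] theorem sndL_apply (y : Y) : sndL y = y.snd := rfl

theorem norm_Y (y : Y) : ‖y‖ = ‖y.fst‖ + ‖y.snd‖ := WithLp.prod_norm_eq_of_L1 y

/-- `(v ^ 2 - 1) / s`. -/
def sqNormalize (v : X) : X := (5 / 11 : ℝ) • (v * v - 1)

/-- The value at `-1`, as a constant. -/
def opA (y : Y) : X := X.constPart (fstL y)

/-- The argument in the definition of `opL`. -/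
def opK (y : Y) : X := sqNormalize (opA y)

/-- The scaling factor, as a constant. -/
def opL (y : Y) : X := -comp (fstL y) (opK y)

/-- The inverse of the scaling factor. -/
def opI (y : Y) : X := Ring.inverse (opL y)

/-- The square of the scaling factor. -/
def opQ (y : Y) : X := opL y * opL y

/-- The inner map of the right branch. -/
def opH₃ (y : Y) : X := X.Z * opQ y

/-- The inner map of the left branch. -/
def opH₁ (y : Y) : X := (5 / 11 : ℝ) • (opQ y - 1) + opH₃ y

/-- The first image of the left branch. -/
def opU (y : Y) : X := comp (fstL y) (opH₁ y)

/-- The square of `opU`. -/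
def opW (y : Y) : X := opU y * opU y

/-- The argument of the second Taylor series in the left branch. -/
def opH₂ (y : Y) : X := (2 : ℝ) • opW y

/-- The second Taylor series at `opH₂`. -/
def opG₂ (y : Y) : X := comp (sndL y) (opH₂ y)

/-- The second image of the left branch. -/
def opR (y : Y) : X := opW y * opG₂ y - 1

/-- The left Taylor series of the renormalization. -/
def opF (y : Y) : X := opI y * opR y

/-- The second Taylor series at `opH₃`. -/
def opG₃ (y : Y) : X := comp (sndL y) (opH₃ y)

/-- The first image of the right branch. -/
def opV₁ (y : Y) : X := (1 / 2 : ℝ) • (opH₃ y * opG₃ y) - 1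

/-- The argument of the first Taylor series at the second step. -/
def opH₄ (y : Y) : X := sqNormalize (opV₁ y)

/-- The second image of the right branch. -/
def opV₂ (y : Y) : X := comp (fstL y) (opH₄ y)

/-- The argument of the first Taylor series at the third step. -/
def opH₅ (y : Y) : X := sqNormalize (opV₂ y)

/-- The third image of the right branch. -/
def opV₃ (y : Y) : X := comp (fstL y) (opH₅ y)

/-- The right Taylor series of the renormalization. -/
def opG (y : Y) : X := (2 : ℝ) • X.shift (opI y * opV₃ y)

/-- The renormalization in coordinates. -/
def opT (y : Y) : Y := WithLp.toLp 1 (opF y, opG y)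

/-- The arguments of all compositions in `opT` are in the open unit ball. -/
structure Admissible (y : Y) : Prop where
  k : ‖opK y‖ < 1
  h₁ : ‖opH₁ y‖ < 1
  h₂ : ‖opH₂ y‖ < 1
  h₃ : ‖opH₃ y‖ < 1
  h₄ : ‖opH₄ y‖ < 1
  h₅ : ‖opH₅ y‖ < 1
  unit : IsUnit (opL y)

/-! ### Its derivative -/

/-- Multiplication as a linear map. -/
abbrev mulL (v : X) : X →L[ℝ] X := ContinuousLinearMap.mul ℝ X v

/-- The derivative of `sqNormalize ∘ v`. -/
def dSqNormalize (v : X) (D : Y →L[ℝ] X) : Y →L[ℝ] X :=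
  (5 / 11 : ℝ) • ((mulL v).comp D + (mulL v).comp D)

theorem HasCompactDeriv.sqNormalize {v : Y → X} {D : Y →L[ℝ] X} {y : Y}
    (h : HasCompactDeriv v D y) :
    HasCompactDeriv (fun y => LorenzRenorm.sqNormalize (v y)) (dSqNormalize (v y) D) y :=
  ((h.mul h).sub_const 1).smul _

theorem dSqNormalize_apply (v : X) (D : Y →L[ℝ] X) (η : Y) :
    dSqNormalize v D η = (10 / 11 : ℝ) • (v * D η) := by
  simp only [dSqNormalize, smul_apply, add_apply,
    ContinuousLinearMap.comp_apply, ContinuousLinearMap.mul_apply']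
  rw [← two_smul ℝ, smul_smul]
  norm_num

/-- The derivative of `opL`. -/
def dL (y : Y) : Y →L[ℝ] X :=
  -(compDeriv (fstL y, opK y)).comp (fstL.prod (dSqNormalize (opA y) (X.constPart.comp fstL)))

/-- The derivative of `opI`. -/
def dI (y : Y) : Y →L[ℝ] X := -(mulL (opI y * opI y)).comp (dL y)

/-- The derivative of `opQ`. -/
def dQ (y : Y) : Y →L[ℝ] X := (mulL (opL y)).comp (dL y) + (mulL (opL y)).comp (dL y)

/-- The derivative of `opH₃`. -/
def dH₃ (y : Y) : Y →L[ℝ] X := (mulL X.Z).comp (dQ y)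

/-- The derivative of `opU`. -/
def dU (y : Y) : Y →L[ℝ] X :=
  (compDeriv (fstL y, opH₁ y)).comp (fstL.prod ((5 / 11 : ℝ) • dQ y + dH₃ y))

/-- The derivative of `opW`. -/
def dW (y : Y) : Y →L[ℝ] X := (mulL (opU y)).comp (dU y) + (mulL (opU y)).comp (dU y)

/-- The derivative of `opG₂`. -/
def dG₂ (y : Y) : Y →L[ℝ] X := (compDeriv (sndL y, opH₂ y)).comp (sndL.prod ((2 : ℝ) • dW y))

/-- The derivative of `opF`. -/
def dF (y : Y) : Y →L[ℝ] X :=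
  (mulL (opI y)).comp ((mulL (opW y)).comp (dG₂ y) + (mulL (opG₂ y)).comp (dW y)) +
    (mulL (opR y)).comp (dI y)

/-- The derivative of `opG₃`. -/
def dG₃ (y : Y) : Y →L[ℝ] X := (compDeriv (sndL y, opH₃ y)).comp (sndL.prod (dH₃ y))

/-- The derivative of `opV₁`. -/
def dV₁ (y : Y) : Y →L[ℝ] X :=
  (1 / 2 : ℝ) • ((mulL (opH₃ y)).comp (dG₃ y) + (mulL (opG₃ y)).comp (dH₃ y))

/-- The derivative of `opV₂`. -/
def dV₂ (y : Y) : Y →L[ℝ] X :=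
  (compDeriv (fstL y, opH₄ y)).comp (fstL.prod (dSqNormalize (opV₁ y) (dV₁ y)))

/-- The derivative of `opV₃`. -/
def dV₃ (y : Y) : Y →L[ℝ] X :=
  (compDeriv (fstL y, opH₅ y)).comp (fstL.prod (dSqNormalize (opV₂ y) (dV₂ y)))

/-- The derivative of `opG`. -/
def dG (y : Y) : Y →L[ℝ] X :=
  (2 : ℝ) • X.shift.comp ((mulL (opI y)).comp (dV₃ y) + (mulL (opV₃ y)).comp (dI y))

/-- The derivative of `opT`. -/
def dT (y : Y) : Y →L[ℝ] Y :=
  ((WithLp.prodContinuousLinearEquiv 1 ℝ X X).symm : X × X →L[ℝ] Y).comp ((dF y).prod (dG y))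

@[simp] theorem dT_fst (y η : Y) : (dT y η).fst = dF y η := rfl

@[simp] theorem dT_snd (y η : Y) : (dT y η).snd = dG y η := rfl

/-- The base case of the calculus: the constant term is a rank-one operator. -/
theorem hasCompactDeriv_opA (y : Y) : HasCompactDeriv opA (X.constPart.comp fstL) y := by
  refine ⟨(X.constPart.comp fstL).hasFDerivAt, (X.constPart.comp fstL).contDiff.contDiffAt, ?_⟩
  exact (isCompactOperator_smulRight (X.coeff 0) (1 : X)).comp_clm fstL

section

variable {y : Y}

theorem hasCompactDeriv_opL (hy : Admissible y) : HasCompactDeriv opL (dL y) y :=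
  ((hasCompactDeriv_opA y).sqNormalize.comp (P := fstL) hy.k).neg

theorem hasCompactDeriv_opI (hy : Admissible y) : HasCompactDeriv opI (dI y) y :=
  (hasCompactDeriv_opL hy).inverse hy.unit

theorem hasCompactDeriv_opQ (hy : Admissible y) : HasCompactDeriv opQ (dQ y) y :=
  (hasCompactDeriv_opL hy).mul (hasCompactDeriv_opL hy)

theorem hasCompactDeriv_opH₃ (hy : Admissible y) : HasCompactDeriv opH₃ (dH₃ y) y :=
  (hasCompactDeriv_opQ hy).clm (mulL X.Z)

theorem hasCompactDeriv_opU (hy : Admissible y) : HasCompactDeriv opU (dU y) y :=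
  ((((hasCompactDeriv_opQ hy).sub_const 1).smul _).add (hasCompactDeriv_opH₃ hy)).comp
    (P := fstL) hy.h₁

theorem hasCompactDeriv_opW (hy : Admissible y) : HasCompactDeriv opW (dW y) y :=
  (hasCompactDeriv_opU hy).mul (hasCompactDeriv_opU hy)

theorem hasCompactDeriv_opG₂ (hy : Admissible y) : HasCompactDeriv opG₂ (dG₂ y) y :=
  ((hasCompactDeriv_opW hy).smul 2).comp (P := sndL) hy.h₂

theorem hasCompactDeriv_opF (hy : Admissible y) : HasCompactDeriv opF (dF y) y :=
  (hasCompactDeriv_opI hy).mul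
    (((hasCompactDeriv_opW hy).mul (hasCompactDeriv_opG₂ hy)).sub_const 1)

theorem hasCompactDeriv_opG₃ (hy : Admissible y) : HasCompactDeriv opG₃ (dG₃ y) y :=
  (hasCompactDeriv_opH₃ hy).comp (P := sndL) hy.h₃

theorem hasCompactDeriv_opV₁ (hy : Admissible y) : HasCompactDeriv opV₁ (dV₁ y) y :=
  (((hasCompactDeriv_opH₃ hy).mul (hasCompactDeriv_opG₃ hy)).smul _).sub_const 1

theorem hasCompactDeriv_opV₂ (hy : Admissible y) : HasCompactDeriv opV₂ (dV₂ y) y :=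
  (hasCompactDeriv_opV₁ hy).sqNormalize.comp (P := fstL) hy.h₄

theorem hasCompactDeriv_opV₃ (hy : Admissible y) : HasCompactDeriv opV₃ (dV₃ y) y :=
  (hasCompactDeriv_opV₂ hy).sqNormalize.comp (P := fstL) hy.h₅

theorem hasCompactDeriv_opG (hy : Admissible y) : HasCompactDeriv opG (dG y) y :=
  (((hasCompactDeriv_opI hy).mul (hasCompactDeriv_opV₃ hy)).clm X.shift).smul 2

theorem hasFDerivAt_opT (hy : Admissible y) : HasFDerivAt opT (dT y) y :=
  (WithLp.prodContinuousLinearEquiv 1 ℝ X X).symm.hasFDerivAt.comp y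
    ((hasCompactDeriv_opF hy).1.prodMk (hasCompactDeriv_opG hy).1)

theorem contDiffAt_opT (hy : Admissible y) : ContDiffAt ℝ 1 opT y :=
  (WithLp.prodContinuousLinearEquiv 1 ℝ X X).symm.contDiff.contDiffAt.comp y
    ((hasCompactDeriv_opF hy).2.prodMk (hasCompactDeriv_opG hy).2)

theorem isCompactOperator_dT (hy : Admissible y) : IsCompactOperator (dT y) := by
  have h1 := (hasCompactDeriv_opF hy).3.clm_comp (ContinuousLinearMap.inl ℝ X X)
  have h2 := (hasCompactDeriv_opG hy).3.clm_comp (ContinuousLinearMap.inr ℝ X X)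
  have h3 : IsCompactOperator ((dF y).prod (dG y)) := by
    have h4 : ⇑((dF y).prod (dG y)) = ContinuousLinearMap.inl ℝ X X ∘ dF y +
        ContinuousLinearMap.inr ℝ X X ∘ dG y := by
      funext η
      simp
    rw [h4]
    exact h1.add h2
  exact h3.clm_comp ((WithLp.prodContinuousLinearEquiv 1 ℝ X X).symm : X × X →L[ℝ] Y)

end

/-! ### The maps represented by `opT` -/

/-- The scaling factor `-f (f (-1))`. -/
def lam (y : Y) : ℝ := -leftPart y (leftPart y 1 ^ 2)

theorem leftPart_one (y : Y) : leftPart y 1 = y.fst 0 := by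
  simp [leftPart, value_zero_right]

theorem comp_smul_one (f : X) (c : ℝ) : comp f (c • (1 : X)) = value f c • (1 : X) := by
  by_cases hc : Summable fun k => f k * c ^ k
  · have := (((1 : ℝ →L[ℝ] ℝ).smulRight (1 : X))).map_tsum hc
    simp only [ContinuousLinearMap.smulRight_apply, one_apply_eq_self] at this
    rw [value, this, comp]
    refine tsum_congr fun k => ?_
    rw [smul_pow, one_pow, smul_smul]
  -- If the series diverges, both sums take the default value 0, so no bound on c is needed.
  · have h2 : ¬ Summable fun k => f k • (c • (1 : X)) ^ k := by
      intro h
      apply hc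
      refine (h.map (X.coeff 0) (X.coeff 0).continuous).congr fun k => ?_
      change X.coeff 0 (f k • (c • (1 : X)) ^ k) = _
      rw [smul_pow, one_pow, smul_smul, map_smul, X.coeff_apply, X.coeff_one]
      simp
    rw [comp, value, tsum_eq_zero_of_not_summable h2, tsum_eq_zero_of_not_summable hc, zero_smul]

theorem sqNormalize_smul_one (c : ℝ) :
    sqNormalize (c • (1 : X)) = ((c ^ 2 - 1) / s) • (1 : X) := by
  rw [sqNormalize, smul_mul_smul_comm, mul_one]
  nth_rw 2 [← one_smul ℝ (1 : X)]
  rw [← sub_smul, smul_smul]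
  congr 1
  unfold s
  ring

/-- The scaling factor is kept as a constant element of `X`, so that the operator is one expression
in the algebra; here it becomes a scalar again. -/
theorem opL_eq (y : Y) : opL y = lam y • (1 : X) := by
  rw [opL, opK, opA, X.constPart_apply, sqNormalize_smul_one, comp_smul_one, ← neg_smul, lam,
    leftPart_one]
  rfl

theorem lam_ne_zero {y : Y} (hy : Admissible y) : lam y ≠ 0 := by
  intro h
  have : Nontrivial X := NormOneClass.nontrivial
  have := hy.unit
  rw [opL_eq, h, zero_smul] at this
  exact not_isUnit_zero this

theorem opI_eq (y : Y) (h : lam y ≠ 0) : opI y = (lam y)⁻¹ • (1 : X) := by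
  rw [opI, opL_eq]
  have h2 : (lam y • (1 : X)) * ((lam y)⁻¹ • (1 : X)) = 1 := by
    rw [smul_mul_smul_comm, mul_inv_cancel₀ h, mul_one, one_smul]
  rw [← Ring.inverse_mul_cancel_left (M₀ := X) (lam y • (1 : X)) ((lam y)⁻¹ • (1 : X))
    (IsUnit.of_mul_eq_one _ h2), h2, mul_one]

theorem value_sqNormalize (v : X) {x : ℝ} (hx : |x| ≤ 1) :
    value (sqNormalize v) x = (value v x ^ 2 - 1) / s := by
  rw [sqNormalize, value_smul, value_sub _ _ hx, value_mul _ _ hx, value_one]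
  unfold s
  ring

section

variable {y : Y} {x : ℝ}

theorem value_opQ (hx : |x| ≤ 1) : value (opQ y) x = lam y ^ 2 := by
  rw [opQ, opL_eq, value_mul _ _ hx, value_smul, value_one]
  ring

theorem value_opH₃ (hx : |x| ≤ 1) : value (opH₃ y) x = lam y ^ 2 * x := by
  rw [opH₃, value_mul _ _ hx, value_Z, value_opQ hx, mul_comm]

theorem value_opF (hy : Admissible y) (hx : |x| ≤ 1) : value (opF y) x =
    (lam y)⁻¹ * rightPart y (leftPart y (lam y ^ 2 * (1 + s * x)) ^ 2) := by
  have h1 : value (opH₁ y) x = (lam y ^ 2 * (1 + s * x) - 1) / s := by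
    rw [opH₁, value_add _ _ hx, value_smul, value_sub _ _ hx, value_one, value_opQ hx,
      value_opH₃ hx]
    unfold s
    ring
  have hu : value (opU y) x = leftPart y (lam y ^ 2 * (1 + s * x)) := by
    rw [opU, value_comp _ hy.h₁.le hx, h1]
    rfl
  have hw : value (opW y) x = leftPart y (lam y ^ 2 * (1 + s * x)) ^ 2 := by
    rw [opW, value_mul _ _ hx, hu]
    ring
  rw [opF, opR, opI_eq y (lam_ne_zero hy), value_mul _ _ hx, value_smul, value_one,
    value_sub _ _ hx, value_one, value_mul _ _ hx, hw, opG₂, value_comp _ hy.h₂.le hx, opH₂,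
    value_smul, hw, rightPart]
  unfold t
  ring_nf
  rfl

theorem value_opI_mul_opV₃ (hy : Admissible y) (hx : |x| ≤ 1) : value (opI y * opV₃ y) x =
    (lam y)⁻¹ * leftPart y (leftPart y (rightPart y (lam y ^ 2 * (t * x)) ^ 2) ^ 2) := by
  have h1 : value (opV₁ y) x = rightPart y (lam y ^ 2 * (t * x)) := by
    rw [opV₁, value_sub _ _ hx, value_smul, value_mul _ _ hx, value_one, opG₃,
      value_comp _ hy.h₃.le hx, value_opH₃ hx, rightPart, sndL_apply]
    have : lam y ^ 2 * (t * x) / t = lam y ^ 2 * x := by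
      unfold t
      ring
    rw [this]
    unfold t
    ring
  have h2 : value (opV₂ y) x = leftPart y (rightPart y (lam y ^ 2 * (t * x)) ^ 2) := by
    rw [opV₂, value_comp _ hy.h₄.le hx, opH₄, value_sqNormalize _ hx, h1]
    rfl
  rw [opI_eq y (lam_ne_zero hy), value_mul _ _ hx, value_smul, value_one, mul_one, opV₃,
    value_comp _ hy.h₅.le hx, opH₅, value_sqNormalize _ hx, h2]
  rfl

end

theorem leftPart_opT {y : Y} (hy : Admissible y) {u : ℝ} (hu : |(u - 1) / s| ≤ 1) :
    leftPart (opT y) u = (lam y)⁻¹ * rightPart y (leftPart y (lam y ^ 2 * u) ^ 2) := by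
  have h := value_opF hy hu
  have h2 : 1 + s * ((u - 1) / s) = u := by
    unfold s
    ring
  rw [h2] at h
  exact h

theorem rightPart_zero (y : Y) : rightPart y 0 = -1 := by
  simp [rightPart]

theorem rightPart_opT {y : Y} (hy : Admissible y) {u : ℝ} (hu : |u / t| ≤ 1) :
    rightPart (opT y) u =
      (lam y)⁻¹ * leftPart y (leftPart y (rightPart y (lam y ^ 2 * u) ^ 2) ^ 2) := by
  have h := value_opI_mul_opV₃ hy hu
  have h2 : t * (u / t) = u := by
    unfold t
    ring
  -- The right-hand critical orbit is -1, φ(1), φ(φ(1)²) = -λ, so division by λ gives the constant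
  -- term -1. Dropping it by the shift is thus the same as adding 1 and dividing by z, which matches
  -- the form -1 + z g(z/t).
  have h0 : (opI y * opV₃ y) 0 = -1 := by
    have := value_opI_mul_opV₃ hy (x := 0) (by simp)
    rw [value_zero_right] at this
    rw [this]
    simp only [mul_zero, rightPart_zero, neg_one_sq]
    have h3 : leftPart y (leftPart y 1 ^ 2) = -lam y := by
      rw [lam, neg_neg]
    rw [h3, mul_neg, inv_mul_cancel₀ (lam_ne_zero hy)]
  rw [value_shift _ hu, h0, h2] at h
  rw [← h]
  change -1 + u * value (opG y) (u / t) = _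
  rw [opG, value_smul]
  unfold t
  ring

end

end LorenzRenorm

namespace LorenzRenorm

open Set Filter Topology

open scoped X

/-! ### Ball arithmetic in `X` -/

/-- The polynomial with coefficients `c`, with an error bound `e`, both in units of `2⁻⁴⁸`. -/
structure Ball where
  c : List ℤ
  e : ℕ

/-- The sum of the coefficient lists. -/
def polyAdd : List ℤ → List ℤ → List ℤ
  | [], q => q
  | a :: p, [] => a :: p
  | a :: p, b :: q => (a + b) :: polyAdd p q

/-- The coefficients of `a * q + r`. -/
def axpy (a : ℤ) : List ℤ → List ℤ → List ℤ
  | [], r => r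
  | b :: q, [] => Int.mul a b :: axpy a q []
  | b :: q, c :: r => Int.add (Int.mul a b) c :: axpy a q r

/-- The product of the coefficient lists. -/
def polyMul : List ℤ → List ℤ → List ℤ
  | [], _ => []
  | a :: p, q => axpy a q (0 :: polyMul p q)

/-- The sum of the absolute values. -/
def absSum : List ℤ → ℕ
  | [] => 0
  | a :: p => a.natAbs + absSum p

/-- The coefficients of the derivative. -/
def polyDeriv : List ℤ → List ℤ
  | [] => []
  | _ :: p => polyAdd p (0 :: polyDeriv p)

/-- `n`, evaluated before it is passed on to `k`. -/
def seqNat {α : Type} (n : ℕ) (k : ℕ → α) : α :=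
  match n with
  | 0 => k 0
  | n + 1 => k (n + 1)

/-- `n`, evaluated before it is passed on to `k`. -/
def seqInt {α : Type} (n : ℤ) (k : ℤ → α) : α :=
  match n with
  | .ofNat n => seqNat n fun n => k (.ofNat n)
  | .negSucc n => seqNat n fun n => k (.negSucc n)

/-- `l`, evaluated before it is passed on to `k`. -/
def seqList {α : Type} : List ℤ → (List ℤ → α) → α
  | [], k => k []
  | a :: l, k => seqInt a fun a => seqList l fun l => k (a :: l)

namespace Ball

/-- The scale. -/
def unit : ℕ := 281474976710656

/-- `b`, evaluated before it is passed on to `k`. -/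
def seq {α : Type} (b : Ball) (k : Ball → α) : α :=
  seqList b.c fun c => seqNat b.e fun e => k ⟨c, e⟩

def zero : Ball := ⟨[], 0⟩

/-- A polynomial. -/
def ofPoly (c : List ℤ) : Ball := ⟨c, 0⟩

/-- A ball around `0`. -/
def err (e : ℕ) : Ball := ⟨[], e⟩

def add (a b : Ball) : Ball := ⟨polyAdd a.c b.c, a.e + b.e⟩

def neg (a : Ball) : Ball := ⟨a.c.map (-·), a.e⟩

def sub (a b : Ball) : Ball := add a (neg b)

/-- Subtraction of `1`. -/
def subOne (a : Ball) : Ball := add a ⟨[-281474976710656], 0⟩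

/-- A bound for the norm. -/
def bound (a : Ball) : ℕ := absSum a.c + a.e

/-- The product, truncated to `n` coefficients. -/
def mul (n : ℕ) (a b : Ball) : Ball :=
  seqList (polyMul a.c b.c) fun p =>
    ⟨(p.take n).map (· / 281474976710656),
      (a.e * bound b + absSum a.c * b.e + absSum (p.drop n)) / 281474976710656 + 1 + (p.take n).length⟩

/-- Multiplication by the rational number `m / d`. -/
def smul (m d : ℕ) (a : Ball) : Ball :=
  ⟨a.c.map fun x => x * m / d, a.e * m / d + 1 + a.c.length⟩

/-- Multiplication by the variable. -/
def mulZ (a : Ball) : Ball := ⟨0 :: a.c, a.e⟩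

/-- Composition of a polynomial with a ball. -/
def horner (n : ℕ) : List ℤ → Ball → Ball
  | [], _ => zero
  | [x], _ => ⟨[x], 0⟩
  | x :: y :: p, h => (horner n (y :: p) h).seq fun r => add ⟨[x], 0⟩ (mul n h r)

/-- Composition. -/
def comp (n : ℕ) (f h : Ball) : Ball := add (horner n f.c h) (err f.e)

/-- Composition of the derivative, for arguments of norm at most `2 / 3`. -/
def dcomp (n : ℕ) (f h : Ball) : Ball := add (horner n (polyDeriv f.c) h) (err (3 * f.e))

/-- An approximate inverse of the constant term. -/
def invGuess (a : Ball) : ℤ := 281474976710656 * 281474976710656 / a.c.headD 0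

/-- The inverse of a constant. -/
def inv (n : ℕ) (a : Ball) : Ball :=
  seqInt (invGuess a) fun x =>
    seqNat (bound (subOne (mul n a ⟨[x], 0⟩))) fun k =>
      ⟨[x], x.natAbs * k / (281474976710656 - k) + 1⟩

def const (a : Ball) : Ball := ⟨a.c.take 1, a.e⟩

def shift (a : Ball) : Ball := ⟨a.c.tail, a.e⟩

/-- `(v ^ 2 - 1) / s`. -/
def sqN (n : ℕ) (v : Ball) : Ball := smul 5 11 (subOne (mul n v v))

/-- The derivative of `sqN`. -/
def dSqN (n : ℕ) (v d : Ball) : Ball := smul 10 11 (mul n v d)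

end Ball


/-! ### Soundness of the ball arithmetic -/

noncomputable section

/-- The polynomial with the given coefficients, as an element of `X`. -/
def toX : List ℤ → X
  | [] => 0
  | a :: l => (a : ℝ) • (1 : X) + X.Z * toX l

theorem toX_polyAdd (p q : List ℤ) : toX (polyAdd p q) = toX p + toX q := by
  induction p, q using polyAdd.induct with
  | case1 q => simp [polyAdd, toX]
  | case2 a p => simp [polyAdd, toX]
  | case3 a p b q ih =>
    simp only [polyAdd, toX, ih, Int.cast_add, add_smul, mul_add]
    abel

theorem toX_axpy (a : ℤ) (q r : List ℤ) : toX (axpy a q r) = (a : ℝ) • toX q + toX r := by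
  induction q, r using axpy.induct with
  | case1 r => simp [axpy, toX]
  | case2 b q ih =>
    simp only [axpy, toX, ih, Int.mul_def, Int.cast_mul, mul_smul, smul_add, add_zero,
      mul_smul_comm]
  | case3 b q c r ih =>
    simp only [axpy, toX, ih, Int.mul_def, Int.add_def, Int.cast_mul, Int.cast_add, add_smul,
      mul_smul, smul_add, mul_smul_comm, mul_add]
    abel

theorem toX_polyMul (p q : List ℤ) : toX (polyMul p q) = toX p * toX q := by
  induction p with
  | nil => simp [polyMul, toX]
  | cons a p ih =>
    simp only [polyMul, toX_axpy, toX, ih, Int.cast_zero, zero_smul, zero_add, add_mul,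
      smul_mul_assoc, one_mul, mul_assoc]

theorem toX_map_neg (p : List ℤ) : toX (p.map (-·)) = -toX p := by
  induction p with
  | nil => simp [toX]
  | cons a p ih => simp only [List.map_cons, toX, ih, Int.cast_neg, neg_smul, mul_neg, neg_add]

theorem norm_Z_mul_le (a : X) : ‖X.Z * a‖ ≤ ‖a‖ := by
  have := norm_mul_le X.Z a
  rwa [X.norm_Z, one_mul] at this

theorem norm_toX_le (p : List ℤ) : ‖toX p‖ ≤ absSum p := by
  induction p with
  | nil => simp [toX, absSum]
  | cons a p ih =>
    rw [toX, absSum, Nat.cast_add]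
    refine (norm_add_le _ _).trans (add_le_add ?_ ((norm_Z_mul_le _).trans ih))
    rw [norm_smul, norm_one, mul_one, Real.norm_eq_abs, Nat.cast_natAbs, Int.cast_abs]

theorem norm_toX_sub_take_le (p : List ℤ) (n : ℕ) :
    ‖toX p - toX (p.take n)‖ ≤ absSum (p.drop n) := by
  induction p generalizing n with
  | nil => simp [toX]
  | cons a p ih =>
    cases n with
    | zero => simpa [toX] using norm_toX_le (a :: p)
    | succ n =>
      simp only [List.take_succ_cons, List.drop_succ_cons, toX, add_sub_add_left_eq_sub, ← mul_sub]
      exact (norm_Z_mul_le _).trans (ih n)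

theorem abs_div_sub_floor_le (x : ℤ) (m : ℕ) {d : ℕ} (hd : 0 < d) :
    |(m / d : ℝ) * x - ((x * m / d : ℤ) : ℝ)| ≤ 1 := by
  have hd' : (0 : ℝ) < d := by exact_mod_cast hd
  have h1 := Int.emod_add_mul_ediv (x * m) d
  have h2 := Int.emod_nonneg (x * m) (by exact_mod_cast hd.ne' : (d : ℤ) ≠ 0)
  have h3 := Int.emod_lt_of_pos (x * m) (by exact_mod_cast hd : (0 : ℤ) < d)
  have h1' : (((x * m) % d : ℤ) : ℝ) + d * ((x * m / d : ℤ) : ℝ) = x * m := by exact_mod_cast h1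
  have h2' : (0 : ℝ) ≤ ((x * m % d : ℤ) : ℝ) := by exact_mod_cast h2
  have h3' : ((x * m % d : ℤ) : ℝ) < d := by exact_mod_cast h3
  have h4 : (m / d : ℝ) * x - ((x * m / d : ℤ) : ℝ) = ((x * m % d : ℤ) : ℝ) / d := by
    field_simp
    linarith
  rw [h4, abs_of_nonneg (div_nonneg h2' hd'.le)]
  exact (div_le_one hd').2 h3'.le

theorem norm_smul_toX_sub_le (p : List ℤ) (m : ℕ) {d : ℕ} (hd : 0 < d) :
    ‖(m / d : ℝ) • toX p - toX (p.map fun x => x * m / d)‖ ≤ p.length := by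
  induction p with
  | nil => simp [toX]
  | cons a p ih =>
    have h : (m / d : ℝ) • toX (a :: p) - toX ((a :: p).map fun x => x * m / d) =
        ((m / d : ℝ) * a - ((a * m / d : ℤ) : ℝ)) • (1 : X) +
          X.Z * ((m / d : ℝ) • toX p - toX (p.map fun x => x * m / d)) := by
      simp only [List.map_cons, toX, smul_add, sub_smul, mul_sub, mul_smul, mul_smul_comm]
      abel
    rw [h, List.length_cons, Nat.cast_add, Nat.cast_one, add_comm (p.length : ℝ)]
    refine (norm_add_le _ _).trans (add_le_add ?_ ((norm_Z_mul_le _).trans ih))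
    rw [norm_smul, norm_one, mul_one]
    exact abs_div_sub_floor_le a m hd

theorem comp_toX_cons (a : ℤ) (p : List ℤ) {h : X} (hh : ‖h‖ ≤ 1) :
    comp (toX (a :: p)) h = (a : ℝ) • (1 : X) + h * comp (toX p) h := by
  rw [toX, comp_add _ _ hh, comp_smul _ _ hh, comp_one, comp_Z_mul _ hh]

theorem comp_zero (h : X) : comp 0 h = 0 := by
  simp [comp]

theorem dcomp_toX (p : List ℤ) {h : X} (hh : ‖h‖ < 1) :
    dcomp (toX p) h = comp (toX (polyDeriv p)) h := by
  induction p with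
  | nil => simp [polyDeriv, toX, comp, dcomp]
  | cons a p ih =>
    rw [toX, dcomp_add _ _ hh, dcomp_smul _ _ hh, dcomp_one, smul_zero, zero_add,
      dcomp_Z_mul _ hh, ih, polyDeriv, toX_polyAdd, comp_add _ _ hh.le, comp_toX_cons _ _ hh.le,
      Int.cast_zero, zero_smul, zero_add]

-- The `seq` functions only steer evaluation: by matching on an intermediate result they force it to
-- be computed once before it is used. Logically they are plain application.
@[simp] theorem seqNat_eq {α : Type} (n : ℕ) (k : ℕ → α) : seqNat n k = k n := by
  cases n <;> rfl

@[simp] theorem seqInt_eq {α : Type} (n : ℤ) (k : ℤ → α) : seqInt n k = k n := by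
  cases n <;> simp [seqInt]

@[simp] theorem seqList_eq {α : Type} (l : List ℤ) (k : List ℤ → α) : seqList l k = k l := by
  induction l generalizing k with
  | nil => rfl
  | cons a l ih => simp [seqList, ih]

namespace Ball

@[simp] theorem seq_eq {α : Type} (b : Ball) (k : Ball → α) : seq b k = k b := by
  simp [seq]

/-- `x` is in the ball `b`. -/
def Has (b : Ball) (x : X) : Prop := ‖(unit : ℝ) • x - toX b.c‖ ≤ b.e

theorem unit_pos : (0 : ℝ) < unit := by
  norm_num [unit]

theorem Has.norm_smul_le {b : Ball} {x : X} (h : b.Has x) : ‖(unit : ℝ) • x‖ ≤ b.bound := by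
  have h1 := norm_add_le ((unit : ℝ) • x - toX b.c) (toX b.c)
  rw [sub_add_cancel] at h1
  rw [bound, Nat.cast_add]
  have h2 := norm_toX_le b.c
  have h3 : ‖(unit : ℝ) • x - toX b.c‖ ≤ b.e := h
  linarith

theorem Has.unit_mul_norm_le {b : Ball} {x : X} (h : b.Has x) : unit * ‖x‖ ≤ b.bound := by
  have := h.norm_smul_le
  rwa [norm_smul, Real.norm_of_nonneg unit_pos.le] at this

theorem Has.norm_le {b : Ball} {x : X} (h : b.Has x) {m d : ℕ} (hd : 0 < d)
    (hb : b.bound * d ≤ m * unit) : ‖x‖ ≤ m / d := by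
  have h1 := h.unit_mul_norm_le
  have h2 : (b.bound : ℝ) * d ≤ m * unit := by exact_mod_cast hb
  have hd' : (0 : ℝ) < d := by exact_mod_cast hd
  rw [le_div_iff₀ hd']
  have h3 : unit * (‖x‖ * d) ≤ unit * m := by nlinarith
  exact le_of_mul_le_mul_left h3 unit_pos

theorem has_zero : zero.Has 0 := by
  simp [Has, zero, toX]

theorem has_ofPoly (p : List ℤ) : (ofPoly p).Has ((unit : ℝ)⁻¹ • toX p) := by
  simp [Has, ofPoly, smul_smul, mul_inv_cancel₀ unit_pos.ne']

theorem has_err {x : X} {e : ℕ} (h : unit * ‖x‖ ≤ e) : (err e).Has x := by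
  rw [Has, err, toX, sub_zero, norm_smul, Real.norm_of_nonneg unit_pos.le]
  exact h

theorem Has.add {a b : Ball} {x y : X} (hx : a.Has x) (hy : b.Has y) : (add a b).Has (x + y) := by
  rw [Has, Ball.add, toX_polyAdd, Nat.cast_add, smul_add, add_sub_add_comm]
  exact (norm_add_le _ _).trans (add_le_add hx hy)

theorem Has.neg {a : Ball} {x : X} (hx : a.Has x) : (neg a).Has (-x) := by
  rw [Has, Ball.neg, toX_map_neg, smul_neg, sub_neg_eq_add, ← norm_neg, neg_add, neg_neg,
    ← sub_eq_add_neg]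
  exact hx

theorem Has.sub {a b : Ball} {x y : X} (hx : a.Has x) (hy : b.Has y) : (sub a b).Has (x - y) := by
  rw [sub_eq_add_neg]
  exact hx.add hy.neg

theorem Has.subOne {a : Ball} {x : X} (hx : a.Has x) : (subOne a).Has (x - 1) := by
  rw [sub_eq_add_neg]
  refine hx.add ?_
  simp [Has, toX, unit]

theorem div_le_natDiv_add_one (m d : ℕ) (hd : 0 < d) : (m : ℝ) / d ≤ ((m / d : ℕ) : ℝ) + 1 := by
  have hd' : (0 : ℝ) < d := by exact_mod_cast hd
  rw [div_le_iff₀ hd']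
  have := Nat.lt_div_mul_add (a := m) hd
  have h : m ≤ (m / d + 1) * d := by
    rw [add_mul, one_mul]
    exact this.le
  exact_mod_cast h

/-- From xy - pq = (x - p)y + p(y - q), where ‖y‖ is estimated by `bound b` and ‖p‖ by the absolute
sum of its coefficients. To this are added the discarded coefficients, 1 for rounding the quotient
of the errors, and 1 for each kept coefficient that is rounded down. -/
theorem Has.mul {a b : Ball} {x y : X} (hx : a.Has x) (hy : b.Has y) (n : ℕ) :
    (mul n a b).Has (x * y) := by
  have hS := unit_pos
  set p := polyMul a.c b.c with hp
  have e1 : ‖((unit : ℝ) • x) * ((unit : ℝ) • y) - toX p‖ ≤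
      a.e * b.bound + absSum a.c * b.e := by
    have : ((unit : ℝ) • x) * ((unit : ℝ) • y) - toX p =
        ((unit : ℝ) • x - toX a.c) * ((unit : ℝ) • y) +
          toX a.c * ((unit : ℝ) • y - toX b.c) := by
      rw [hp, toX_polyMul]
      ring
    rw [this]
    refine (norm_add_le _ _).trans (add_le_add ?_ ?_)
    · exact (norm_mul_le _ _).trans
        (mul_le_mul hx hy.norm_smul_le (norm_nonneg _) (Nat.cast_nonneg _))
    · exact (norm_mul_le _ _).trans
        (mul_le_mul (norm_toX_le _) hy (norm_nonneg _) (Nat.cast_nonneg _))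
  have e2 := norm_toX_sub_take_le p n
  have e3 := norm_smul_toX_sub_le (p.take n) 1 (d := unit) (by norm_num [unit])
  set E : ℕ := a.e * bound b + absSum a.c * b.e + absSum (p.drop n) with hE
  have e5 := div_le_natDiv_add_one E unit (by norm_num [unit])
  have e0 : ((1 : ℕ) / unit : ℝ) = (unit : ℝ)⁻¹ := by rw [Nat.cast_one, one_div]
  have e6 : (unit : ℝ) • (x * y) - toX ((p.take n).map fun x => x * (1 : ℕ) / unit) =
      (unit : ℝ)⁻¹ • ((((unit : ℝ) • x) * ((unit : ℝ) • y) - toX p) + (toX p - toX (p.take n))) +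
      (((1 : ℕ) / unit : ℝ) • toX (p.take n) - toX ((p.take n).map fun x => x * (1 : ℕ) / unit)) := by
    rw [sub_add_sub_cancel, smul_sub, smul_mul_smul_comm, smul_smul,
      inv_mul_cancel_left₀ hS.ne', e0, sub_add_sub_cancel]
  have e7 : Ball.mul n a b = ⟨(p.take n).map fun x => x * (1 : ℕ) / unit, E / unit + 1 + (p.take n).length⟩ := by
    simp [Ball.mul, unit, hE, hp]
  rw [e7, Has, e6]
  refine (norm_add_le _ _).trans ?_
  have e8 : ‖(unit : ℝ)⁻¹ • ((((unit : ℝ) • x) * ((unit : ℝ) • y) - toX p) +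
      (toX p - toX (p.take n)))‖ ≤ E / unit := by
    rw [norm_smul, norm_inv, Real.norm_of_nonneg hS.le, inv_mul_eq_div]
    refine div_le_div_of_nonneg_right ((norm_add_le _ _).trans ?_) hS.le
    rw [hE]
    push_cast
    exact add_le_add e1 e2
  push_cast at e3 e5 e8 ⊢
  linarith

theorem Has.smul {a : Ball} {x : X} (hx : a.Has x) (m : ℕ) {d : ℕ} (hd : 0 < d) :
    (smul m d a).Has ((m / d : ℝ) • x) := by
  have hd' : (0 : ℝ) < d := by exact_mod_cast hd
  have e1 : (unit : ℝ) • (m / d : ℝ) • x - toX (a.c.map fun x => x * m / d) =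
      (m / d : ℝ) • ((unit : ℝ) • x - toX a.c) +
        ((m / d : ℝ) • toX a.c - toX (a.c.map fun x => x * m / d)) := by
    rw [smul_sub, sub_add_sub_cancel, smul_comm]
  have e2 := div_le_natDiv_add_one (a.e * m) d hd
  have e3 := norm_smul_toX_sub_le a.c m hd
  have e4 : ‖(m / d : ℝ) • ((unit : ℝ) • x - toX a.c)‖ ≤ (a.e * m : ℕ) / d := by
    rw [norm_smul, Real.norm_of_nonneg (by positivity), Nat.cast_mul, mul_comm (a.e : ℝ),
      div_mul_eq_mul_div]
    exact div_le_div_of_nonneg_right (mul_le_mul_of_nonneg_left hx (Nat.cast_nonneg m)) hd'.le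
  rw [Has, Ball.smul, e1]
  refine (norm_add_le _ _).trans ?_
  push_cast at e2 e4 ⊢
  linarith

theorem Has.mulZ {a : Ball} {x : X} (hx : a.Has x) : (mulZ a).Has (X.Z * x) := by
  rw [Has, Ball.mulZ, toX, Int.cast_zero, zero_smul, zero_add, ← mul_smul_comm, ← mul_sub]
  exact (norm_Z_mul_le _).trans hx

theorem has_horner (n : ℕ) (p : List ℤ) {hb : Ball} {h : X} (hh : hb.Has h) (h1 : ‖h‖ ≤ 1) :
    (horner n p hb).Has ((unit : ℝ)⁻¹ • LorenzRenorm.comp (toX p) h) := by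
  have hsingle : ∀ x : ℤ, (ofPoly [x]).Has ((unit : ℝ)⁻¹ • ((x : ℝ) • (1 : X))) := by
    intro x
    have := has_ofPoly [x]
    rwa [toX, toX, mul_zero, add_zero] at this
  induction p with
  | nil => simpa [horner, toX, comp_zero] using has_zero
  | cons x p ih =>
    cases p with
    | nil =>
      rw [comp_toX_cons _ _ h1, toX, comp_zero, mul_zero, add_zero]
      exact hsingle x
    | cons y p =>
      rw [comp_toX_cons _ _ h1, horner, seq_eq, smul_add, ← mul_smul_comm]
      exact (hsingle x).add (hh.mul ih n)

theorem smul_eq_comp (f h : X) (h1 : ‖h‖ ≤ 1) (p : List ℤ) : LorenzRenorm.comp f h =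
    (unit : ℝ)⁻¹ • LorenzRenorm.comp (toX p) h +
      (unit : ℝ)⁻¹ • LorenzRenorm.comp ((unit : ℝ) • f - toX p) h := by
  rw [comp_sub _ _ h1, ← smul_add, add_sub_cancel, comp_smul _ _ h1, smul_smul,
    inv_mul_cancel₀ unit_pos.ne', one_smul]

theorem unit_mul_norm_inv_smul (x : X) : unit * ‖(unit : ℝ)⁻¹ • x‖ = ‖x‖ := by
  rw [norm_smul, norm_inv, Real.norm_of_nonneg unit_pos.le, mul_inv_cancel_left₀ unit_pos.ne']

theorem Has.comp {fb hb : Ball} {f h : X} (hf : fb.Has f) (hh : hb.Has h) (h1 : ‖h‖ ≤ 1) (n : ℕ) :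
    (comp n fb hb).Has (LorenzRenorm.comp f h) := by
  rw [smul_eq_comp f h h1 fb.c]
  refine (has_horner n fb.c hh h1).add (has_err ?_)
  rw [unit_mul_norm_inv_smul]
  exact (norm_comp_le _ h1).trans hf

/-- The error of f is amplified by (1 - ‖h‖)⁻¹, which is at most 3 for ‖h‖ ≤ 2/3. -/
theorem Has.dcomp {fb hb : Ball} {f h : X} (hf : fb.Has f) (hh : hb.Has h) (h1 : ‖h‖ ≤ 2 / 3)
    (n : ℕ) : (dcomp n fb hb).Has (LorenzRenorm.dcomp f h) := by
  have h2 : ‖h‖ < 1 := by linarith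
  have e1 : LorenzRenorm.dcomp f h = (unit : ℝ)⁻¹ • LorenzRenorm.comp (toX (polyDeriv fb.c)) h +
      (unit : ℝ)⁻¹ • LorenzRenorm.dcomp ((unit : ℝ) • f - toX fb.c) h := by
    rw [dcomp_sub _ _ h2, dcomp_toX _ h2, ← smul_add, add_sub_cancel, dcomp_smul _ _ h2, smul_smul,
      inv_mul_cancel₀ unit_pos.ne', one_smul]
  rw [e1]
  refine (has_horner n _ hh h2.le).add (has_err ?_)
  rw [unit_mul_norm_inv_smul, Nat.cast_mul, Nat.cast_ofNat, mul_comm]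
  refine (norm_dcomp_le _ h2).trans (mul_le_mul hf ?_ ?_ (Nat.cast_nonneg _))
  · rw [inv_le_comm₀ (by linarith) (by norm_num)]
    linarith
  · exact inv_nonneg.2 (by linarith)

theorem Has.const {a : Ball} {x : X} (hx : a.Has x) : (const a).Has (X.constPart x) := by
  have h1 : toX (a.c.take 1) = X.constPart (toX a.c) := by
    cases a.c with
    | nil => simp [toX]
    | cons b l => simp [toX, X.add_apply', X.smul_apply', X.Z_mul_zero, X.coeff_one]
  rw [Has, Ball.const, h1, ← map_smul, ← map_sub]
  exact (X.norm_constPart_le _).trans hx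

theorem Has.shift {a : Ball} {x : X} (hx : a.Has x) : (shift a).Has (X.shift x) := by
  have h1 : toX a.c.tail = X.shift (toX a.c) := by
    cases a.c with
    | nil => simp [toX]
    | cons b l => rw [List.tail_cons, toX, map_add, X.shift_smul_one, X.shift_Z_mul, zero_add]
  rw [Has, Ball.shift, h1, ← map_smul, ← map_sub]
  exact (X.norm_shift_le _).trans hx

theorem Has.sqN {a : Ball} {x : X} (hx : a.Has x) (n : ℕ) : (sqN n a).Has (sqNormalize x) := by
  have := ((hx.mul hx n).subOne).smul 5 (d := 11) (by norm_num)
  exact_mod_cast this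

theorem Has.dSqN {a b : Ball} {x y : X} (hx : a.Has x) (hy : b.Has y) (n : ℕ) :
    (dSqN n a b).Has ((10 / 11 : ℝ) • (x * y)) := by
  have := (hx.mul hy n).smul 10 (d := 11) (by norm_num)
  exact_mod_cast this

/-- The error term in `inv` is meaningful. -/
def invOK (n : ℕ) (a : Ball) : Bool :=
  seqInt (invGuess a) fun x => bound (subOne (mul n a ⟨[x], 0⟩)) < 281474976710656

/-- An a posteriori bound for any guess z. If ‖xz - 1‖ ≤ κ < 1 then xz is invertible by the Neumann
series, and x⁻¹ - z = x⁻¹(1 - xz) yields ‖x⁻¹ - z‖ ≤ ‖z‖ κ / (1 - κ). In units of the scale, κ is k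
/ `unit`. -/
theorem Has.inv {a : Ball} {x : X} (hx : a.Has x) (n : ℕ) (h : invOK n a = true) :
    IsUnit x ∧ (inv n a).Has (Ring.inverse x) := by
  have hS := unit_pos
  set c : ℤ := invGuess a with hc
  set k := bound (Ball.subOne (Ball.mul n a (ofPoly [c]))) with hk
  have hlt : k < unit := by
    rw [invOK, seqInt_eq] at h
    exact of_decide_eq_true h
  have hltR : (k : ℝ) < unit := by exact_mod_cast hlt
  set z : X := (unit : ℝ)⁻¹ • toX [c] with hz
  have hzn : unit * ‖z‖ ≤ c.natAbs := by
    rw [hz, unit_mul_norm_inv_smul]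
    simpa [absSum] using norm_toX_le [c]
  have h1 : unit * ‖x * z - 1‖ ≤ k := ((hx.mul (has_ofPoly [c]) n).subOne).unit_mul_norm_le
  have h2 : ‖1 - x * z‖ < 1 := by
    rw [norm_sub_rev]
    by_contra hcon
    push Not at hcon
    nlinarith
  have h3 : IsUnit (x * z) := by
    have := isUnit_one_sub_of_norm_lt_one h2
    rwa [sub_sub_cancel] at this
  have hu : IsUnit x := isUnit_of_mul_isUnit_left h3
  refine ⟨hu, ?_⟩
  set i := Ring.inverse x with hi
  have h4 : i * x = 1 := Ring.inverse_mul_cancel x hu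
  have h5 : i - z = i * (1 - x * z) := by
    rw [mul_sub, ← mul_assoc, h4, mul_one, one_mul]
  rw [norm_sub_rev] at h1
  have h6 : unit * ‖i - z‖ ≤ ‖i‖ * k := by
    rw [h5]
    have := norm_mul_le i (1 - x * z)
    nlinarith [norm_nonneg i]
  have h7 : ‖i‖ ≤ ‖z‖ + ‖i - z‖ := by
    have := norm_add_le z (i - z)
    rwa [add_sub_cancel] at this
  have h8 : unit * ‖i - z‖ * (unit - k) ≤ c.natAbs * k := by
    have h9 : ‖i‖ * (unit - k) ≤ c.natAbs := by nlinarith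
    have h10 : 0 ≤ (k : ℝ) := Nat.cast_nonneg k
    nlinarith
  have h11 : unit * ‖i - z‖ ≤ (c.natAbs * k : ℕ) / ((unit - k : ℕ) : ℝ) := by
    rw [Nat.cast_sub hlt.le, le_div_iff₀ (by linarith)]
    push_cast
    exact_mod_cast h8
  have h12 := h11.trans (div_le_natDiv_add_one _ _ (Nat.sub_pos_of_lt hlt))
  have h13 : Ball.inv n a = ⟨[c], c.natAbs * k / (unit - k) + 1⟩ := by
    rw [Ball.inv, seqInt_eq, seqNat_eq]
    rfl
  rw [h13, Has]
  have h14 : (unit : ℝ) • i - toX [c] = (unit : ℝ) • (i - z) := by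
    rw [smul_sub, hz, smul_smul, mul_inv_cancel₀ hS.ne', one_smul]
  rw [h14, norm_smul, Real.norm_of_nonneg hS.le]
  exact_mod_cast h12

end Ball

end

end LorenzRenorm

namespace LorenzRenorm

open Set Filter Topology

open scoped X

/-! ### Enclosure of the operator and of its derivative -/

section

variable {y : Y}

theorem dL_apply (hy : Admissible y) (η : Y) : dL y η = -(comp η.fst (opK y) +
    dcomp y.fst (opK y) * ((10 / 11 : ℝ) • (opA y * X.constPart η.fst))) := by
  rw [dL, neg_apply, ContinuousLinearMap.comp_apply, compDeriv_apply (p := (fstL y, opK y)) hy.k,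
    ContinuousLinearMap.prod_apply, dSqNormalize_apply]
  rfl

theorem dU_apply (hy : Admissible y) (η : Y) : dU y η = comp η.fst (opH₁ y) +
    dcomp y.fst (opH₁ y) * (((5 : ℕ) / (11 : ℕ) : ℝ) • dQ y η + dH₃ y η) := by
  rw [dU, ContinuousLinearMap.comp_apply, compDeriv_apply (p := (fstL y, opH₁ y)) hy.h₁, Nat.cast_ofNat, Nat.cast_ofNat]
  rfl

theorem dG₂_apply (hy : Admissible y) (η : Y) : dG₂ y η = comp η.snd (opH₂ y) +
    dcomp y.snd (opH₂ y) * (dW y η + dW y η) := by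
  rw [dG₂, ContinuousLinearMap.comp_apply, compDeriv_apply (p := (sndL y, opH₂ y)) hy.h₂, ← two_smul ℝ (dW y η)]
  rfl

theorem dG₃_apply (hy : Admissible y) (η : Y) : dG₃ y η = comp η.snd (opH₃ y) + dcomp y.snd (opH₃ y) * dH₃ y η := by
  rw [dG₃, ContinuousLinearMap.comp_apply, compDeriv_apply (p := (sndL y, opH₃ y)) hy.h₃]
  rfl

theorem dV₂_apply (hy : Admissible y) (η : Y) : dV₂ y η = comp η.fst (opH₄ y) +
    dcomp y.fst (opH₄ y) * ((10 / 11 : ℝ) • (opV₁ y * dV₁ y η)) := by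
  rw [dV₂, ContinuousLinearMap.comp_apply, compDeriv_apply (p := (fstL y, opH₄ y)) hy.h₄, ContinuousLinearMap.prod_apply,
    dSqNormalize_apply]
  rfl

theorem dV₃_apply (hy : Admissible y) (η : Y) : dV₃ y η = comp η.fst (opH₅ y) +
    dcomp y.fst (opH₅ y) * ((10 / 11 : ℝ) • (opV₂ y * dV₂ y η)) := by
  rw [dV₃, ContinuousLinearMap.comp_apply, compDeriv_apply (p := (fstL y, opH₅ y)) hy.h₅, ContinuousLinearMap.prod_apply,
    dSqNormalize_apply]
  rfl

end

section

variable (y η : Y)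

theorem dI_apply : dI y η = -(opI y * opI y * dL y η) := rfl

theorem dQ_apply : dQ y η = opL y * dL y η + opL y * dL y η := rfl

theorem dH₃_apply : dH₃ y η = X.Z * dQ y η := rfl

theorem dW_apply : dW y η = opU y * dU y η + opU y * dU y η := rfl

theorem dF_apply : dF y η =
    opI y * (opW y * dG₂ y η + opG₂ y * dW y η) + opR y * dI y η := rfl

theorem dV₁_apply : dV₁ y η =
    ((1 : ℕ) / (2 : ℕ) : ℝ) • (opH₃ y * dG₃ y η + opG₃ y * dH₃ y η) := by
  rw [Nat.cast_one, Nat.cast_ofNat]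
  rfl

theorem dG_apply : dG y η =
    ((2 : ℕ) / (1 : ℕ) : ℝ) • X.shift (opI y * dV₃ y η + opV₃ y * dI y η) := by
  rw [Nat.cast_one, Nat.cast_ofNat, div_one]
  rfl

end

/-! ### Evaluation of the operator and of its derivative on balls -/

namespace Ball

/-- Enclosures for the intermediate results in `opT`. -/
structure Trace where
  (A K L I Q H₃ H₁ U W H₂ G₂ R G₃ V₁ H₄ V₂ H₅ V₃ : Ball)

/-- The computation of `opT`. -/
def trace (n : ℕ) (f g : Ball) : Trace :=
  (const f).seq fun A =>
  (sqN n A).seq fun K =>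
  (neg (comp n f K)).seq fun L =>
  (inv n L).seq fun I =>
  (mul n L L).seq fun Q =>
  (mulZ Q).seq fun H₃ =>
  (add (smul 5 11 (subOne Q)) H₃).seq fun H₁ =>
  (comp n f H₁).seq fun U =>
  (mul n U U).seq fun W =>
  (add W W).seq fun H₂ =>
  (comp n g H₂).seq fun G₂ =>
  (subOne (mul n W G₂)).seq fun R =>
  (comp n g H₃).seq fun G₃ =>
  (subOne (smul 1 2 (mul n H₃ G₃))).seq fun V₁ =>
  (sqN n V₁).seq fun H₄ =>
  (comp n f H₄).seq fun V₂ =>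
  (sqN n V₂).seq fun H₅ =>
  (comp n f H₅).seq fun V₃ =>
  ⟨A, K, L, I, Q, H₃, H₁, U, W, H₂, G₂, R, G₃, V₁, H₄, V₂, H₅, V₃⟩

/-- The ball `b` is contained in the ball of radius `2 / 3` around `0`. -/
def small (b : Ball) : Bool := 3 * bound b ≤ 562949953421312

/-- All compositions in `trace` are defined. -/
def Trace.ok (n : ℕ) (t : Trace) : Bool :=
  small t.K && small t.H₁ && small t.H₂ && small t.H₃ && small t.H₄ && small t.H₅ && invOK n t.L

/-- The enclosures in `t` are valid for `y`. -/
structure Trace.Holds (t : Trace) (y : Y) : Prop where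
  A : t.A.Has (opA y)
  K : t.K.Has (opK y)
  L : t.L.Has (opL y)
  I : t.I.Has (opI y)
  Q : t.Q.Has (opQ y)
  H₃ : t.H₃.Has (opH₃ y)
  H₁ : t.H₁.Has (opH₁ y)
  U : t.U.Has (opU y)
  W : t.W.Has (opW y)
  H₂ : t.H₂.Has (opH₂ y)
  G₂ : t.G₂.Has (opG₂ y)
  R : t.R.Has (opR y)
  G₃ : t.G₃.Has (opG₃ y)
  V₁ : t.V₁.Has (opV₁ y)
  H₄ : t.H₄.Has (opH₄ y)
  V₂ : t.V₂.Has (opV₂ y)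
  H₅ : t.H₅.Has (opH₅ y)
  V₃ : t.V₃.Has (opV₃ y)
  k : ‖opK y‖ ≤ 2 / 3
  h₁ : ‖opH₁ y‖ ≤ 2 / 3
  h₂ : ‖opH₂ y‖ ≤ 2 / 3
  h₃ : ‖opH₃ y‖ ≤ 2 / 3
  h₄ : ‖opH₄ y‖ ≤ 2 / 3
  h₅ : ‖opH₅ y‖ ≤ 2 / 3
  unit : IsUnit (opL y)

theorem Trace.Holds.admissible {t : Trace} {y : Y} (h : t.Holds y) : Admissible y :=
  ⟨h.k.trans_lt (by norm_num), h.h₁.trans_lt (by norm_num), h.h₂.trans_lt (by norm_num),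
    h.h₃.trans_lt (by norm_num), h.h₄.trans_lt (by norm_num), h.h₅.trans_lt (by norm_num), h.unit⟩

theorem Has.of_eq {b : Ball} {x x' : X} (h : b.Has x) (e : x = x') : b.Has x' := e ▸ h

theorem Has.norm_le_of_small {b : Ball} {x : X} (h : b.Has x) (hs : small b = true) :
    ‖x‖ ≤ 2 / 3 := by
  -- The literal is 2 · 2⁴⁸.
  have h1 : 3 * bound b ≤ 562949953421312 := of_decide_eq_true hs
  have := h.norm_le (m := 2) (d := 3) (by norm_num) (by rw [unit]; omega)
  exact_mod_cast this

theorem trace_holds {n : ℕ} {f g : Ball} {y : Y} (hf : f.Has y.fst) (hg : g.Has y.snd)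
    (hok : (trace n f g).ok n = true) : (trace n f g).Holds y := by
  have h23 : ∀ {x : X}, ‖x‖ ≤ 2 / 3 → ‖x‖ ≤ 1 := fun h => h.trans (by norm_num)
  simp only [Trace.ok, Bool.and_eq_true] at hok
  obtain ⟨⟨⟨⟨⟨⟨sk, s1⟩, s2⟩, s3⟩, s4⟩, s5⟩, su⟩ := hok
  simp only [trace, seq_eq] at sk s1 s2 s3 s4 s5 su ⊢
  have A : Has _ (opA y) := hf.const
  have K : Has _ (opK y) := A.sqN n
  have k := K.norm_le_of_small sk
  have L : Has _ (opL y) := (hf.comp K (h23 k) n).neg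
  have I := L.inv n su
  have Q : Has _ (opQ y) := L.mul L n
  have H₃ : Has _ (opH₃ y) := Q.mulZ
  have h₃ := H₃.norm_le_of_small s3
  have H₁ : Has _ (opH₁ y) :=
    ((Q.subOne.smul 5 (d := 11) (by norm_num)).add H₃).of_eq (by norm_num [opH₁])
  have h₁ := H₁.norm_le_of_small s1
  have U : Has _ (opU y) := hf.comp H₁ (h23 h₁) n
  have W : Has _ (opW y) := U.mul U n
  have H₂ : Has _ (opH₂ y) := (W.add W).of_eq (two_smul ℝ _).symm
  have h₂ := H₂.norm_le_of_small s2
  have G₂ : Has _ (opG₂ y) := hg.comp H₂ (h23 h₂) n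
  have R : Has _ (opR y) := (W.mul G₂ n).subOne
  have G₃ : Has _ (opG₃ y) := hg.comp H₃ (h23 h₃) n
  have V₁ : Has _ (opV₁ y) :=
    ((H₃.mul G₃ n).smul 1 (d := 2) (by norm_num)).subOne.of_eq (by norm_num [opV₁])
  have H₄ : Has _ (opH₄ y) := V₁.sqN n
  have h₄ := H₄.norm_le_of_small s4
  have V₂ : Has _ (opV₂ y) := hf.comp H₄ (h23 h₄) n
  have H₅ : Has _ (opH₅ y) := V₂.sqN n
  have h₅ := H₅.norm_le_of_small s5
  have V₃ : Has _ (opV₃ y) := hf.comp H₅ (h23 h₅) n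
  exact ⟨A, K, L, I.2, Q, H₃, H₁, U, W, H₂, G₂, R, G₃, V₁, H₄, V₂, H₅, V₃, k, h₁, h₂, h₃, h₄, h₅,
    I.1⟩

/-- The computation of `opT`. -/
def result (n : ℕ) (t : Trace) : Ball × Ball :=
  (mul n t.I t.R, smul 2 1 (shift (mul n t.I t.V₃)))

theorem Trace.Holds.result {t : Trace} {y : Y} (h : t.Holds y) (n : ℕ) :
    (Ball.result n t).1.Has (opF y) ∧ (Ball.result n t).2.Has (opG y) := by
  refine ⟨h.I.mul h.R n, ?_⟩
  exact (((h.I.mul h.V₃ n).shift).smul 2 (d := 1) (by norm_num)).of_eq (by simp [opG])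

/-- Enclosures of the coefficients in the derivative of `opT`. -/
structure Jet where
  (K C₁ C₂ C₃ C₄ C₅ I : Ball)

/-- The computation of the coefficients in the derivative of `opT`. -/
def jet (n : ℕ) (f g : Ball) (t : Trace) : Jet :=
  (dcomp n f t.K).seq fun K =>
  (dcomp n f t.H₁).seq fun C₁ =>
  (dcomp n g t.H₂).seq fun C₂ =>
  (dcomp n g t.H₃).seq fun C₃ =>
  (dcomp n f t.H₄).seq fun C₄ =>
  (dcomp n f t.H₅).seq fun C₅ =>
  (mul n t.I t.I).seq fun I =>
  ⟨K, C₁, C₂, C₃, C₄, C₅, I⟩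

/-- The enclosures in `j` are valid for `y`. -/
structure Jet.Holds (j : Jet) (y : Y) : Prop where
  K : j.K.Has (LorenzRenorm.dcomp y.fst (opK y))
  C₁ : j.C₁.Has (LorenzRenorm.dcomp y.fst (opH₁ y))
  C₂ : j.C₂.Has (LorenzRenorm.dcomp y.snd (opH₂ y))
  C₃ : j.C₃.Has (LorenzRenorm.dcomp y.snd (opH₃ y))
  C₄ : j.C₄.Has (LorenzRenorm.dcomp y.fst (opH₄ y))
  C₅ : j.C₅.Has (LorenzRenorm.dcomp y.fst (opH₅ y))
  I : j.I.Has (opI y * opI y)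

theorem jet_holds {n : ℕ} {f g : Ball} {t : Trace} {y : Y} (hf : f.Has y.fst) (hg : g.Has y.snd)
    (h : t.Holds y) : (jet n f g t).Holds y := by
  simp only [jet, seq_eq]
  exact ⟨hf.dcomp h.K h.k n, hf.dcomp h.H₁ h.h₁ n, hg.dcomp h.H₂ h.h₂ n, hg.dcomp h.H₃ h.h₃ n,
    hf.dcomp h.H₄ h.h₄ n, hf.dcomp h.H₅ h.h₅ n, h.I.mul h.I n⟩

/-- Enclosures of all terms in the derivative of `opT` that involve the direction. -/
structure Dir where
  (A K H₁ H₂ H₃ H₄ H₅ : Ball)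

/-- The enclosures in `d` are valid for the direction `η` at `y`. -/
structure Dir.Holds (d : Dir) (y η : Y) : Prop where
  A : d.A.Has (X.constPart η.fst)
  K : d.K.Has (LorenzRenorm.comp η.fst (opK y))
  H₁ : d.H₁.Has (LorenzRenorm.comp η.fst (opH₁ y))
  H₂ : d.H₂.Has (LorenzRenorm.comp η.snd (opH₂ y))
  H₃ : d.H₃.Has (LorenzRenorm.comp η.snd (opH₃ y))
  H₄ : d.H₄.Has (LorenzRenorm.comp η.fst (opH₄ y))
  H₅ : d.H₅.Has (LorenzRenorm.comp η.fst (opH₅ y))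

/-- The computation of the derivative of `opT`. -/
def column {α : Type} (n : ℕ) (t : Trace) (j : Jet) (d : Dir) (k : Ball → Ball → α) : α :=
  (neg (add d.K (mul n j.K (dSqN n t.A d.A)))).seq fun L =>
  (neg (mul n j.I L)).seq fun I =>
  (mul n t.L L).seq fun Q' =>
  (add Q' Q').seq fun Q =>
  (add d.H₁ (mul n j.C₁ (add (smul 5 11 Q) (mulZ Q)))).seq fun U =>
  (mul n t.U U).seq fun W' =>
  (add W' W').seq fun W =>
  (add d.H₂ (mul n j.C₂ (add W W))).seq fun G₂ =>
  (add (mul n t.I (add (mul n t.W G₂) (mul n t.G₂ W))) (mul n t.R I)).seq fun F =>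
  (add d.H₃ (mul n j.C₃ (mulZ Q))).seq fun G₃ =>
  (smul 1 2 (add (mul n t.H₃ G₃) (mul n t.G₃ (mulZ Q)))).seq fun V₁ =>
  (add d.H₄ (mul n j.C₄ (dSqN n t.V₁ V₁))).seq fun V₂ =>
  (add d.H₅ (mul n j.C₅ (dSqN n t.V₂ V₂))).seq fun V₃ =>
  (smul 2 1 (shift (add (mul n t.I V₃) (mul n t.V₃ I)))).seq fun G =>
  k F G

/-- The existential form hides the large expressions for the two resulting balls: later arguments
need only that valid enclosures are passed to the continuation `k`. -/
theorem exists_column {α : Type} (n : ℕ) {t : Trace} {j : Jet} {d : Dir} {y η : Y}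
    (ht : t.Holds y) (hj : j.Holds y) (hd : d.Holds y η) (k : Ball → Ball → α) :
    ∃ F G : Ball, F.Has (dF y η) ∧ G.Has (dG y η) ∧ column n t j d k = k F G := by
  have hy := ht.admissible
  have L := (hd.K.add (hj.K.mul (ht.A.dSqN hd.A n) n)).neg.of_eq (dL_apply hy η).symm
  have I := (hj.I.mul L n).neg.of_eq (dI_apply y η).symm
  have Q := ((ht.L.mul L n).add (ht.L.mul L n)).of_eq (dQ_apply y η).symm
  have H₃ := Q.mulZ.of_eq (dH₃_apply y η).symm
  have U := (hd.H₁.add (hj.C₁.mul ((Q.smul 5 (d := 11) (by norm_num)).add H₃) n)).of_eq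
    (dU_apply hy η).symm
  have W := ((ht.U.mul U n).add (ht.U.mul U n)).of_eq (dW_apply y η).symm
  have G₂ := (hd.H₂.add (hj.C₂.mul (W.add W) n)).of_eq (dG₂_apply hy η).symm
  have F := ((ht.I.mul ((ht.W.mul G₂ n).add (ht.G₂.mul W n)) n).add (ht.R.mul I n)).of_eq
    (dF_apply y η).symm
  have G₃ := (hd.H₃.add (hj.C₃.mul H₃ n)).of_eq (dG₃_apply hy η).symm
  have V₁ := (((ht.H₃.mul G₃ n).add (ht.G₃.mul H₃ n)).smul 1 (d := 2) (by norm_num)).of_eq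
    (dV₁_apply y η).symm
  have V₂ := (hd.H₄.add (hj.C₄.mul (ht.V₁.dSqN V₁ n) n)).of_eq (dV₂_apply hy η).symm
  have V₃ := (hd.H₅.add (hj.C₅.mul (ht.V₂.dSqN V₂ n) n)).of_eq (dV₃_apply hy η).symm
  have G := (((ht.I.mul V₃ n).add (ht.V₃.mul I n)).shift.smul 2 (d := 1) (by norm_num)).of_eq
    (dG_apply y η).symm
  exact ⟨_, _, F, G, by simp only [column, seq_eq]⟩

/-- The direction given by two polynomials. -/
def polyDir (n : ℕ) (t : Trace) (p q : List ℤ) : Dir :=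
  (const (ofPoly p)).seq fun A =>
  (comp n (ofPoly p) t.K).seq fun K =>
  (comp n (ofPoly p) t.H₁).seq fun H₁ =>
  (comp n (ofPoly q) t.H₂).seq fun H₂ =>
  (comp n (ofPoly q) t.H₃).seq fun H₃ =>
  (comp n (ofPoly p) t.H₄).seq fun H₄ =>
  (comp n (ofPoly p) t.H₅).seq fun H₅ =>
  ⟨A, K, H₁, H₂, H₃, H₄, H₅⟩

theorem polyDir_holds (n : ℕ) {t : Trace} (p q : List ℤ) {y η : Y} (ht : t.Holds y)
    (hp : (ofPoly p).Has η.fst) (hq : (ofPoly q).Has η.snd) : (polyDir n t p q).Holds y η := by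
  have hy := ht.admissible
  simp only [polyDir, seq_eq]
  exact ⟨hp.const, hp.comp ht.K hy.k.le n, hp.comp ht.H₁ hy.h₁.le n, hq.comp ht.H₂ hy.h₂.le n,
    hq.comp ht.H₃ hy.h₃.le n, hp.comp ht.H₄ hy.h₄.le n, hp.comp ht.H₅ hy.h₅.le n⟩

/-- A bound for the `k`-th power. -/
def powBound (b : ℕ) : ℕ → ℕ
  | 0 => 281474976710656
  | k + 1 => powBound b k * b / 281474976710656 + 1

theorem unit_mul_pow_le {b : ℕ} {x : ℝ} (h0 : 0 ≤ x) (h : unit * x ≤ b) (k : ℕ) :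
    unit * x ^ k ≤ powBound b k := by
  induction k with
  | zero => simp [powBound, unit]
  | succ k ih =>
    have h1 := div_le_natDiv_add_one (powBound b k * b) unit (by norm_num [unit])
    have h2 : unit * x ^ (k + 1) ≤ ((powBound b k * b : ℕ) : ℝ) / unit := by
      rw [le_div_iff₀ unit_pos, Nat.cast_mul, pow_succ]
      have := mul_le_mul ih h (mul_nonneg unit_pos.le h0) (Nat.cast_nonneg _)
      linarith
    rw [powBound]
    push_cast
    exact h2.trans h1

/-- The direction of a high power of the variable in the first series. -/
def tailDirFst (t : Trace) (k : ℕ) : Dir :=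
  ⟨zero, err (powBound (bound t.K) k), err (powBound (bound t.H₁) k), zero, zero,
    err (powBound (bound t.H₄) k), err (powBound (bound t.H₅) k)⟩

/-- The direction of a high power of the variable in the second series. -/
def tailDirSnd (t : Trace) (k : ℕ) : Dir :=
  ⟨zero, zero, zero, err (2 * powBound (bound t.H₂) k), err (2 * powBound (bound t.H₃) k), zero,
    zero⟩

/-- Since ‖h‖ < 1, ‖hᵐ‖ ≤ ‖h‖ᵏ for every m ≥ k. A single ball around 0 therefore serves all
monomials of degree at least k. -/
theorem Has.err_comp_pow {b : Ball} {h : X} (hb : b.Has h) (hh : ‖h‖ < 1) {k m : ℕ} (hk : k ≤ m)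
    {e : ℕ} {c : ℕ} (he : e = c * powBound (bound b) k) :
    (err e).Has (LorenzRenorm.comp ((c : ℝ) • X.Z ^ m) h) := by
  refine has_err ?_
  rw [comp_smul _ _ hh.le, comp_Z_pow, he, norm_smul, Real.norm_natCast, Nat.cast_mul]
  have h1 : ‖h ^ m‖ ≤ ‖h‖ ^ k :=
    (norm_pow_le h m).trans (pow_le_pow_of_le_one (norm_nonneg _) hh.le hk)
  have h2 := unit_mul_pow_le (norm_nonneg h) hb.unit_mul_norm_le k
  have h3 := mul_le_mul_of_nonneg_left h1 unit_pos.le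
  have h4 := mul_le_mul_of_nonneg_left (h3.trans h2) (Nat.cast_nonneg (α := ℝ) c)
  linarith

theorem tailDirFst_holds {t : Trace} {k m : ℕ} (hk0 : 0 < k) (hk : k ≤ m) {y η : Y}
    (ht : t.Holds y) (h1 : η.fst = X.Z ^ m) (h2 : η.snd = 0) : (tailDirFst t k).Holds y η := by
  have hy := ht.admissible
  -- A monomial of positive degree has no constant term, hence the exact `zero` in the first slot.
  have h3 : X.constPart η.fst = 0 := by
    rw [X.constPart_apply, h1, X.Z_pow_apply, if_neg (by omega), zero_smul]
  have h4 : η.fst = ((1 : ℕ) : ℝ) • X.Z ^ m := by simpa using h1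
  refine ⟨?_, ?_, ?_, ?_, ?_, ?_, ?_⟩
  · rw [h3]
    exact has_zero
  · rw [h4]
    exact ht.K.err_comp_pow hy.k hk (one_mul _).symm
  · rw [h4]
    exact ht.H₁.err_comp_pow hy.h₁ hk (one_mul _).symm
  · rw [h2, comp_zero]
    exact has_zero
  · rw [h2, comp_zero]
    exact has_zero
  · rw [h4]
    exact ht.H₄.err_comp_pow hy.h₄ hk (one_mul _).symm
  · rw [h4]
    exact ht.H₅.err_comp_pow hy.h₅ hk (one_mul _).symm

theorem tailDirSnd_holds {t : Trace} {k m : ℕ} (hk : k ≤ m) {y η : Y}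
    (ht : t.Holds y) (h1 : η.fst = 0) (h2 : η.snd = (2 : ℝ) • X.Z ^ m) :
    (tailDirSnd t k).Holds y η := by
  have hy := ht.admissible
  have h4 : η.snd = ((2 : ℕ) : ℝ) • X.Z ^ m := by simpa using h2
  refine ⟨?_, ?_, ?_, ?_, ?_, ?_, ?_⟩
  · rw [h1, map_zero]
    exact has_zero
  · rw [h1, comp_zero]
    exact has_zero
  · rw [h1, comp_zero]
    exact has_zero
  · rw [h4]
    exact ht.H₂.err_comp_pow hy.h₂ hk rfl
  · rw [h4]
    exact ht.H₃.err_comp_pow hy.h₃ hk rfl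
  · rw [h1, comp_zero]
    exact has_zero
  · rw [h1, comp_zero]
    exact has_zero

end Ball

end LorenzRenorm

namespace LorenzRenorm

open Set Filter Topology

open scoped X

/-! ### The approximate fixed point, the change of coordinates, and the numerical checks -/

namespace Ball

/-- The left Taylor coefficients of the approximate fixed point. -/
def baseFst : List ℤ :=
  [-211653507122683, -713511795268237, 83922290453759, 25425220087953, -2037831978082,
    -248793264995, 29924023569, -116129186, -304741400, 21800132, 2952045, -291567, -29849, 3672]

/-- The right Taylor coefficients of the approximate fixed point. -/
def baseSnd : List ℤ :=
  [1757273355933015, -598444298847386, 46325848703374, 14795816316908, -5213610405004,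
    911124425150, -79699574592, -9191577918, 4990330502, -932247067, 73404458, 8690513,
    -3803426, 599028]

/-- The first approximate eigenvector. -/
def axis₁Fst : List ℤ :=
  [1125899906842624, 1052653534576640, -645284476485632, -229746390597632, 30189325123584,
    3968549781504, -635655159808, 8589934592, 8589934592]

def axis₁Snd : List ℤ :=
  [-4031041555660800, 3530506066984960, -414773581709312, -213893666308096, 93522912870400,
    -19649475379200, 1962800054272, 292057776128, -167503724544, 34359738368]

/-- The second approximate eigenvector. -/
def axis₂Fst : List ℤ :=
  [0, 1125899906842624, -416186625949696, -196928545488896, 22582938042368, 3440268804096,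
    -511101108224, 4294967296, 8589934592]

def axis₂Snd : List ℤ :=
  [-3844176118546432, 3015874495643648, -322968655757312, -185293479084032, 78756815306752,
    -16338055593984, 1584842932224, 253403070464, -141733920768, 30064771072]

/-- Half of the third approximate eigenvector. -/
def axis₃Fst : List ℤ :=
  [0, 0, 147298050899968, -43941810405376, -5817533202432, 1924145348608, 36507222016,
    -32212254720, 2147483648]

def axis₃Snd : List ℤ :=
  [-2305244239233024, 2251799813685248, -525040424583168, -34087007944704, 45831596015616,
    -13615046328320, 2211908157440, -60129542144, -77309411328, 23622320128]

/-- The radius of the ball in which the fixed point is found. -/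
def rad : ℕ := 2250000

/-- A bound for the first component on the ball. -/
def radFst : ℕ := 24800000

/-- A bound for the second component on the ball. -/
def radSnd : ℕ := 83200000

/-- The fixed point and its neighbourhood. -/
def nearFst : Ball := ⟨baseFst, radFst⟩

def nearSnd : Ball := ⟨baseSnd, radSnd⟩

/-- Application of the preconditioner. -/
def solve {α : Type} (n : ℕ) (f g : Ball) (k : Ball → Ball → α) : α :=
  (smul 1 4 (const f)).seq fun c₁ =>
  (sub f (mul n c₁ (ofPoly axis₁Fst))).seq fun f₁ =>
  (sub g (mul n c₁ (ofPoly axis₁Snd))).seq fun g₁ =>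
  (smul 1 4 (const (shift f₁))).seq fun c₂ =>
  (sub f₁ (mul n c₂ (ofPoly axis₂Fst))).seq fun f₂ =>
  (sub g₁ (mul n c₂ (ofPoly axis₂Snd))).seq fun g₂ =>
  (smul 1 8 (const (shift g₂))).seq fun c₃ =>
  (sub f₂ (mul n c₃ (ofPoly axis₃Fst))).seq fun f₃ =>
  (sub g₂ (mul n c₃ (ofPoly axis₃Snd))).seq fun g₃ =>
  k (sub (sub f₃ (smul 1 22 c₁)) (mulZ (smul 1 11 c₂))) (smul 1 2 (add g₃ (mulZ c₃)))

/-- `t`, evaluated before it is passed on to `k`. -/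
def Trace.seq {α : Type} (t : Trace) (k : Trace → α) : α :=
  match t with
  | ⟨A, K, L, I, Q, H₃, H₁, U, W, H₂, G₂, R, G₃, V₁, H₄, V₂, H₅, V₃⟩ =>
    k ⟨A, K, L, I, Q, H₃, H₁, U, W, H₂, G₂, R, G₃, V₁, H₄, V₂, H₅, V₃⟩

/-- `j`, evaluated before it is passed on to `k`. -/
def Jet.seq {α : Type} (j : Jet) (k : Jet → α) : α :=
  match j with
  | ⟨K, C₁, C₂, C₃, C₄, C₅, I⟩ => k ⟨K, C₁, C₂, C₃, C₄, C₅, I⟩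

/-- `d`, evaluated before it is passed on to `k`. -/
def Dir.seq {α : Type} (d : Dir) (k : Dir → α) : α :=
  match d with
  | ⟨A, K, H₁, H₂, H₃, H₄, H₅⟩ => k ⟨A, K, H₁, H₂, H₃, H₄, H₅⟩

/-- The image of a direction under the derivative, after preconditioning and a correction by `c`,
has norm at most `3 / 4`. -/
def columnOK (n : ℕ) (t : Trace) (j : Jet) (d : Dir) (c : Ball) : Bool :=
  d.seq fun d => column n t j d fun F G => solve n F G fun f g =>
    4 * (bound (add f c) + bound g) ≤ 844424930131968

/-- The coefficients of the monomial `m * z ^ k`. -/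
def monomial (m : ℕ) : ℕ → List ℤ
  | 0 => [281474976710656 * m]
  | k + 1 => 0 :: monomial m k

/-- The coordinate directions and the corrections of the corresponding columns. -/
def directions (n : ℕ) (t : Trace) : List (Dir × Ball) :=
  (polyDir n t axis₁Fst axis₁Snd, smul 23 22 (ofPoly [281474976710656])) ::
  (polyDir n t axis₂Fst axis₂Snd, mulZ (smul 12 11 (ofPoly [281474976710656]))) ::
  (polyDir n t (polyAdd axis₃Fst axis₃Fst) (polyAdd axis₃Snd axis₃Snd), zero) ::
  (polyDir n t [] (monomial 2 0), zero) ::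
  (tailDirFst t 12, zero) ::
  (tailDirSnd t 12, zero) ::
  (((List.range 10).map fun k => (polyDir n t (monomial 1 (k + 2)) [], zero)) ++
    (List.range 10).map fun k => (polyDir n t [] (monomial 2 (k + 2)), zero))

/-- All columns are small, in the whole ball. -/
def columnsOK : Bool :=
  (trace 14 nearFst nearSnd).seq fun t => (jet 14 nearFst nearSnd t).seq fun j =>
    t.ok 14 && (directions 14 t).all fun d => columnOK 14 t j d.1 d.2

/-- The approximate fixed point is almost fixed. -/
def residualOK : Bool :=
  (trace 16 (ofPoly baseFst) (ofPoly baseSnd)).seq fun t =>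
    t.ok 16 && solve 16 (sub (result 16 t).1 (ofPoly baseFst)) (sub (result 16 t).2 (ofPoly baseSnd))
      fun f g => 5 * (bound f + bound g) ≤ rad

end Ball

end LorenzRenorm

namespace LorenzRenorm

open Set Filter Topology

open scoped X

noncomputable section

/-! ### Coordinates in `Y` -/

/-- The pair of two series. -/
def toYL : X × X →L[ℝ] Y := ((WithLp.prodContinuousLinearEquiv 1 ℝ X X).symm : X × X →L[ℝ] Y)

@[simp] theorem toYL_fst (p : X × X) : (toYL p).fst = p.1 := rfl

@[simp] theorem toYL_snd (p : X × X) : (toYL p).snd = p.2 := rfl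

theorem Y_ext {x y : Y} (h₁ : x.fst = y.fst) (h₂ : x.snd = y.snd) : x = y :=
  WithLp.ofLp_injective 1 (Prod.ext h₁ h₂)

@[simp] theorem Y_add_fst (x y : Y) : (x + y).fst = x.fst + y.fst := rfl

@[simp] theorem Y_add_snd (x y : Y) : (x + y).snd = x.snd + y.snd := rfl

@[simp] theorem Y_sub_fst (x y : Y) : (x - y).fst = x.fst - y.fst := rfl

@[simp] theorem Y_sub_snd (x y : Y) : (x - y).snd = x.snd - y.snd := rfl

@[simp] theorem Y_smul_fst (c : ℝ) (x : Y) : (c • x).fst = c • x.fst := rfl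

@[simp] theorem Y_smul_snd (c : ℝ) (x : Y) : (c • x).snd = c • x.snd := rfl

/-- The unit vectors of `Y`. -/
def basisVec : ℕ ⊕ ℕ → Y
  | .inl k => toYL (X.Z ^ k, 0)
  | .inr k => toYL (0, X.Z ^ k)

/-- The coordinates of a point of `Y`. -/
def coord : ℕ ⊕ ℕ → Y →L[ℝ] ℝ
  | .inl k => (X.coeff k).comp fstL
  | .inr k => (X.coeff k).comp sndL

@[simp] theorem coord_inl (k : ℕ) (x : Y) : coord (.inl k) x = x.fst k := rfl

@[simp] theorem coord_inr (k : ℕ) (x : Y) : coord (.inr k) x = x.snd k := rfl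

theorem hasSum_basisVec (x : Y) : HasSum (fun i => coord i x • basisVec i) x := by
  have h₁ := (X.hasSum_Z_pow x.fst).mapL (toYL.comp (ContinuousLinearMap.inl ℝ X X))
  have h₂ := (X.hasSum_Z_pow x.snd).mapL (toYL.comp (ContinuousLinearMap.inr ℝ X X))
  have h₃ : x = toYL.comp (ContinuousLinearMap.inl ℝ X X) x.fst +
      toYL.comp (ContinuousLinearMap.inr ℝ X X) x.snd :=
    Y_ext (add_zero x.fst).symm (zero_add x.snd).symm
  nth_rw 2 [h₃]
  refine HasSum.sum ?_ ?_
  · refine h₁.congr_fun fun k => ?_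
    simp [basisVec]
  · refine h₂.congr_fun fun k => ?_
    simp [basisVec]

theorem hasSum_abs_coord (x : Y) : HasSum (fun i => |coord i x|) ‖x‖ := by
  rw [norm_Y]
  exact HasSum.sum (X.hasSum_abs x.fst) (X.hasSum_abs x.snd)

theorem eq_zero_of_coord {x : Y} (h : ∀ i, coord i x = 0) : x = 0 := by
  have := hasSum_abs_coord x
  simp only [h, abs_zero] at this
  exact norm_eq_zero.1 (this.unique hasSum_zero)

/-- The norm of an operator on ℓ¹ is controlled by the images of the unit vectors. -/
theorem norm_apply_le_of_columns {F : Type*} [NormedAddCommGroup F] [NormedSpace ℝ F]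
    (A : Y →L[ℝ] F) {C : ℝ} (h : ∀ i, ‖A (basisVec i)‖ ≤ C) (x : Y) : ‖A x‖ ≤ C * ‖x‖ := by
  have h₁ := (hasSum_basisVec x).mapL A
  have h₂ := (hasSum_abs_coord x).mul_left C
  refine h₁.norm_le_of_bounded h₂ fun i => ?_
  rw [map_smul, norm_smul, Real.norm_eq_abs, mul_comm]
  exact mul_le_mul_of_nonneg_right (h i) (abs_nonneg _)

theorem enorm_eq_tsum_coord (x : Y) : ‖x‖ₑ = ∑' i, ‖coord i x‖ₑ := by
  have h := hasSum_abs_coord x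
  rw [← ofReal_norm, ← h.tsum_eq,
    ENNReal.ofReal_tsum_of_nonneg (fun i => abs_nonneg _) h.summable]
  refine tsum_congr fun i => ?_
  rw [← Real.norm_eq_abs, ofReal_norm]

/-- The complex coordinates of `x + i y`. -/
def complexCoord (x y : Y) (i : ℕ ⊕ ℕ) : ℂ := coord i x + coord i y * Complex.I

theorem enorm_ofReal_complex (x : ℝ) : ‖(x : ℂ)‖ₑ = ‖x‖ₑ := by
  rw [← ofReal_norm, ← ofReal_norm, Complex.norm_real]

theorem tsum_complexCoord_ne_top (x y : Y) : ∑' i, ‖complexCoord x y i‖ₑ ≠ ⊤ := by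
  have h : ∀ i, ‖complexCoord x y i‖ₑ ≤ ‖coord i x‖ₑ + ‖coord i y‖ₑ := by
    intro i
    refine (enorm_add_le _ _).trans (le_of_eq ?_)
    rw [enorm_mul, enorm_ofReal_complex, enorm_ofReal_complex, ← ofReal_norm Complex.I]
    simp
  refine ne_top_of_le_ne_top ?_ (ENNReal.tsum_le_tsum h)
  rw [ENNReal.tsum_add, ← enorm_eq_tsum_coord, ← enorm_eq_tsum_coord]
  exact ENNReal.add_ne_top.2 ⟨enorm_ne_top, enorm_ne_top⟩

/-- The column bound survives complexification in the norm ∑ |xᵢ + i yᵢ|: expand in columns and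
exchange the sums. This norm, unlike ‖x‖ + ‖y‖, scales exactly under multiplication of the
coordinates by complex numbers. Values in [0, ∞] make the exchange unconditional. -/
theorem tsum_complexCoord_apply_le (A : Y →L[ℝ] Y) {C : ENNReal}
    (h : ∀ i, ‖A (basisVec i)‖ₑ ≤ C) (x y : Y) :
    ∑' i, ‖complexCoord (A x) (A y) i‖ₑ ≤ C * ∑' i, ‖complexCoord x y i‖ₑ := by
  have h₁ : ∀ i, complexCoord (A x) (A y) i =
      ∑' j, complexCoord x y j * (coord i (A (basisVec j)) : ℂ) := by
    intro i
    have hs : ∀ x : Y, HasSum (fun j => ((coord j x * coord i (A (basisVec j)) : ℝ) : ℂ))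
        (coord i (A x) : ℂ) := by
      intro x
      have := (hasSum_basisVec x).mapL (Complex.ofRealCLM.comp ((coord i).comp A))
      refine this.congr_fun fun j => ?_
      simp
    rw [complexCoord, ← ((hs x).add ((hs y).mul_right Complex.I)).tsum_eq]
    refine tsum_congr fun j => ?_
    rw [complexCoord]
    push_cast
    ring
  calc ∑' i, ‖complexCoord (A x) (A y) i‖ₑ
      ≤ ∑' i, ∑' j, ‖complexCoord x y j‖ₑ * ‖coord i (A (basisVec j))‖ₑ := by
        refine ENNReal.tsum_le_tsum fun i => ?_
        rw [h₁]
        refine enorm_tsum_le_tsum_enorm.trans (le_of_eq (tsum_congr fun j => ?_))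
        rw [enorm_mul, enorm_ofReal_complex]
    _ = ∑' j, ‖complexCoord x y j‖ₑ * ‖A (basisVec j)‖ₑ := by
        rw [ENNReal.tsum_comm]
        refine tsum_congr fun j => ?_
        rw [ENNReal.tsum_mul_left, ← enorm_eq_tsum_coord]
    _ ≤ ∑' j, ‖complexCoord x y j‖ₑ * C :=
        ENNReal.tsum_le_tsum fun j => by gcongr; exact h j
    _ = C * ∑' i, ‖complexCoord x y i‖ₑ := by
        rw [ENNReal.tsum_mul_right, mul_comm]

/-- A weighted `ℓ¹` estimate that excludes eigenvectors. -/
theorem eq_zero_of_complexCoord_eq (A : Y →L[ℝ] Y) {κ : ℝ} (hκ : κ < 1)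
    (h : ∀ i, ‖A (basisVec i)‖ ≤ κ) (m : ℕ ⊕ ℕ → ℂ) (hm : ∀ i, 1 ≤ ‖m i‖) {x y : Y}
    (hxy : ∀ i, complexCoord (A x) (A y) i = m i * complexCoord x y i) : x = 0 ∧ y = 0 := by
  have h₁ := tsum_complexCoord_apply_le A (C := ENNReal.ofReal κ) (fun i => by
    rw [← ofReal_norm]
    exact ENNReal.ofReal_le_ofReal (h i)) x y
  have h₂ : ∑' i, ‖complexCoord x y i‖ₑ ≤ ∑' i, ‖complexCoord (A x) (A y) i‖ₑ := by
    refine ENNReal.tsum_le_tsum fun i => ?_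
    rw [hxy, enorm_mul]
    refine le_mul_of_one_le_left' ?_
    rw [← ofReal_norm, ← ENNReal.ofReal_one]
    exact ENNReal.ofReal_le_ofReal (hm i)
  have h₃ : ∑' i, ‖complexCoord x y i‖ₑ = 0 := by
    by_contra h0
    have h4 := h₂.trans h₁
    -- A strict inequality requires the sum to be non-zero and finite; finiteness is
    -- `tsum_complexCoord_ne_top`.
    have h5 : ENNReal.ofReal κ * ∑' i, ‖complexCoord x y i‖ₑ <
        1 * ∑' i, ‖complexCoord x y i‖ₑ := by
      rw [ENNReal.mul_lt_mul_iff_left h0 (tsum_complexCoord_ne_top x y)]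
      simpa using hκ
    rw [one_mul] at h5
    exact absurd h4 h5.not_ge
  rw [ENNReal.tsum_eq_zero] at h₃
  have h₄ : ∀ i, coord i x = 0 ∧ coord i y = 0 := by
    intro i
    have := enorm_eq_zero.1 (h₃ i)
    rw [complexCoord, Complex.ext_iff] at this
    simpa using this
  exact ⟨eq_zero_of_coord fun i => (h₄ i).1, eq_zero_of_coord fun i => (h₄ i).2⟩

/-! ### Compact operators without spectrum at a point of the unit circle -/

section

variable {E : Type*} [NormedAddCommGroup E] [NormedSpace ℝ E]

/-- Multiplication by `μ` in the complexification. -/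
def complexMul (μ : ℂ) : (E × E) →L[ℝ] (E × E) :=
  (μ.re • ContinuousLinearMap.fst ℝ E E - μ.im • ContinuousLinearMap.snd ℝ E E).prod
    (μ.re • ContinuousLinearMap.snd ℝ E E + μ.im • ContinuousLinearMap.fst ℝ E E)

theorem complexMul_apply (μ : ℂ) (p : E × E) :
    complexMul μ p = (μ.re • p.1 - μ.im • p.2, μ.re • p.2 + μ.im • p.1) := rfl

theorem complexMul_mul (μ ν : ℂ) :
    (complexMul μ : (E × E) →L[ℝ] (E × E)) * complexMul ν = complexMul (μ * ν) := by
  refine ContinuousLinearMap.ext fun p => ?_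
  rw [mul_apply_eq_comp]
  simp only [complexMul_apply, Complex.mul_re, Complex.mul_im]
  refine Prod.ext ?_ ?_ <;> module

theorem complexMul_one : (complexMul 1 : (E × E) →L[ℝ] (E × E)) = 1 := by
  refine ContinuousLinearMap.ext fun p => ?_
  simp [complexMul_apply]

theorem complexShift_apply (A : E →L[ℝ] E) (μ : ℂ) (p : E × E) :
    complexShift A μ p =
      (A p.1 - μ.re • p.1 + μ.im • p.2, A p.2 - μ.re • p.2 - μ.im • p.1) := rfl

/-- As |μ| = 1, A - μ = μ(μ̄A - 1), where multiplication by μ is invertible and μ̄A is compact on E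
× E. The Fredholm alternative for the real number 1 applies, and the hypothesis rules out an
eigenvector. -/
theorem isUnit_complexShift [CompleteSpace E] {A : E →L[ℝ] E} (hA : IsCompactOperator A) {μ : ℂ}
    (hμ : ‖μ‖ = 1)
    (h : ∀ u v : E, A u = μ.re • u - μ.im • v → A v = μ.re • v + μ.im • u → u = 0 ∧ v = 0) :
    IsUnit (complexShift A μ) := by
  set ν := starRingEnd ℂ μ with hν
  have h₁ : μ * ν = 1 := by
    rw [hν, Complex.mul_conj, Complex.normSq_eq_norm_sq, hμ]
    simp
  have h₂ : ν * μ = 1 := by rw [mul_comm, h₁]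
  set P : (E × E) →L[ℝ] (E × E) := (A.comp (ContinuousLinearMap.fst ℝ E E)).prod
    (A.comp (ContinuousLinearMap.snd ℝ E E)) with hP
  have hPc : IsCompactOperator P := by
    have e : ⇑P = ContinuousLinearMap.inl ℝ E E ∘ A ∘ ContinuousLinearMap.fst ℝ E E +
        ContinuousLinearMap.inr ℝ E E ∘ A ∘ ContinuousLinearMap.snd ℝ E E := by
      funext p
      simp [hP]
    rw [e]
    exact ((hA.comp_clm _).clm_comp _).add ((hA.comp_clm _).clm_comp _)
  set C : (E × E) →L[ℝ] (E × E) := complexMul ν * P with hC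
  have hCc : IsCompactOperator C := hPc.clm_comp (complexMul ν)
  have h₃ : complexShift A μ = complexMul μ * (C - 1) := by
    rw [hC, mul_sub, ← mul_assoc, complexMul_mul, h₁, complexMul_one, one_mul, mul_one]
    refine ContinuousLinearMap.ext fun p => ?_
    rw [complexShift_apply, sub_apply, complexMul_apply]
    refine Prod.ext ?_ ?_
    · change A p.1 - μ.re • p.1 + μ.im • p.2 = A p.1 - (μ.re • p.1 - μ.im • p.2)
      abel
    · change A p.2 - μ.re • p.2 - μ.im • p.1 = A p.2 - (μ.re • p.2 + μ.im • p.1)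
      abel
  have h₄ : IsUnit (complexMul μ : (E × E) →L[ℝ] (E × E)) :=
    ⟨⟨complexMul μ, complexMul ν, by rw [complexMul_mul, h₁, complexMul_one],
      by rw [complexMul_mul, h₂, complexMul_one]⟩, rfl⟩
  rw [h₃]
  refine h₄.mul ?_
  rcases hCc.hasEigenvalue_or_mem_resolventSet (μ := (1 : ℝ)) one_ne_zero with h₅ | h₅
  · exfalso
    obtain ⟨p, hp⟩ := h₅.exists_hasEigenvector
    have hp1 : C p = p := by
      have := hp.apply_eq_smul
      rwa [one_smul] at this
    have hp2 : P p = complexMul μ p := by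
      have h6 : complexMul μ * C = P := by
        rw [hC, ← mul_assoc, complexMul_mul, h₁, complexMul_one, one_mul]
      rw [← h6, mul_apply_eq_comp, hp1]
    have := h p.1 p.2 (congrArg Prod.fst hp2) (congrArg Prod.snd hp2)
    exact hp.2 (Prod.ext this.1 this.2)
  · rw [spectrum.mem_resolventSet_iff, map_one] at h₅
    rw [← neg_sub]
    exact h₅.neg

end

end

end LorenzRenorm

namespace LorenzRenorm

open Set Filter Topology

open scoped X

noncomputable section

/-! ### The change of coordinates and the preconditioner -/

/-- The invertible operator `x + ℓ x • v`. -/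
def rankOne (ℓ : Y →L[ℝ] ℝ) (v : Y) (h : 1 + ℓ v ≠ 0) : Y ≃L[ℝ] Y :=
  ContinuousLinearEquiv.equivOfInverse (.id ℝ Y + ℓ.smulRight v)
    (.id ℝ Y - ℓ.smulRight ((1 + ℓ v)⁻¹ • v))
    (fun x => by
      simp only [add_apply, sub_apply, ContinuousLinearMap.id_apply,
        ContinuousLinearMap.smulRight_apply, map_add, map_smul, smul_smul]
      match_scalars <;> field_simp
      ring)
    (fun x => by
      simp only [add_apply, sub_apply, ContinuousLinearMap.id_apply,
        ContinuousLinearMap.smulRight_apply, map_sub, map_smul, smul_smul]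
      match_scalars <;> field_simp
      ring)

theorem rankOne_apply (ℓ : Y →L[ℝ] ℝ) (v : Y) (h : 1 + ℓ v ≠ 0) (x : Y) :
    rankOne ℓ v h x = x + ℓ x • v := rfl

/-- The pair of polynomials with the given coefficients. -/
def polyY (p q : List ℤ) : Y :=
  toYL ((Ball.unit : ℝ)⁻¹ • toX p, (Ball.unit : ℝ)⁻¹ • toX q)

theorem has_polyY_fst (p q : List ℤ) : (Ball.ofPoly p).Has (polyY p q).fst := Ball.has_ofPoly p

theorem has_polyY_snd (p q : List ℤ) : (Ball.ofPoly q).Has (polyY p q).snd := Ball.has_ofPoly q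

theorem toX_cons_zero (a : ℤ) (p : List ℤ) : toX (a :: p) 0 = a := by
  rw [toX, X.add_apply', X.smul_apply', X.Z_mul_zero, X.coeff_one]
  simp

theorem toX_cons_succ (a : ℤ) (p : List ℤ) (k : ℕ) : toX (a :: p) (k + 1) = toX p k := by
  rw [toX, X.add_apply', X.smul_apply', X.Z_mul_succ, X.coeff_one]
  simp

/-- The approximate fixed point. -/
def basePoint : Y := polyY Ball.baseFst Ball.baseSnd

/-- The first approximate eigenvector. -/
def axis₁ : Y := polyY Ball.axis₁Fst Ball.axis₁Snd

/-- The second approximate eigenvector. -/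
def axis₂ : Y := polyY Ball.axis₂Fst Ball.axis₂Snd

/-- Half of the third approximate eigenvector. -/
def axis₃ : Y := polyY Ball.axis₃Fst Ball.axis₃Snd

/-- The axes are normalized to have exact pivots 4, 4, 8 at `inl 0`, `inl 1`, `inr 1`, and each
later axis vanishes at the pivots of the earlier ones. Elimination is therefore triangular, with
exact divisors. -/
theorem axis₁_zero : axis₁.fst 0 = 4 := by
  change (Ball.unit : ℝ)⁻¹ * toX Ball.axis₁Fst 0 = 4
  rw [Ball.axis₁Fst, toX_cons_zero]
  norm_num [Ball.unit]

theorem axis₂_zero : axis₂.fst 0 = 0 := by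
  change (Ball.unit : ℝ)⁻¹ * toX Ball.axis₂Fst 0 = 0
  rw [Ball.axis₂Fst, toX_cons_zero]
  norm_num

theorem axis₂_one : axis₂.fst 1 = 4 := by
  change (Ball.unit : ℝ)⁻¹ * toX Ball.axis₂Fst 1 = 4
  rw [Ball.axis₂Fst, toX_cons_succ, toX_cons_zero]
  norm_num [Ball.unit]

theorem axis₃_zero : axis₃.fst 0 = 0 := by
  change (Ball.unit : ℝ)⁻¹ * toX Ball.axis₃Fst 0 = 0
  rw [Ball.axis₃Fst, toX_cons_zero]
  norm_num

theorem axis₃_one : axis₃.fst 1 = 0 := by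
  change (Ball.unit : ℝ)⁻¹ * toX Ball.axis₃Fst 1 = 0
  rw [Ball.axis₃Fst, toX_cons_succ, toX_cons_zero]
  norm_num

theorem axis₃_snd_one : axis₃.snd 1 = 8 := by
  change (Ball.unit : ℝ)⁻¹ * toX Ball.axis₃Snd 1 = 8
  rw [Ball.axis₃Snd, toX_cons_succ, toX_cons_zero]
  norm_num [Ball.unit]

theorem coord_basisVec (i j : ℕ ⊕ ℕ) : coord i (basisVec j) = if i = j then 1 else 0 := by
  rcases i with i | i <;> rcases j with j | j
  · simp [basisVec, X.Z_pow_apply]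
  · simp [basisVec]
  · simp [basisVec]
  · simp [basisVec, X.Z_pow_apply]

/-- Doubling of the second series. -/
def doubleSnd : Y ≃L[ℝ] Y :=
  ContinuousLinearEquiv.equivOfInverse (toYL.comp (fstL.prod ((2 : ℝ) • sndL)))
    (toYL.comp (fstL.prod ((1 / 2 : ℝ) • sndL)))
    (fun x => Y_ext rfl (by
      change (1 / 2 : ℝ) • (2 : ℝ) • x.snd = x.snd
      rw [smul_smul]
      norm_num))
    (fun x => Y_ext rfl (by
      change (2 : ℝ) • (1 / 2 : ℝ) • x.snd = x.snd
      rw [smul_smul]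
      norm_num))

theorem doubleSnd_apply (x : Y) : doubleSnd x = toYL (x.fst, (2 : ℝ) • x.snd) := rfl

theorem doubleSnd_symm_apply (x : Y) : doubleSnd.symm x = toYL (x.fst, (1 / 2 : ℝ) • x.snd) := rfl

theorem coord_axis₁_sub : coord (.inl 0) (axis₁ - basisVec (.inl 0)) = 3 := by
  rw [map_sub, coord_inl, axis₁_zero, coord_basisVec, if_pos rfl]
  norm_num

theorem coord_axis₂_sub : coord (.inl 1) (axis₂ - basisVec (.inl 1)) = 3 := by
  rw [map_sub, coord_inl, axis₂_one, coord_basisVec, if_pos rfl]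
  norm_num

theorem coord_axis₃_sub : coord (.inr 1) (axis₃ - basisVec (.inr 1)) = 7 := by
  rw [map_sub, coord_inr, axis₃_snd_one, coord_basisVec, if_pos rfl]
  norm_num

/-- The coordinates adapted to the approximate eigenvectors. -/
def frame : Y ≃L[ℝ] Y :=
  ((doubleSnd.trans (rankOne (coord (.inr 1)) (axis₃ - basisVec (.inr 1))
    (by rw [coord_axis₃_sub]; norm_num))).trans
    (rankOne (coord (.inl 1)) (axis₂ - basisVec (.inl 1))
      (by rw [coord_axis₂_sub]; norm_num))).trans
    (rankOne (coord (.inl 0)) (axis₁ - basisVec (.inl 0))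
      (by rw [coord_axis₁_sub]; norm_num))

/-- Since `axis₃` vanishes at `inl 0` and `inl 1`, and `axis₂` at `inl 0`, each rank-one factor
reads a coordinate that the preceding ones left unchanged, and the corrections simply add up. -/
theorem frame_apply (x : Y) : frame x =
    doubleSnd x + (2 * x.snd 1) • (axis₃ - basisVec (.inr 1)) +
      x.fst 1 • (axis₂ - basisVec (.inl 1)) + x.fst 0 • (axis₁ - basisVec (.inl 0)) := by
  simp only [frame, ContinuousLinearEquiv.trans_apply, rankOne_apply]
  have h₁ : coord (.inr 1) (doubleSnd x) = 2 * x.snd 1 := rfl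
  have h₂ : coord (.inl 1) (doubleSnd x) = x.fst 1 := rfl
  have h₃ : coord (.inl 0) (doubleSnd x) = x.fst 0 := rfl
  simp only [map_add, map_smul, map_sub, h₁, h₂, h₃, coord_basisVec, coord_inl, axis₃_one,
    axis₃_zero, axis₂_zero]
  simp

theorem frame_inl_zero : frame (basisVec (.inl 0)) = axis₁ := by
  have h : doubleSnd (basisVec (.inl 0)) = basisVec (.inl 0) :=
    Y_ext rfl (smul_zero (2 : ℝ))
  rw [frame_apply, h, ← coord_inr, ← coord_inl, ← coord_inl]
  simp [coord_basisVec]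

theorem frame_inl_one : frame (basisVec (.inl 1)) = axis₂ := by
  have h : doubleSnd (basisVec (.inl 1)) = basisVec (.inl 1) :=
    Y_ext rfl (smul_zero (2 : ℝ))
  rw [frame_apply, h, ← coord_inr, ← coord_inl, ← coord_inl]
  simp [coord_basisVec]

theorem frame_inr_one : frame (basisVec (.inr 1)) = (2 : ℝ) • axis₃ := by
  have h : doubleSnd (basisVec (.inr 1)) = (2 : ℝ) • basisVec (.inr 1) :=
    Y_ext (smul_zero (2 : ℝ)).symm rfl
  rw [frame_apply, h, ← coord_inr, ← coord_inl, ← coord_inl]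
  simp [coord_basisVec, smul_sub]

theorem frame_inl {k : ℕ} (hk : 2 ≤ k) : frame (basisVec (.inl k)) = toYL (X.Z ^ k, 0) := by
  have h : doubleSnd (basisVec (.inl k)) = basisVec (.inl k) :=
    Y_ext rfl (smul_zero (2 : ℝ))
  rw [frame_apply, h, ← coord_inr, ← coord_inl, ← coord_inl]
  rw [coord_basisVec, coord_basisVec, coord_basisVec]
  simp [show 1 ≠ k by omega, show 0 ≠ k by omega, basisVec]

theorem frame_inr {k : ℕ} (hk : k ≠ 1) :
    frame (basisVec (.inr k)) = toYL (0, (2 : ℝ) • X.Z ^ k) := by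
  rw [frame_apply, ← coord_inr, ← coord_inl, ← coord_inl]
  rw [coord_basisVec, coord_basisVec, coord_basisVec]
  simp [hk.symm, doubleSnd_apply, basisVec]

/-- The diagonal part of the preconditioner. -/
def damping : Y ≃L[ℝ] Y :=
  (rankOne (coord (.inl 0)) (-(23 / 22 : ℝ) • basisVec (.inl 0))
    (by rw [map_smul, coord_basisVec]; norm_num)).trans
    (rankOne (coord (.inl 1)) (-(12 / 11 : ℝ) • basisVec (.inl 1))
      (by rw [map_smul, coord_basisVec]; norm_num))

theorem damping_apply (x : Y) : damping x =
    x - (23 / 22 * x.fst 0) • basisVec (.inl 0) - (12 / 11 * x.fst 1) • basisVec (.inl 1) := by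
  simp only [damping, ContinuousLinearEquiv.trans_apply, rankOne_apply, map_add, map_smul,
    coord_basisVec, coord_inl]
  simp
  module

/-- The diagonal entries of `damping`. -/
def dampingCoeff : ℕ ⊕ ℕ → ℝ
  | .inl 0 => -(1 / 22)
  | .inl 1 => -(1 / 11)
  | _ => 1

theorem coord_damping (i : ℕ ⊕ ℕ) (x : Y) : coord i (damping x) = dampingCoeff i * coord i x := by
  rw [damping_apply, map_sub, map_sub, map_smul, map_smul, coord_basisVec, coord_basisVec]
  match i with
  | .inl 0 =>
    simp [dampingCoeff]
    ring
  | .inl 1 =>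
    simp [dampingCoeff]
    ring
  | .inl (k + 2) => simp [dampingCoeff]
  | .inr k => simp [dampingCoeff]

/-- The preconditioner. -/
def precond : Y ≃L[ℝ] Y := frame.symm.trans damping

theorem precond_frame (x : Y) : precond (frame x) = damping x := by
  simp [precond]

/-- Elimination in the directions of the approximate eigenvectors. -/
theorem precond_apply {z z₁ z₂ z₃ : Y} {c₁ c₂ c₃ : ℝ} (hc₁ : c₁ = 1 / 4 * z.fst 0)
    (hz₁ : z₁ = z - c₁ • axis₁) (hc₂ : c₂ = 1 / 4 * z₁.fst 1) (hz₂ : z₂ = z₁ - c₂ • axis₂)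
    (hc₃ : c₃ = 1 / 8 * z₂.snd 1) (hz₃ : z₃ = z₂ - c₃ • axis₃) :
    precond z = toYL (z₃.fst - (1 / 22 : ℝ) • c₁ • (1 : X) - X.Z * ((1 / 11 : ℝ) • c₂ • (1 : X)),
      (1 / 2 : ℝ) • (z₃.snd + X.Z * (c₃ • (1 : X)))) := by
  -- After elimination `z₃` vanishes at the three pivots, so `x` is z with each axis replaced by the
  -- unit vector at its pivot, that is `doubleSnd (frame.symm z)`.
  set x : Y := z₃ + c₁ • basisVec (.inl 0) + c₂ • basisVec (.inl 1) + c₃ • basisVec (.inr 1)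
    with hx
  have e₁ : coord (.inl 0) z₃ = 0 := by
    rw [hz₃, hz₂, hz₁]
    simp only [map_sub, map_smul, coord_inl, axis₁_zero, axis₂_zero, axis₃_zero, smul_eq_mul, hc₁]
    ring
  have e₂ : coord (.inl 1) z₃ = 0 := by
    rw [hz₃, hz₂]
    simp only [map_sub, map_smul, coord_inl, axis₂_one, axis₃_one, smul_eq_mul, hc₂]
    ring
  have e₃ : coord (.inr 1) z₃ = 0 := by
    rw [hz₃]
    simp only [map_sub, map_smul, coord_inr, axis₃_snd_one, smul_eq_mul, hc₃]
    ring
  have f₁ : coord (.inl 0) x = c₁ := by simp [hx, e₁, coord_basisVec, -coord_inl, -coord_inr]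
  have f₂ : coord (.inl 1) x = c₂ := by simp [hx, e₂, coord_basisVec, -coord_inl, -coord_inr]
  have f₃ : coord (.inr 1) x = c₃ := by simp [hx, e₃, coord_basisVec, -coord_inl, -coord_inr]
  have hf : frame (doubleSnd.symm x) = z := by
    rw [frame_apply, ContinuousLinearEquiv.apply_symm_apply, doubleSnd_symm_apply]
    have g₁ : (toYL (x.fst, (1 / 2 : ℝ) • x.snd)).fst 0 = c₁ := f₁
    have g₂ : (toYL (x.fst, (1 / 2 : ℝ) • x.snd)).fst 1 = c₂ := f₂
    have g₃ : (toYL (x.fst, (1 / 2 : ℝ) • x.snd)).snd 1 = 1 / 2 * c₃ := by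
      rw [← f₃]
      rfl
    rw [g₁, g₂, g₃, hx, hz₃, hz₂, hz₁]
    module
  rw [← hf, precond_frame, damping_apply, doubleSnd_symm_apply]
  have g₁ : (toYL (x.fst, (1 / 2 : ℝ) • x.snd)).fst 0 = c₁ := f₁
  have g₂ : (toYL (x.fst, (1 / 2 : ℝ) • x.snd)).fst 1 = c₂ := f₂
  rw [g₁, g₂]
  refine Y_ext ?_ ?_
  · simp only [hx, Y_sub_fst, Y_smul_fst, Y_add_fst, toYL_fst, basisVec, pow_zero, pow_one,
      smul_zero, add_zero, mul_smul_comm, mul_one]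
    module
  · simp only [hx, Y_sub_snd, Y_smul_snd, Y_add_snd, toYL_snd, basisVec, pow_zero, pow_one,
      smul_zero, add_zero, sub_zero, mul_smul_comm, mul_one]

namespace Ball

theorem exists_solve {α : Type} (n : ℕ) {F G : Ball} {z : Y} (hF : F.Has z.fst)
    (hG : G.Has z.snd) (k : Ball → Ball → α) :
    ∃ f g : Ball, f.Has (precond z).fst ∧ g.Has (precond z).snd ∧ solve n F G k = k f g := by
  obtain ⟨c₁, hc₁⟩ : ∃ c : ℝ, c = 1 / 4 * z.fst 0 := ⟨_, rfl⟩
  obtain ⟨z₁, hz₁⟩ : ∃ x : Y, x = z - c₁ • axis₁ := ⟨_, rfl⟩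
  obtain ⟨c₂, hc₂⟩ : ∃ c : ℝ, c = 1 / 4 * z₁.fst 1 := ⟨_, rfl⟩
  obtain ⟨z₂, hz₂⟩ : ∃ x : Y, x = z₁ - c₂ • axis₂ := ⟨_, rfl⟩
  obtain ⟨c₃, hc₃⟩ : ∃ c : ℝ, c = 1 / 8 * z₂.snd 1 := ⟨_, rfl⟩
  obtain ⟨z₃, hz₃⟩ : ∃ x : Y, x = z₂ - c₃ • axis₃ := ⟨_, rfl⟩
  have hm : ∀ (c : ℝ) (a : X), (c • (1 : X)) * a = c • a := fun c a => by
    rw [smul_mul_assoc, one_mul]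
  have C₁ := (hF.const.smul 1 (d := 4) (by norm_num)).of_eq (x' := c₁ • (1 : X)) (by
    rw [X.constPart_apply, smul_smul, hc₁]
    norm_num)
  have F₁ := (hF.sub (C₁.mul (has_polyY_fst axis₁Fst axis₁Snd) n)).of_eq (x' := z₁.fst) (by
    rw [hm, hz₁]
    rfl)
  have G₁ := (hG.sub (C₁.mul (has_polyY_snd axis₁Fst axis₁Snd) n)).of_eq (x' := z₁.snd) (by
    rw [hm, hz₁]
    rfl)
  have C₂ := (F₁.shift.const.smul 1 (d := 4) (by norm_num)).of_eq (x' := c₂ • (1 : X)) (by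
    rw [X.constPart_apply, X.shift_apply, smul_smul, hc₂]
    norm_num)
  have F₂ := (F₁.sub (C₂.mul (has_polyY_fst axis₂Fst axis₂Snd) n)).of_eq (x' := z₂.fst) (by
    rw [hm, hz₂]
    rfl)
  have G₂ := (G₁.sub (C₂.mul (has_polyY_snd axis₂Fst axis₂Snd) n)).of_eq (x' := z₂.snd) (by
    rw [hm, hz₂]
    rfl)
  have C₃ := (G₂.shift.const.smul 1 (d := 8) (by norm_num)).of_eq (x' := c₃ • (1 : X)) (by
    rw [X.constPart_apply, X.shift_apply, smul_smul, hc₃]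
    norm_num)
  have F₃ := (F₂.sub (C₃.mul (has_polyY_fst axis₃Fst axis₃Snd) n)).of_eq (x' := z₃.fst) (by
    rw [hm, hz₃]
    rfl)
  have G₃ := (G₂.sub (C₃.mul (has_polyY_snd axis₃Fst axis₃Snd) n)).of_eq (x' := z₃.snd) (by
    rw [hm, hz₃]
    rfl)
  have h := precond_apply hc₁ hz₁ hc₂ hz₂ hc₃ hz₃
  have R₁ := ((F₃.sub (C₁.smul 1 (d := 22) (by norm_num))).sub
    (C₂.smul 1 (d := 11) (by norm_num)).mulZ).of_eq (x' := (precond z).fst) (by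
      rw [h, toYL_fst, Nat.cast_one, Nat.cast_ofNat, Nat.cast_ofNat])
  have R₂ := ((G₃.add C₃.mulZ).smul 1 (d := 2) (by norm_num)).of_eq (x' := (precond z).snd) (by
    rw [h, toYL_snd, Nat.cast_one, Nat.cast_ofNat])
  exact ⟨_, _, R₁, R₂, by simp only [solve, seq_eq]⟩

end Ball

end

end LorenzRenorm

namespace LorenzRenorm

open Set Filter Topology

open scoped X

noncomputable section

/-! ### The fixed point -/

namespace Ball

/-- One evaluation covers the whole neighbourhood, because the computation starts from balls with
the radii `radFst` and `radSnd`. -/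
theorem columnsOK_eq : columnsOK = true := by decide +kernel

/-- Here the input is the exact polynomial pair, so only rounding and truncation errors enter. -/
theorem residualOK_eq : residualOK = true := by decide +kernel

@[simp] theorem Trace.seq_eq {α : Type} (t : Trace) (k : Trace → α) : t.seq k = k t := rfl

@[simp] theorem Jet.seq_eq {α : Type} (j : Jet) (k : Jet → α) : j.seq k = k j := rfl

@[simp] theorem Dir.seq_eq {α : Type} (d : Dir) (k : Dir → α) : d.seq k = k d := rfl

/-- The enclosures of the operator in the ball. -/
def nearTrace : Trace := trace 14 nearFst nearSnd

theorem nearTrace_ok : nearTrace.ok 14 = true := by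
  have h := columnsOK_eq
  rw [columnsOK, Trace.seq_eq, Jet.seq_eq, Bool.and_eq_true] at h
  exact h.1

theorem columnOK_of_mem {d : Dir × Ball} (hd : d ∈ directions 14 nearTrace) :
    columnOK 14 nearTrace (jet 14 nearFst nearSnd nearTrace) d.1 d.2 = true := by
  have h := columnsOK_eq
  rw [columnsOK, Trace.seq_eq, Jet.seq_eq, Bool.and_eq_true] at h
  exact List.all_eq_true.1 h.2 d hd

theorem toX_monomial (m k : ℕ) : toX (monomial m k) = (unit * m : ℝ) • X.Z ^ k := by
  induction k with
  | zero => simp [monomial, toX, unit]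
  | succ k ih => rw [monomial, toX, ih, Int.cast_zero, zero_smul, zero_add, pow_succ',
      mul_smul_comm]

theorem has_monomial (m k : ℕ) : (ofPoly (monomial m k)).Has ((m : ℝ) • X.Z ^ k) := by
  refine (has_ofPoly _).of_eq ?_
  rw [toX_monomial, smul_smul, inv_mul_cancel_left₀ unit_pos.ne']

theorem has_ofPoly_polyAdd {p q : List ℤ} {x y : X} (hx : (ofPoly p).Has x)
    (hy : (ofPoly q).Has y) : (ofPoly (polyAdd p q)).Has (x + y) := by
  have h : add (ofPoly p) (ofPoly q) = ofPoly (polyAdd p q) := rfl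
  exact h ▸ hx.add hy

theorem norm_le_of_columnOK {n : ℕ} {t : Trace} {j : Jet} {d : Dir} {c : Ball} {y η : Y} {e : X}
    (h : columnOK n t j d c = true) (ht : t.Holds y) (hj : j.Holds y) (hd : d.Holds y η)
    (hc : c.Has e) : ‖precond (dT y η) + toYL (e, 0)‖ ≤ 3 / 4 := by
  rw [columnOK, Dir.seq_eq] at h
  obtain ⟨F, G, hF, hG, e₁⟩ := exists_column n ht hj hd fun F G => solve n F G fun f g =>
    decide (4 * (bound (add f c) + bound g) ≤ 844424930131968)
  rw [e₁] at h
  obtain ⟨f, g, hf, hg, e₂⟩ := exists_solve n (z := dT y η) hF hG fun f g =>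
    decide (4 * (bound (add f c) + bound g) ≤ 844424930131968)
  rw [e₂] at h
  have h₁ := of_decide_eq_true h
  have h₂ := (hf.add hc).unit_mul_norm_le
  have h₃ := hg.unit_mul_norm_le
  -- The literal in the check is 3 · 2⁴⁸.
  have h₄ : (4 : ℝ) * (bound (add f c) + bound g) ≤ 3 * unit := by
    rw [unit]
    exact_mod_cast h₁
  rw [norm_Y, Y_add_fst, Y_add_snd, toYL_fst, toYL_snd, add_zero]
  have := unit_pos
  refine le_of_mul_le_mul_left ?_ this
  linarith

end Ball

/-- The neighbourhood of the approximate fixed point in which all estimates hold. -/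
def Near (y : Y) : Prop := Ball.nearFst.Has y.fst ∧ Ball.nearSnd.Has y.snd

theorem Near.holds {y : Y} (h : Near y) : Ball.nearTrace.Holds y :=
  Ball.trace_holds h.1 h.2 Ball.nearTrace_ok

theorem Near.admissible {y : Y} (h : Near y) : Admissible y := h.holds.admissible

/-- The radius of the ball in the adapted coordinates. -/
def radius : ℝ := Ball.rad / Ball.unit

theorem radius_pos : 0 < radius := by
  norm_num [radius, Ball.rad, Ball.unit]

theorem norm_polyY_fst_le (p q : List ℤ) {m d : ℕ} (hd : 0 < d)
    (h : (Ball.ofPoly p).bound * d ≤ m * Ball.unit) : ‖(polyY p q).fst‖ ≤ m / d :=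
  (has_polyY_fst p q).norm_le hd h

theorem norm_polyY_snd_le (p q : List ℤ) {m d : ℕ} (hd : 0 < d)
    (h : (Ball.ofPoly q).bound * d ≤ m * Ball.unit) : ‖(polyY p q).snd‖ ≤ m / d :=
  (has_polyY_snd p q).norm_le hd h

/-- The constant 11 here and 36.9 in the next estimate bound the columns of `frame`. Multiplied by
`rad` they stay below `radFst` and `radSnd`, which puts the image of the coordinate ball inside the
numerical neighbourhood. -/
theorem norm_frame_fst_le (x : Y) : ‖(frame x).fst‖ ≤ 11 * ‖x‖ := by
  refine norm_apply_le_of_columns (fstL.comp (frame : Y →L[ℝ] Y)) (fun i => ?_) x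
  change ‖(frame (basisVec i)).fst‖ ≤ 11
  match i with
  | .inl 0 =>
    rw [frame_inl_zero]
    exact (norm_polyY_fst_le _ _ (m := 11) (d := 1) one_pos (by decide)).trans (by norm_num)
  | .inl 1 =>
    rw [frame_inl_one]
    exact (norm_polyY_fst_le _ _ (m := 11) (d := 1) one_pos (by decide)).trans (by norm_num)
  | .inl (k + 2) =>
    rw [frame_inl (by omega), toYL_fst, X.norm_Z_pow]
    norm_num
  | .inr k =>
    by_cases hk : k = 1
    · rw [hk, frame_inr_one, Y_smul_fst, norm_smul]
      have := norm_polyY_fst_le Ball.axis₃Fst Ball.axis₃Snd (m := 5) (d := 1) one_pos (by decide)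
      rw [axis₃]
      norm_num at this ⊢
      linarith
    · rw [frame_inr hk, toYL_fst]
      norm_num

theorem norm_frame_snd_le (x : Y) : ‖(frame x).snd‖ ≤ 369 / 10 * ‖x‖ := by
  refine norm_apply_le_of_columns (sndL.comp (frame : Y →L[ℝ] Y)) (fun i => ?_) x
  change ‖(frame (basisVec i)).snd‖ ≤ 369 / 10
  match i with
  | .inl 0 =>
    rw [frame_inl_zero]
    exact (norm_polyY_snd_le _ _ (m := 36) (d := 1) one_pos (by decide)).trans (by norm_num)
  | .inl 1 =>
    rw [frame_inl_one]
    exact (norm_polyY_snd_le _ _ (m := 36) (d := 1) one_pos (by decide)).trans (by norm_num)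
  | .inl (k + 2) =>
    rw [frame_inl (by omega), toYL_snd]
    norm_num
  | .inr k =>
    by_cases hk : k = 1
    · rw [hk, frame_inr_one, Y_smul_snd, norm_smul]
      have := norm_polyY_snd_le Ball.axis₃Fst Ball.axis₃Snd (m := 369) (d := 20) (by norm_num)
        (by decide)
      rw [axis₃]
      norm_num at this ⊢
      linarith
    · rw [frame_inr hk, toYL_snd, norm_smul, X.norm_Z_pow]
      norm_num

theorem has_polyY_add {p : List ℤ} {e : ℕ} {v : X} (h : Ball.unit * ‖v‖ ≤ e) :
    Ball.Has ⟨p, e⟩ ((Ball.unit : ℝ)⁻¹ • toX p + v) := by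
  rw [Ball.Has, smul_add, smul_smul, mul_inv_cancel₀ Ball.unit_pos.ne', one_smul,
    add_sub_cancel_left, norm_smul, Real.norm_of_nonneg Ball.unit_pos.le]
  exact h

theorem near_of_norm_le {x : Y} (hx : ‖x‖ ≤ radius) : Near (basePoint + frame x) := by
  have hu := Ball.unit_pos
  have h₀ : Ball.unit * ‖x‖ ≤ Ball.rad := by
    rw [radius, le_div_iff₀ hu] at hx
    linarith
  constructor
  · refine has_polyY_add ?_
    have := norm_frame_fst_le x
    have h₂ := mul_le_mul_of_nonneg_left this hu.le
    norm_num [Ball.radFst, Ball.rad] at h₀ ⊢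
    linarith
  · refine has_polyY_add ?_
    have := norm_frame_snd_le x
    have h₂ := mul_le_mul_of_nonneg_left this hu.le
    norm_num [Ball.radSnd, Ball.rad] at h₀ ⊢
    linarith

theorem sub_damping_inl_zero :
    basisVec (.inl 0) - damping (basisVec (.inl 0)) = toYL ((23 / 22 : ℝ) • 1, 0) := by
  rw [damping_apply, ← coord_inl, ← coord_inl, coord_basisVec, coord_basisVec]
  simp
  refine Y_ext ?_ ?_ <;> simp [basisVec]

theorem sub_damping_inl_one :
    basisVec (.inl 1) - damping (basisVec (.inl 1)) = toYL (X.Z * ((12 / 11 : ℝ) • 1), 0) := by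
  rw [damping_apply, ← coord_inl, ← coord_inl, coord_basisVec, coord_basisVec]
  simp
  refine Y_ext ?_ ?_ <;> simp [basisVec]

theorem sub_damping {i : ℕ ⊕ ℕ} (h₀ : i ≠ .inl 0) (h₁ : i ≠ .inl 1) :
    basisVec i - damping (basisVec i) = toYL (0, 0) := by
  rw [damping_apply, ← coord_inl, ← coord_inl, coord_basisVec, coord_basisVec, if_neg h₀.symm,
    if_neg h₁.symm]
  simp
  rfl

/-- Degrees 0 to 11 are checked one by one in each component, all higher degrees by the two tail
directions. The unit vector minus its damped image is non-zero only at the two expanding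
coordinates, where it is 1 + 1/22 = 23/22 and 1 + 1/11 = 12/11. -/
theorem norm_column_le {n : ℕ} {t : Ball.Trace} {j : Ball.Jet} {y : Y}
    (ht : t.Holds y) (hj : j.Holds y)
    (hcol : ∀ d ∈ Ball.directions n t, Ball.columnOK n t j d.1 d.2 = true) (i : ℕ ⊕ ℕ) :
    ‖basisVec i + precond (dT y (frame (basisVec i))) - damping (basisVec i)‖ ≤ 3 / 4 := by
  have key : ∀ (d : Ball.Dir) (c : Ball) {e : X}, (d, c) ∈ Ball.directions n t →
      d.Holds y (frame (basisVec i)) → c.Has e →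
      basisVec i - damping (basisVec i) = toYL (e, 0) → ‖basisVec i + precond (dT y (frame (basisVec i))) - damping (basisVec i)‖ ≤ 3 / 4 := by
    intro d c e hd h₁ h₂ h₃
    rw [add_sub_right_comm, h₃, add_comm]
    exact Ball.norm_le_of_columnOK (hcol _ hd) ht hj h₁ h₂
  have one_has : (Ball.ofPoly [281474976710656]).Has (1 : X) := by
    simp [Ball.Has, Ball.ofPoly, toX, Ball.unit]
  have nil_has : (Ball.ofPoly []).Has (0 : X) := Ball.has_zero
  have mono_has : ∀ k, (Ball.ofPoly (Ball.monomial 1 k)).Has (X.Z ^ k) := fun k =>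
    (Ball.has_monomial 1 k).of_eq (by rw [Nat.cast_one, one_smul])
  have mono_has₂ : ∀ k, (Ball.ofPoly (Ball.monomial 2 k)).Has ((2 : ℝ) • X.Z ^ k) := fun k =>
    (Ball.has_monomial 2 k).of_eq (by rw [Nat.cast_ofNat])
  match i with
  | .inl 0 =>
    refine key (Ball.polyDir n t Ball.axis₁Fst Ball.axis₁Snd)
      (Ball.smul 23 22 (Ball.ofPoly [281474976710656])) (by simp [Ball.directions]) ?_
      (one_has.smul 23 (by norm_num)) (by rw [sub_damping_inl_zero]; norm_num)
    rw [frame_inl_zero]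
    exact Ball.polyDir_holds _ _ _ ht (has_polyY_fst Ball.axis₁Fst Ball.axis₁Snd)
      (has_polyY_snd Ball.axis₁Fst Ball.axis₁Snd)
  | .inl 1 =>
    refine key (Ball.polyDir n t Ball.axis₂Fst Ball.axis₂Snd)
      (Ball.mulZ (Ball.smul 12 11 (Ball.ofPoly [281474976710656]))) (by simp [Ball.directions]) ?_
      (one_has.smul 12 (by norm_num)).mulZ (by rw [sub_damping_inl_one]; norm_num)
    rw [frame_inl_one]
    exact Ball.polyDir_holds _ _ _ ht (has_polyY_fst Ball.axis₂Fst Ball.axis₂Snd)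
      (has_polyY_snd Ball.axis₂Fst Ball.axis₂Snd)
  | .inl (k + 2) =>
    have hd := sub_damping (i := .inl (k + 2)) (by simp) (by simp)
    by_cases hk : k < 10
    · refine key (Ball.polyDir n t (Ball.monomial 1 (k + 2)) []) Ball.zero
        ?_ ?_ Ball.has_zero hd
      · simp only [Ball.directions, List.mem_cons, List.mem_append, List.mem_map, List.mem_range]
        exact .inr (.inr (.inr (.inr (.inr (.inr (.inl ⟨k, hk, rfl⟩))))))
      · rw [frame_inl (by omega)]
        exact Ball.polyDir_holds _ _ _ ht (mono_has (k + 2)) nil_has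
    · refine key (Ball.tailDirFst t 12) Ball.zero (by simp [Ball.directions])
        ?_ Ball.has_zero hd
      rw [frame_inl (by omega)]
      exact Ball.tailDirFst_holds (m := k + 2) (by norm_num) (by omega) ht rfl rfl
  | .inr 0 =>
    have hd := sub_damping (i := .inr 0) (by simp) (by simp)
    refine key (Ball.polyDir n t [] (Ball.monomial 2 0)) Ball.zero
      (by simp [Ball.directions]) ?_ Ball.has_zero hd
    rw [frame_inr (by omega)]
    exact Ball.polyDir_holds _ _ _ ht nil_has (mono_has₂ 0)
  | .inr 1 =>
    have hd := sub_damping (i := .inr 1) (by simp) (by simp)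
    refine key (Ball.polyDir n t (polyAdd Ball.axis₃Fst Ball.axis₃Fst)
      (polyAdd Ball.axis₃Snd Ball.axis₃Snd)) Ball.zero
      (by simp [Ball.directions]) ?_ Ball.has_zero hd
    rw [frame_inr_one, two_smul]
    have h₁ := has_polyY_fst Ball.axis₃Fst Ball.axis₃Snd
    have h₂ := has_polyY_snd Ball.axis₃Fst Ball.axis₃Snd
    exact Ball.polyDir_holds _ _ _ ht (Ball.has_ofPoly_polyAdd h₁ h₁)
      (Ball.has_ofPoly_polyAdd h₂ h₂)
  | .inr (k + 2) =>
    have hd := sub_damping (i := .inr (k + 2)) (by simp) (by simp)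
    by_cases hk : k < 10
    · refine key (Ball.polyDir n t [] (Ball.monomial 2 (k + 2))) Ball.zero
        ?_ ?_ Ball.has_zero hd
      · simp only [Ball.directions, List.mem_cons, List.mem_append, List.mem_map, List.mem_range]
        exact .inr (.inr (.inr (.inr (.inr (.inr (.inr ⟨k, hk, rfl⟩))))))
      · rw [frame_inr (by omega)]
        exact Ball.polyDir_holds _ _ _ ht nil_has (mono_has₂ (k + 2))
    · refine key (Ball.tailDirSnd t 12) Ball.zero (by simp [Ball.directions])
        ?_ Ball.has_zero hd
      rw [frame_inr (by omega)]
      exact Ball.tailDirSnd_holds (m := k + 2) (by omega) ht rfl rfl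

/-- The derivative of the Newton-like map for an operator with derivative `A`. -/
def newtonDeriv (P A M D : Y →L[ℝ] Y) : Y →L[ℝ] Y := .id ℝ Y + P.comp (A.comp M) - D

theorem newtonDeriv_apply (P A M D : Y →L[ℝ] Y) (x : Y) :
    newtonDeriv P A M D x = x + P (A (M x)) - D x := rfl

/-! ### Newton-like iteration and exclusion of spectrum from column bounds -/

section

variable {T : Y → Y} {T' : Y → Y →L[ℝ] Y} {N : Y → Prop} {M P D : Y ≃L[ℝ] Y} {y₀ : Y} {δ κ : ℝ}

/-- A Newton-like iteration: a fixed point of `T` in `y₀ + M x`, `‖x‖ ≤ δ`, from estimates for the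
columns of the derivative in the coordinates `x`, with the preconditioner `P`. -/
theorem exists_fixed_of_columns (hPM : ∀ x, P (M x) = D x)
    (hN : ∀ x, ‖x‖ ≤ δ → N (y₀ + M x)) (hT : ∀ y, N y → HasFDerivAt T (T' y) y)
    (hcol : ∀ y, N y → ∀ i, ‖basisVec i + P (T' y (M (basisVec i))) - D (basisVec i)‖ ≤ κ)
    (hκ₀ : 0 ≤ κ) (hδ : 0 < δ) (hres : ‖P (T y₀ - y₀)‖ < (1 - κ) * δ) :
    ∃ y : Y, T y = y ∧ ∀ᶠ z in 𝓝 y, N z := by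
  -- Forced by the residual bound: a non-negative number lies below (1 - κ)δ with δ > 0.
  have hκ : κ < 1 := by
    by_contra hκ
    have := (norm_nonneg _).trans_lt hres
    nlinarith
  obtain ⟨φ, hφ⟩ : ∃ φ : Y → Y, ∀ x, φ x = x + P (T (y₀ + M x) - (y₀ + M x)) :=
    ⟨_, fun _ => rfl⟩
  set S := Metric.closedBall (0 : Y) δ with hS
  have hmem : ∀ x : Y, x ∈ S ↔ ‖x‖ ≤ δ := fun x => by rw [hS, mem_closedBall_zero_iff]
  have hd : ∀ x ∈ S, HasFDerivWithinAt φ (newtonDeriv P (T' (y₀ + M x)) M D) S x := by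
    intro x hx
    have h₁ : HasFDerivAt (fun x => y₀ + M x) (M : Y →L[ℝ] Y) x := M.hasFDerivAt.const_add _
    have h₂ := (hT _ (hN x ((hmem x).1 hx))).comp x h₁
    have h₃ := (hasFDerivAt_id x).add (P.hasFDerivAt.comp x (h₂.sub h₁))
    have h₄ : φ = fun x => id x + P (T (y₀ + M x) - (y₀ + M x)) := funext hφ
    rw [h₄]
    refine (h₃.congr_fderiv (ContinuousLinearMap.ext fun v => ?_)).hasFDerivWithinAt
    -- The relation P M = D turns the linear part of the Newton step into the diagonal operator of
    -- the column estimates.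
    change v + P (T' (y₀ + M x) (M v) - M v) = v + P (T' (y₀ + M x) (M v)) - D v
    rw [map_sub, hPM]
    abel
  lift κ to NNReal using hκ₀
  have hL : LipschitzOnWith κ φ S := by
    refine (convex_closedBall (0 : Y) δ).lipschitzOnWith_of_nnnorm_hasFDerivWithin_le hd
      fun x hx => ?_
    rw [← NNReal.coe_le_coe, coe_nnnorm]
    exact ContinuousLinearMap.opNorm_le_bound _ κ.2 fun v =>
      norm_apply_le_of_columns _ (fun i => hcol _ (hN x ((hmem x).1 hx)) i) v
  have h0 : (0 : Y) ∈ S := (hmem 0).2 (by simpa using hδ.le)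
  have hφ0 : φ 0 = P (T y₀ - y₀) := by simp [hφ]
  have hle : ∀ x ∈ S, ‖φ x‖ ≤ κ * ‖x‖ + ‖P (T y₀ - y₀)‖ := by
    intro x hx
    have h₁ := hL.dist_le_mul x hx 0 h0
    rw [dist_eq_norm, dist_zero_right] at h₁
    have h₂ := norm_add_le (φ x - φ 0) (φ 0)
    rw [sub_add_cancel] at h₂
    rw [← hφ0]
    linarith
  have hmaps : MapsTo φ S S := fun x hx => by
    have h₁ := hle x hx
    have h₂ := mul_le_mul_of_nonneg_left ((hmem x).1 hx) κ.coe_nonneg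
    exact (hmem _).2 (by linarith)
  have hc : ContractingWith κ (hmaps.restrict φ S S) :=
    ⟨by exact_mod_cast hκ, hL.mapsToRestrict hmaps⟩
  obtain ⟨x, hx, hfix, -⟩ := hc.exists_fixedPoint' Metric.isClosed_closedBall.isComplete hmaps h0
    (edist_ne_top _ _)
  -- Strictness of the residual bound keeps the fixed point off the boundary sphere, so a full
  -- neighbourhood of it remains in the region of validity.
  have hx' : ‖x‖ < δ := by
    have h₁ := hle x hx
    rw [hfix] at h₁
    by_contra h₂
    have h₃ := le_antisymm ((hmem x).1 hx) (not_lt.1 h₂)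
    rw [h₃] at h₁
    linarith
  refine ⟨y₀ + M x, ?_, ?_⟩
  · have h : x + P (T (y₀ + M x) - (y₀ + M x)) = x := (hφ x).symm.trans hfix
    rw [add_eq_left, map_eq_zero_iff _ P.injective] at h
    exact sub_eq_zero.1 h
  · have hc : ContinuousAt (fun z : Y => ‖M.symm (z - y₀)‖) (y₀ + M x) := by fun_prop
    have h₁ : ‖M.symm (y₀ + M x - y₀)‖ < δ := by
      rwa [add_sub_cancel_left, ContinuousLinearEquiv.symm_apply_apply]
    filter_upwards [hc.eventually_lt_const h₁] with z hz
    have := hN _ hz.le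
    rwa [ContinuousLinearEquiv.apply_symm_apply, add_sub_cancel] at this

/-- The estimates for the columns exclude spectrum on the unit circle. -/
theorem disjoint_complexSpectrum_of_columns {A : Y →L[ℝ] Y} (hA : IsCompactOperator A)
    (hPM : ∀ x, P (M x) = D x) (hκ : κ < 1)
    (hcol : ∀ i, ‖basisVec i + P (A (M (basisVec i))) - D (basisVec i)‖ ≤ κ)
    {θ : ℕ ⊕ ℕ → ℝ} (hD : ∀ i x, coord i (D x) = θ i * coord i x)
    (hθ : ∀ i, θ i ≤ 0 ∨ θ i = 1) :
    Disjoint (complexSpectrum A) (Metric.sphere (0 : ℂ) 1) := by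
  rw [Set.disjoint_left]
  intro μ h₁ h₂
  have hμ : ‖μ‖ = 1 := by simpa using h₂
  refine h₁ (isUnit_complexShift hA hμ fun u v hu hv => ?_)
  have hcol' : ∀ i, ‖newtonDeriv P A M D (basisVec i)‖ ≤ κ := hcol
  have hp : ∀ z : Y, P z = D (M.symm z) := fun z => by
    rw [← hPM, ContinuousLinearEquiv.apply_symm_apply]
  have he : ∀ z : Y, newtonDeriv P A M D (M.symm z) =
      M.symm z + D (M.symm (A z)) - D (M.symm z) := fun z => by
    rw [newtonDeriv_apply]
    simp only [ContinuousLinearEquiv.coe_coe]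
    rw [ContinuousLinearEquiv.apply_symm_apply, hp]
  -- For an eigenvector u + iv with eigenvalue μ, the operator 1 + D(M⁻¹AM - 1) acts on the i-th
  -- coordinate of M⁻¹(u + iv) as multiplication by 1 + θᵢ(μ - 1).
  have h := eq_zero_of_complexCoord_eq (newtonDeriv P A M D) hκ hcol'
    (fun i => 1 + (θ i : ℂ) * (μ - 1)) (fun i => ?_)
    (x := M.symm u) (y := M.symm v) fun i => ?_
  · exact ⟨(map_eq_zero_iff _ M.symm.injective).1 h.1, (map_eq_zero_iff _ M.symm.injective).1 h.2⟩
  -- If θᵢ ≤ 0, the real part of the factor is 1 + θᵢ(Re μ - 1) ≥ 1. If θᵢ = 1, the factor is μ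
  -- itself.
  · rcases hθ i with hi | hi
    · have hre : μ.re ≤ 1 := hμ ▸ Complex.re_le_norm μ
      refine le_trans ?_ (Complex.re_le_norm _)
      simp
      nlinarith
    · simp [hi, hμ]
  · rw [complexCoord, complexCoord, he, he, hu, hv]
    simp only [map_add, map_sub, map_smul, hD, smul_eq_mul]
    rw [Complex.ext_iff]
    constructor
    · simp
      ring
    · simp
      ring

end

theorem norm_precond_residual_le : ‖precond (opT basePoint - basePoint)‖ ≤ radius / 5 := by
  have h := Ball.residualOK_eq
  rw [Ball.residualOK, Ball.Trace.seq_eq, Bool.and_eq_true] at h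
  have ht := Ball.trace_holds (has_polyY_fst Ball.baseFst Ball.baseSnd)
    (has_polyY_snd Ball.baseFst Ball.baseSnd) h.1
  obtain ⟨hF, hG⟩ := ht.result 16
  obtain ⟨f, g, hf, hg, e⟩ := Ball.exists_solve 16 (z := opT basePoint - basePoint)
    (hF.sub (has_polyY_fst Ball.baseFst Ball.baseSnd))
    (hG.sub (has_polyY_snd Ball.baseFst Ball.baseSnd))
    fun f g => decide (5 * (Ball.bound f + Ball.bound g) ≤ Ball.rad)
  have h₁ := h.2
  rw [e] at h₁
  have h₂ : (5 : ℝ) * (Ball.bound f + Ball.bound g) ≤ Ball.rad := by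
    exact_mod_cast of_decide_eq_true h₁
  have h₃ := hf.unit_mul_norm_le
  have h₄ := hg.unit_mul_norm_le
  rw [norm_Y, radius, div_div, le_div_iff₀ (mul_pos Ball.unit_pos (by norm_num))]
  linarith

theorem Near.column_le {y : Y} (hy : Near y) (i : ℕ ⊕ ℕ) :
    ‖basisVec i + precond (dT y (frame (basisVec i))) - damping (basisVec i)‖ ≤ 3 / 4 :=
  norm_column_le hy.holds (Ball.jet_holds hy.1 hy.2 hy.holds)
    (fun _ => Ball.columnOK_of_mem) i

theorem exists_fixed : ∃ y : Y, opT y = y ∧ ∀ᶠ z in 𝓝 y, Near z := by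
  refine exists_fixed_of_columns precond_frame (fun x => near_of_norm_le)
    (fun y hy => hasFDerivAt_opT hy.admissible) (fun y hy => hy.column_le) (by norm_num) radius_pos
    (norm_precond_residual_le.trans_lt ?_)
  have := radius_pos
  linarith

theorem Near.disjoint_complexSpectrum {y : Y} (hy : Near y) :
    Disjoint (complexSpectrum (dT y)) (Metric.sphere (0 : ℂ) 1) := by
  refine disjoint_complexSpectrum_of_columns (isCompactOperator_dT hy.admissible) precond_frame
    (by norm_num) hy.column_le coord_damping fun i => ?_
  match i with
  | .inl 0 => exact .inl (by norm_num [dampingCoeff])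
  | .inl 1 => exact .inl (by norm_num [dampingCoeff])
  | .inl (k + 2) => exact .inr rfl
  | .inr k => exact .inr rfl

end

end LorenzRenorm

namespace LorenzRenorm

open Set Filter Topology

open scoped X

noncomputable section

/-! ### Lorenz maps -/

namespace IsLorenzMap

variable {ρ l r : ℝ} {f : ℝ → ℝ}

theorem mem_Icc (hf : IsLorenzMap ρ l r f) {x : ℝ} (hx : x ∈ Icc l r) (h0 : x ≠ 0) :
    f x ∈ Icc l r := hf.mapsTo ⟨hx, h0⟩

theorem lt_right (hf : IsLorenzMap ρ l r f) {x : ℝ} (hx : x ∈ Ico l 0) : f x < r := by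
  obtain ⟨x', h₁, h₂⟩ := exists_between hx.2
  have h₃ : x' ∈ Ico l 0 := ⟨hx.1.trans h₁.le, h₂⟩
  exact (hf.strictMonoOn_left hx h₃ h₁).trans_le
    (hf.mem_Icc ⟨h₃.1, h₂.le.trans hf.right_pos.le⟩ h₂.ne).2

theorem left_lt (hf : IsLorenzMap ρ l r f) {x : ℝ} (hx : x ∈ Ioc 0 r) : l < f x := by
  obtain ⟨x', h₁, h₂⟩ := exists_between hx.1
  have h₃ : x' ∈ Ioc 0 r := ⟨h₁, h₂.le.trans hx.2⟩
  exact (hf.mem_Icc ⟨hf.left_neg.le.trans h₁.le, h₃.2⟩ h₁.ne').1.trans_lt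
    (hf.strictMonoOn_right h₃ hx h₂)

theorem exists_eq_left (hf : IsLorenzMap ρ l r f) {x v : ℝ} (hx : x ∈ Ico l 0) (hv : f x ≤ v)
    (hv' : v < r) : ∃ z ∈ Ico x 0, f z = v := by
  obtain ⟨x', h₁, h₂⟩ := ((hf.tendsto_left.eventually_const_lt hv').and
    (Ioo_mem_nhdsLT hx.2)).exists
  have hc : ContinuousOn f (Icc x x') := hf.continuousOn.mono fun z hz =>
    ⟨⟨hx.1.trans hz.1, (hz.2.trans h₂.2.le).trans hf.right_pos.le⟩, (hz.2.trans_lt h₂.2).ne⟩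
  obtain ⟨z, hz, rfl⟩ := intermediate_value_Icc h₂.1.le hc ⟨hv, h₁.le⟩
  exact ⟨z, ⟨hz.1, hz.2.trans_lt h₂.2⟩, rfl⟩

theorem exists_eq_right (hf : IsLorenzMap ρ l r f) {x v : ℝ} (hx : x ∈ Ioc 0 r) (hv : v ≤ f x)
    (hv' : l < v) : ∃ z ∈ Ioc 0 x, f z = v := by
  obtain ⟨x', h₁, h₂⟩ := ((hf.tendsto_right.eventually_lt_const hv').and
    (Ioo_mem_nhdsGT hx.1)).exists
  have hc : ContinuousOn f (Icc x' x) := hf.continuousOn.mono fun z hz =>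
    ⟨⟨hf.left_neg.le.trans (h₂.1.le.trans hz.1), hz.2.trans hx.2⟩, (h₂.1.trans_le hz.1).ne'⟩
  obtain ⟨z, hz, rfl⟩ := intermediate_value_Icc h₂.2.le hc ⟨h₁.le, hv⟩
  exact ⟨z, ⟨h₂.1.trans_le hz.1, hz.2⟩, rfl⟩

theorem tendsto_comp (hf : IsLorenzMap ρ l r f) {F : Filter ℝ} {h : ℝ → ℝ} {v : ℝ}
    (hv : v ∈ Icc l r) (h0 : v ≠ 0) (hh : Tendsto h F (𝓝 v)) (hm : ∀ᶠ x in F, h x ∈ Icc l r) :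
    Tendsto (fun x => f (h x)) F (𝓝 (f v)) := by
  refine (hf.continuousOn v ⟨hv, h0⟩).tendsto.comp (tendsto_nhdsWithin_iff.2 ⟨hh, ?_⟩)
  filter_upwards [hm, hh.eventually_ne h0] with x h₁ h₂ using ⟨h₁, h₂⟩

theorem eventually_mem_left (hf : IsLorenzMap ρ l r f) :
    ∀ᶠ x in 𝓝[<] (0 : ℝ), f x ∈ Icc l r := by
  filter_upwards [Ioo_mem_nhdsLT hf.left_neg] with x hx
  exact hf.mem_Icc ⟨hx.1.le, hx.2.le.trans hf.right_pos.le⟩ hx.2.ne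

theorem eventually_mem_right (hf : IsLorenzMap ρ l r f) :
    ∀ᶠ x in 𝓝[>] (0 : ℝ), f x ∈ Icc l r := by
  filter_upwards [Ioo_mem_nhdsGT hf.right_pos] with x hx
  exact hf.mem_Icc ⟨hf.left_neg.le.trans hx.1.le, hx.2.le⟩ hx.1.ne'

end IsLorenzMap

theorem returnTime_eq {f : ℝ → ℝ} {U : Set ℝ} {x : ℝ} {n : ℕ} (hn : 0 < n) (h : f^[n] x ∈ U)
    (h' : ∀ j, 0 < j → j < n → f^[j] x ∉ U) : returnTime f U x = n := by
  refine le_antisymm (Nat.sInf_le ⟨hn, h⟩) (le_csInf ⟨n, hn, h⟩ fun m hm => ?_)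
  by_contra hlt
  exact h' m hm.1 (not_le.1 hlt) hm.2

theorem firstReturn_eq {f : ℝ → ℝ} {U : Set ℝ} {x : ℝ} {n : ℕ} (hn : 0 < n) (h : f^[n] x ∈ U)
    (h' : ∀ j, 0 < j → j < n → f^[j] x ∉ U) : firstReturn f U x = f^[n] x := by
  rw [firstReturn, returnTime_eq hn h h']

theorem firstReturn_eq_one {f : ℝ → ℝ} {U : Set ℝ} {x : ℝ} (h : f x ∈ U) :
    firstReturn f U x = f x :=
  firstReturn_eq one_pos h fun j h₁ h₂ => by omega

theorem returnTime_eq_two {f : ℝ → ℝ} {U : Set ℝ} {x : ℝ} (h₁ : f x ∉ U) (h₂ : f (f x) ∈ U) :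
    returnTime f U x = 2 :=
  returnTime_eq two_pos h₂ fun j hj hj' => by
    obtain rfl : j = 1 := by omega
    exact h₁

theorem returnTime_eq_three {f : ℝ → ℝ} {U : Set ℝ} {x : ℝ} (h₁ : f x ∉ U) (h₂ : f (f x) ∉ U)
    (h₃ : f (f (f x)) ∈ U) : returnTime f U x = 3 :=
  returnTime_eq three_pos h₃ fun j hj hj' => by
    obtain rfl | rfl : j = 1 ∨ j = 2 := by omega
    · exact h₁
    · exact h₂

theorem firstReturn_eq_two {f : ℝ → ℝ} {U : Set ℝ} {x : ℝ} (h₁ : f x ∉ U) (h₂ : f (f x) ∈ U) :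
    firstReturn f U x = f (f x) := by
  rw [firstReturn, returnTime_eq_two h₁ h₂]
  rfl

theorem firstReturn_eq_three {f : ℝ → ℝ} {U : Set ℝ} {x : ℝ} (h₁ : f x ∉ U) (h₂ : f (f x) ∉ U)
    (h₃ : f (f (f x)) ∈ U) : firstReturn f U x = f (f (f x)) := by
  rw [firstReturn, returnTime_eq_three h₁ h₂ h₃]
  rfl

/-! ### The largest return interval -/

section

variable {ρ l r : ℝ} {f : ℝ → ℝ} {p q : ℝ}

/-- If p = l then q < r, and since f l < 0 < q the left branch attains the value q at some point of
[l, 0). That point returns at once with value q, whereas a Lorenz map on [p, q] stays strictly below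
q to the left of 0. -/
theorem ReturnIsLorenz.ne_left (hf : IsLorenzMap ρ l r f) (hs : Icc p q ⊂ Icc l r)
    (h : ReturnIsLorenz ρ f p q) (hc : f l < 0) : p ≠ l := by
  rintro rfl
  have hg := h.2
  have hle := (Icc_subset_Icc_iff (hg.left_neg.le.trans hg.right_pos.le)).1 hs.1
  have hlt : q < r := by
    refine lt_of_le_of_ne hle.2 ?_
    rintro rfl
    exact hs.2 subset_rfl
  obtain ⟨z, hz, hz'⟩ := hf.exists_eq_left (x := p) (v := q) ⟨le_rfl, hf.left_neg⟩
    (hc.le.trans hg.right_pos.le) hlt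
  have h₁ := hg.lt_right hz
  rw [firstReturn_eq_one (by rw [hz']; exact ⟨hg.left_neg.le.trans hg.right_pos.le, le_rfl⟩),
    hz'] at h₁
  exact h₁.false

theorem ReturnIsLorenz.ne_right (hf : IsLorenzMap ρ l r f) (hs : Icc p q ⊂ Icc l r)
    (h : ReturnIsLorenz ρ f p q) (hc : 0 < f r) : q ≠ r := by
  rintro rfl
  have hg := h.2
  have hle := (Icc_subset_Icc_iff (hg.left_neg.le.trans hg.right_pos.le)).1 hs.1
  have hlt : l < p := by
    refine lt_of_le_of_ne hle.1 ?_
    rintro rfl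
    exact hs.2 subset_rfl
  obtain ⟨z, hz, hz'⟩ := hf.exists_eq_right (x := q) (v := p) ⟨hf.right_pos, le_rfl⟩
    (hg.left_neg.le.trans hc.le) hlt
  have h₁ := hg.left_lt hz
  rw [firstReturn_eq_one (by rw [hz']; exact ⟨le_rfl, hg.left_neg.le.trans hg.right_pos.le⟩),
    hz'] at h₁
  exact h₁.false

/-- The same mechanism: if f x ≤ q, the intermediate value theorem gives a point of [x, 0) with
immediate return value q. Hence no point to the left of 0 returns at time 1. -/
theorem ReturnIsLorenz.right_lt_apply (hf : IsLorenzMap ρ l r f) (h : ReturnIsLorenz ρ f p q)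
    (hp : l ≤ p) (hq : q < r) {x : ℝ} (hx : x ∈ Ico p 0) : q < f x := by
  by_contra hlt
  have hg := h.2
  obtain ⟨z, hz, hz'⟩ := hf.exists_eq_left (x := x) (v := q) ⟨hp.trans hx.1, hx.2⟩
    (not_lt.1 hlt) hq
  have h₁ := hg.lt_right (x := z) ⟨hx.1.trans hz.1, hz.2⟩
  rw [firstReturn_eq_one (by rw [hz']; exact ⟨hg.left_neg.le.trans hg.right_pos.le, le_rfl⟩),
    hz'] at h₁
  exact h₁.false

theorem ReturnIsLorenz.apply_lt_left (hf : IsLorenzMap ρ l r f) (h : ReturnIsLorenz ρ f p q)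
    (hp : l < p) (hq : q ≤ r) {x : ℝ} (hx : x ∈ Ioc 0 q) : f x < p := by
  by_contra hlt
  have hg := h.2
  obtain ⟨z, hz, hz'⟩ := hf.exists_eq_right (x := x) (v := p) ⟨hx.1, hx.2.trans hq⟩
    (not_lt.1 hlt) hp
  have h₁ := hg.left_lt (x := z) ⟨hz.1, hz.2.trans hx.2⟩
  rw [firstReturn_eq_one (by rw [hz']; exact ⟨le_rfl, hg.left_neg.le.trans hg.right_pos.le⟩),
    hz'] at h₁
  exact h₁.false

/-- If `f l < 0`, `f (f l) < 0 < f r`, then no return interval exceeds `[f (f l), f r]`. -/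
theorem ReturnIsLorenz.subset_Icc (hf : IsLorenzMap ρ l r f) (hs : Icc p q ⊂ Icc l r)
    (h : ReturnIsLorenz ρ f p q) (hc : f l < 0) (hcc : f (f l) < 0) (hr : 0 < f r) :
    Icc p q ⊆ Icc (f (f l)) (f r) := by
  have hg := h.2
  have hle := (Icc_subset_Icc_iff (hg.left_neg.le.trans hg.right_pos.le)).1 hs.1
  have hp : l < p := lt_of_le_of_ne hle.1 (h.ne_left hf hs hc).symm
  have hq : q < r := lt_of_le_of_ne hle.2 (h.ne_right hf hs hr)
  have hleft : ∀ x ∈ Ico p 0, f x ∉ Icc p q := fun x hx hx' =>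
    (h.right_lt_apply hf hle.1 hq hx).not_ge hx'.2
  have hright : ∀ x ∈ Ioc 0 q, f x ∉ Icc p q := fun x hx hx' =>
    (h.apply_lt_left hf hp hle.2 hx).not_ge hx'.1
  refine Icc_subset_Icc ?_ ?_
  · by_contra! hlt
    -- As x decreases to 0, the iterates f, f², f³ tend to l, f l, f (f l), while the return map
    -- tends to p. So p must be the limit of whichever iterate is the first to return near 0 from
    -- the right.
    have hl := hf.mem_Icc ⟨le_rfl, hf.left_neg.le.trans hf.right_pos.le⟩ hf.left_neg.ne
    have h₁ := hf.tendsto_comp ⟨le_rfl, hf.left_neg.le.trans hf.right_pos.le⟩ hf.left_neg.ne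
      hf.tendsto_right hf.eventually_mem_right
    have hm₂ : ∀ᶠ x in 𝓝[>] (0 : ℝ), f l ≤ f (f x) ∧ f (f x) ∈ Icc l r := by
      filter_upwards [hf.tendsto_right.eventually_lt_const hf.left_neg, hf.eventually_mem_right,
        Ioo_mem_nhdsGT hf.right_pos] with x h₂ h₃ h₄
      refine ⟨hf.strictMonoOn_left.monotoneOn ⟨le_rfl, hf.left_neg⟩ ⟨h₃.1, h₂⟩ h₃.1,
        hf.mem_Icc h₃ h₂.ne⟩
    have h₂ := hf.tendsto_comp hl hc.ne h₁ (hm₂.mono fun x hx => hx.2)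
    rcases le_or_gt p (f l) with hpl | hpl
    -- Return at time 2 would give p = f l; but then f p = f (f l) < 0 < q, although f exceeds q on
    -- [p, 0).
    · have he : firstReturn f (Icc p q) =ᶠ[𝓝[>] (0 : ℝ)] fun x => f (f x) := by
        filter_upwards [hm₂, h₁.eventually_lt_const (hc.trans hg.right_pos),
          Ioo_mem_nhdsGT hg.right_pos] with x h₃ h₄ h₅
        exact firstReturn_eq_two (hright x ⟨h₅.1, h₅.2.le⟩) ⟨hpl.trans h₃.1, h₄.le⟩
      have hpe : p = f l := tendsto_nhds_unique hg.tendsto_right (h₁.congr' he.symm)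
      have := h.right_lt_apply hf hle.1 hq (x := p) ⟨le_rfl, hg.left_neg⟩
      rw [hpe] at this
      exact absurd (this.trans hcc) hg.right_pos.not_gt
    -- Return at time 3 gives p = f (f l), against the assumption p < f (f l).
    · have he : firstReturn f (Icc p q) =ᶠ[𝓝[>] (0 : ℝ)] fun x => f (f (f x)) := by
        filter_upwards [h₁.eventually_lt_const hpl, h₂.eventually_const_lt hlt,
          h₂.eventually_lt_const (hcc.trans hg.right_pos), Ioo_mem_nhdsGT hg.right_pos]
          with x h₃ h₄ h₅ h₆
        exact firstReturn_eq_three (hright x ⟨h₆.1, h₆.2.le⟩) (fun h₇ => h₃.not_ge h₇.1)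
          ⟨h₄.le, h₅.le⟩
      have hpe : p = f (f l) := tendsto_nhds_unique hg.tendsto_right (h₂.congr' he.symm)
      exact hlt.ne hpe
  · by_contra! hlt
    -- From the left of 0 the iterates f, f² tend to r, f r. If f r < q, the return time there is 2
    -- and q = f r.
    have h₁ := hf.tendsto_comp ⟨hf.left_neg.le.trans hf.right_pos.le, le_rfl⟩ hf.right_pos.ne'
      hf.tendsto_left hf.eventually_mem_left
    have he : firstReturn f (Icc p q) =ᶠ[𝓝[<] (0 : ℝ)] fun x => f (f x) := by
      filter_upwards [h₁.eventually_lt_const hlt, h₁.eventually_const_lt (hg.left_neg.trans hr),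
        Ioo_mem_nhdsLT hg.left_neg] with x h₂ h₃ h₄
      exact firstReturn_eq_two (hleft x ⟨h₄.1.le, h₄.2⟩) ⟨h₃.le, h₂.le⟩
    exact hlt.ne (tendsto_nhds_unique hg.tendsto_left (h₁.congr' he.symm)).symm

end

/-! ### Scaling and branches -/

theorem HasAnalyticPart.scale {ρ m : ℝ} {J K : Set ℝ} {g h : ℝ → ℝ} {c : ℝ} (hc : 0 < c)
    (hg : HasAnalyticPart ρ m J g) (hK : ∀ x ∈ K, c⁻¹ * x ∈ J ∧ h x = c * g (c⁻¹ * x)) :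
    HasAnalyticPart ρ (c ^ ρ * m) K h := by
  obtain ⟨φ, N, hN, hI, hd, hs, he⟩ := hg
  have hcρ : 0 < c ^ ρ := Real.rpow_pos_of_pos hc ρ
  set d : ℝ := (c ^ ρ)⁻¹ with hd'
  have hd0 : 0 < d := inv_pos.2 hcρ
  refine ⟨fun z => c * φ (d * z), (fun z => (d : ℂ) * z) ⁻¹' N, hN.preimage (by fun_prop),
    fun u hu => ?_, ?_, fun z hz => ?_, fun x hx => ?_⟩
  · have : d * u ∈ Icc 0 m := by
      refine ⟨mul_nonneg hd0.le hu.1, ?_⟩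
      rw [hd', inv_mul_le_iff₀ hcρ]
      exact hu.2
    have := hI _ this
    push_cast at this
    exact this
  · have h₁ : DifferentiableOn ℂ (fun z => (d : ℂ) * z) ((fun z => (d : ℂ) * z) ⁻¹' N) := by
      fun_prop
    exact (hd.comp h₁ fun z hz => hz).const_mul _
  · have e : (d : ℂ) * starRingEnd ℂ z = starRingEnd ℂ (d * z) := by simp
    have := hs _ hz
    refine ⟨?_, ?_⟩
    · change (d : ℂ) * starRingEnd ℂ z ∈ N
      rw [e]
      exact this.1
    · change c * φ (d * starRingEnd ℂ z) = starRingEnd ℂ (c * φ (d * z))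
      rw [e, this.2]
      simp
  · obtain ⟨h₁, h₂⟩ := hK x hx
    have h₃ := he _ h₁
    have e : |c⁻¹ * x| ^ ρ = d * |x| ^ ρ := by
      rw [abs_mul, Real.mul_rpow (abs_nonneg _) (abs_nonneg _), abs_of_pos (inv_pos.2 hc),
        Real.inv_rpow hc.le]
    rw [h₂, Complex.ofReal_mul, h₃, e, Complex.ofReal_mul]

/-- Used to see that the first-return map is a Lorenz map: it is a rescaling of the renormalization,
which is known to be one. The analyticity of the composed branches need not be examined separately.
-/
theorem IsLorenzMap.scale {ρ l r : ℝ} {g h : ℝ → ℝ} {c : ℝ} (hc : 0 < c)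
    (hg : IsLorenzMap ρ l r g)
    (hh : ∀ x ∈ Icc (c * l) (c * r) \ {0}, h x = c * g (c⁻¹ * x)) :
    IsLorenzMap ρ (c * l) (c * r) h := by
  have hl := hg.left_neg
  have hr := hg.right_pos
  have hcl : c * l < 0 := mul_neg_of_pos_of_neg hc hl
  have hcr : 0 < c * r := mul_pos hc hr
  have hmem : ∀ x, x ∈ Icc (c * l) (c * r) \ {0} → c⁻¹ * x ∈ Icc l r \ {0} := by
    intro x hx
    have h0 : x ≠ 0 := hx.2
    refine ⟨⟨?_, ?_⟩, mul_ne_zero (inv_ne_zero hc.ne') h0⟩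
    · rw [inv_mul_eq_div, le_div_iff₀ hc, mul_comm]
      exact hx.1.1
    · rw [inv_mul_le_iff₀ hc]
      exact hx.1.2
  have hleft : ∀ x ∈ Ico (c * l) 0, x ∈ Icc (c * l) (c * r) \ {0} ∧ c⁻¹ * x ∈ Ico l 0 := by
    intro x hx
    have h₁ : x ∈ Icc (c * l) (c * r) \ {0} := ⟨⟨hx.1, hx.2.le.trans hcr.le⟩, hx.2.ne⟩
    exact ⟨h₁, (hmem x h₁).1.1, mul_neg_of_pos_of_neg (inv_pos.2 hc) hx.2⟩
  have hright : ∀ x ∈ Ioc 0 (c * r), x ∈ Icc (c * l) (c * r) \ {0} ∧ c⁻¹ * x ∈ Ioc 0 r := by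
    intro x hx
    have h₁ : x ∈ Icc (c * l) (c * r) \ {0} := ⟨⟨hcl.le.trans hx.1.le, hx.2⟩, hx.1.ne'⟩
    exact ⟨h₁, mul_pos (inv_pos.2 hc) hx.1, (hmem x h₁).1.2⟩
  have hcont : Continuous fun x : ℝ => c⁻¹ * x := by fun_prop
  refine ⟨hg.one_lt_exponent, hcl, hcr, fun x hx => ?_, ?_, fun x hx x' hx' hlt => ?_,
    fun x hx x' hx' hlt => ?_, ?_, ?_, ?_, ?_⟩
  · rw [hh x hx]
    have := hg.mapsTo (hmem x hx)
    exact ⟨mul_le_mul_of_nonneg_left this.1 hc.le, mul_le_mul_of_nonneg_left this.2 hc.le⟩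
  · refine ContinuousOn.congr (f := fun x => c * g (c⁻¹ * x)) ?_ hh
    exact continuousOn_const.mul (hg.continuousOn.comp hcont.continuousOn hmem)
  · rw [hh x (hleft x hx).1, hh x' (hleft x' hx').1]
    exact mul_lt_mul_of_pos_left (hg.strictMonoOn_left (hleft x hx).2 (hleft x' hx').2
      (mul_lt_mul_of_pos_left hlt (inv_pos.2 hc))) hc
  · rw [hh x (hright x hx).1, hh x' (hright x' hx').1]
    exact mul_lt_mul_of_pos_left (hg.strictMonoOn_right (hright x hx).2 (hright x' hx').2
      (mul_lt_mul_of_pos_left hlt (inv_pos.2 hc))) hc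
  · have h₁ : Tendsto (fun x : ℝ => c⁻¹ * x) (𝓝[<] 0) (𝓝[<] 0) := by
      refine tendsto_nhdsWithin_iff.2 ⟨?_, ?_⟩
      · have := (hcont.tendsto 0).mono_left (nhdsWithin_le_nhds (s := Iio 0))
        simpa using this
      · filter_upwards [self_mem_nhdsWithin] with x hx
        exact mul_neg_of_pos_of_neg (inv_pos.2 hc) hx
    refine ((hg.tendsto_left.comp h₁).const_mul c).congr' ?_
    filter_upwards [Ioo_mem_nhdsLT hcl] with x hx
    exact (hh x (hleft x ⟨hx.1.le, hx.2⟩).1).symm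
  · have h₁ : Tendsto (fun x : ℝ => c⁻¹ * x) (𝓝[>] 0) (𝓝[>] 0) := by
      refine tendsto_nhdsWithin_iff.2 ⟨?_, ?_⟩
      · have := (hcont.tendsto 0).mono_left (nhdsWithin_le_nhds (s := Ioi 0))
        simpa using this
      · filter_upwards [self_mem_nhdsWithin] with x hx
        exact mul_pos (inv_pos.2 hc) hx
    refine ((hg.tendsto_right.comp h₁).const_mul c).congr' ?_
    filter_upwards [Ioo_mem_nhdsGT hcr] with x hx
    exact (hh x (hright x ⟨hx.1, hx.2.le⟩).1).symm
  · have := hg.analytic_left.scale (K := Ioo (c * l) 0) (h := h) hc fun x hx =>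
      ⟨⟨by rw [inv_mul_eq_div, lt_div_iff₀ hc, mul_comm]; exact hx.1,
        (hleft x ⟨hx.1.le, hx.2⟩).2.2⟩, hh x (hleft x ⟨hx.1.le, hx.2⟩).1⟩
    rwa [abs_mul, abs_of_pos hc, Real.mul_rpow hc.le (abs_nonneg _)]
  · have := hg.analytic_right.scale (K := Ioo 0 (c * r)) (h := h) hc fun x hx =>
      ⟨⟨(hright x ⟨hx.1, hx.2.le⟩).2.1, by rw [inv_mul_lt_iff₀ hc]; exact hx.2⟩,
        hh x (hright x ⟨hx.1, hx.2.le⟩).1⟩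
    rwa [Real.mul_rpow hc.le hr.le]

/-- An interval of monotonicity whose endpoints are mapped to `0` is a branch. -/
theorem IsMonotoneInterval.isBranch {l r : ℝ} {f : ℝ → ℝ} {n : ℕ} {c d : ℝ} (hcd : c < d)
    (h : IsMonotoneInterval l r f n (Ioo c d)) (hc : ∃ j < n, f^[j] c = 0)
    (hd : ∃ j < n, f^[j] d = 0) : IsBranch l r f n (Ioo c d) := by
  refine ⟨h, fun B hB hsub => ?_⟩
  obtain ⟨⟨c', d', hcd', rfl⟩, -, hne, -⟩ := hB
  have hle := (Ioo_subset_Ioo_iff hcd).1 hsub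
  refine Ioo_subset_Ioo ?_ ?_
  · by_contra! hlt
    obtain ⟨j, hj, hj0⟩ := hc
    exact hne j hj c ⟨hlt, hcd.trans_le hle.2⟩ hj0
  · by_contra! hlt
    obtain ⟨j, hj, hj0⟩ := hd
    exact hne j hj d ⟨hle.1.trans_lt hcd, hlt⟩ hj0

/-! ### Renormalizations of type `(01, 100)` -/

theorem isRenormalization_of_bounds {ρ r r' : ℝ} {f g : ℝ → ℝ} {p q : ℝ}
    (hf : IsLorenzMap ρ (-1) r f) (hg : IsLorenzMap ρ (-1) r' g) (hc : f (-1) < 0)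
    (hp : f (f (-1)) = p) (hq : f r = q) (hp1 : -1 < p) (hp0 : p < 0) (hq0 : 0 < q) (hqr : q < r)
    (hfp : q < f p) (hfq : f q < p) (hffq : f (f q) < p) (hr' : -p * r' = q)
    (hleft : ∀ x ∈ Ico (-1) 0, g x = (-p)⁻¹ * f (f (-p * x)))
    (hright : ∀ x ∈ Ioc 0 r', g x = (-p)⁻¹ * f (f (f (-p * x)))) :
    IsRenormalization ρ [0, 1] [1, 0, 0] (-1) r f r' g := by
  have hr := hf.right_pos
  have hcp : 0 < -p := neg_pos.2 hp0
  have mL : ∀ {x}, x ∈ Ico p 0 → x ∈ Ico (-1) 0 := fun hx => ⟨hp1.le.trans hx.1, hx.2⟩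
  have mR : ∀ {x}, x ∈ Ioc 0 q → x ∈ Ioc 0 r := fun hx => ⟨hx.1, hx.2.trans hqr.le⟩
  have hL₁ : ∀ x ∈ Ico p 0, q < f x := fun x hx =>
    hfp.trans_le (hf.strictMonoOn_left.monotoneOn ⟨hp1.le, hp0⟩ (mL hx) hx.1)
  have hR₁ : ∀ x ∈ Ioc 0 q, f x < p := fun x hx =>
    (hf.strictMonoOn_right.monotoneOn (mR hx) ⟨hq0, hqr.le⟩ hx.2).trans_lt hfq
  have hR₂ : ∀ x ∈ Ioc 0 q, f (f x) < p := fun x hx =>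
    (hf.strictMonoOn_left.monotoneOn ⟨(hf.left_lt (mR hx)).le, (hR₁ x hx).trans hp0⟩
      ⟨(hf.left_lt ⟨hq0, hqr.le⟩).le, hfq.trans hp0⟩
      (hf.strictMonoOn_right.monotoneOn (mR hx) ⟨hq0, hqr.le⟩ hx.2)).trans_lt hffq
  have sL : ∀ {x}, x ∈ Ico p 0 → (-p)⁻¹ * x ∈ Ico (-1) 0 := fun {x} hx => by
    refine ⟨?_, mul_neg_of_pos_of_neg (inv_pos.2 hcp) hx.2⟩
    rw [inv_mul_eq_div, le_div_iff₀ hcp]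
    linarith [hx.1]
  have sR : ∀ {x}, x ∈ Ioc 0 q → (-p)⁻¹ * x ∈ Ioc 0 r' := fun {x} hx => by
    refine ⟨mul_pos (inv_pos.2 hcp) hx.1, ?_⟩
    rw [inv_mul_le_iff₀ hcp, hr']
    exact hx.2
  have gL : ∀ x ∈ Ico p 0, f (f x) = -p * g ((-p)⁻¹ * x) := fun x hx => by
    rw [hleft _ (sL hx), mul_inv_cancel_left₀ hcp.ne', mul_inv_cancel_left₀ hcp.ne']
  have gR : ∀ x ∈ Ioc 0 q, f (f (f x)) = -p * g ((-p)⁻¹ * x) := fun x hx => by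
    rw [hright _ (sR hx), mul_inv_cancel_left₀ hcp.ne', mul_inv_cancel_left₀ hcp.ne']
  have scaled : ∀ {v}, v ∈ Icc (-1) r' → -p * v ∈ Icc p q := fun {v} hv => by
    rw [← hr']
    exact ⟨by nlinarith [hv.1], mul_le_mul_of_nonneg_left hv.2 hcp.le⟩
  have uL : ∀ x ∈ Ico p 0, f (f x) ∈ Icc p q := fun x hx => by
    rw [gL x hx]
    exact scaled (hg.mem_Icc ⟨(sL hx).1, (sL hx).2.le.trans hg.right_pos.le⟩ (sL hx).2.ne)
  have uR : ∀ x ∈ Ioc 0 q, f (f (f x)) ∈ Icc p q := fun x hx => by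
    rw [gR x hx]
    exact scaled (hg.mem_Icc ⟨hg.left_neg.le.trans (sR hx).1.le, (sR hx).2⟩ (sR hx).1.ne')
  have nL : ∀ x ∈ Ico p 0, f x ∉ Icc p q := fun x hx h => (hL₁ x hx).not_ge h.2
  have nR : ∀ x ∈ Ioc 0 q, f x ∉ Icc p q := fun x hx h => (hR₁ x hx).not_ge h.1
  have nR₂ : ∀ x ∈ Ioc 0 q, f (f x) ∉ Icc p q := fun x hx h => (hR₂ x hx).not_ge h.1
  have split : ∀ {x}, x ∈ Icc p q \ {0} → x ∈ Ico p 0 ∨ x ∈ Ioc 0 q := fun {x} hx => by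
    rcases lt_or_gt_of_ne (show x ≠ 0 from hx.2) with h | h
    · exact .inl ⟨hx.1.1, h⟩
    · exact .inr ⟨h, hx.1.2⟩
  have ret : ∀ x ∈ Icc p q \ {0}, firstReturn f (Icc p q) x = -p * g ((-p)⁻¹ * x) := by
    intro x hx
    rcases split hx with h | h
    · rw [firstReturn_eq_two (nL x h) (uL x h), gL x h]
    · rw [firstReturn_eq_three (nR x h) (nR₂ x h) (uR x h), gR x h]
  have hret : ReturnIsLorenz ρ f p q := by
    refine ⟨fun x hx => ?_, ?_⟩
    · rcases split hx with h | h
      · exact ⟨2, two_pos, uL x h⟩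
      · exact ⟨3, three_pos, uR x h⟩
    · have := hg.scale (h := firstReturn f (Icc p q)) hcp (by
        rw [hr', mul_neg_one, neg_neg]
        exact ret)
      rwa [hr', mul_neg_one, neg_neg] at this
  -- The branches are bounded by preimages of 0: x₀ is the zero of the left branch and x₁ the
  -- preimage of x₀ under the right one. The branch with word 01 is (x₀, 0), the one with word 100
  -- is (0, x₁).
  obtain ⟨x₀, hx₀, hfx₀⟩ := hf.exists_eq_left (x := -1) (v := 0) ⟨le_rfl, by norm_num⟩ hc.le hr
  have hx₀p : x₀ < p := (hf.strictMonoOn_left.lt_iff_lt ⟨hx₀.1, hx₀.2⟩ ⟨hp1.le, hp0⟩).1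
    (by rw [hfx₀]; exact hq0.trans hfp)
  have hx₀1 : -1 < x₀ := lt_of_le_of_ne hx₀.1 (by rintro rfl; exact hc.ne hfx₀)
  have hfqx₀ : f q < x₀ := (hf.strictMonoOn_left.lt_iff_lt
    ⟨(hf.left_lt ⟨hq0, hqr.le⟩).le, hfq.trans hp0⟩ ⟨hx₀.1, hx₀.2⟩).1
    (by rw [hfx₀]; exact hffq.trans hp0)
  obtain ⟨x₁, hx₁, hfx₁⟩ := hf.exists_eq_right (x := r) (v := x₀) ⟨hr, le_rfl⟩
    (by rw [hq]; exact hx₀.2.le.trans hq0.le) hx₀1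
  have hqx₁ : q < x₁ := (hf.strictMonoOn_right.lt_iff_lt ⟨hq0, hqr.le⟩ hx₁).1
    (by rw [hfx₁]; exact hfqx₀)
  have aA : ∀ x ∈ Ioo x₀ 0, x ∈ Ico (-1) 0 ∧ f x ∈ Ioo 0 r := fun x hx => by
    have h₁ : x ∈ Ico (-1) 0 := ⟨hx₀.1.trans hx.1.le, hx.2⟩
    refine ⟨h₁, ?_, hf.lt_right h₁⟩
    rw [← hfx₀]
    exact hf.strictMonoOn_left hx₀ h₁ hx.1
  have aB : ∀ x ∈ Ioo 0 x₁, x ∈ Ioc 0 r ∧ f x ∈ Ioo (-1) x₀ ∧ f (f x) ∈ Ioo (-1) 0 :=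
    fun x hx => by
    have h₁ : x ∈ Ioc 0 r := ⟨hx.1, hx.2.le.trans hx₁.2⟩
    have h₂ : f x < x₀ := hfx₁ ▸ hf.strictMonoOn_right h₁ hx₁ hx.2
    have h₃ := hf.left_lt h₁
    have h₄ : f x ∈ Ico (-1) 0 := ⟨h₃.le, h₂.trans hx₀.2⟩
    refine ⟨h₁, ⟨h₃, h₂⟩, ?_, hfx₀ ▸ hf.strictMonoOn_left h₄ hx₀ h₂⟩
    exact (hf.mem_Icc ⟨le_rfl, by linarith⟩ (by norm_num)).1.trans_lt
      (hf.strictMonoOn_left ⟨le_rfl, by norm_num⟩ h₄ h₃)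
  have bA : IsBranch (-1) r f 2 (Ioo x₀ 0) := by
    refine IsMonotoneInterval.isBranch hx₀.2 ⟨⟨x₀, 0, hx₀.2, rfl⟩, fun x hx => ?_, ?_, ?_⟩
      ⟨1, one_lt_two, hfx₀⟩ ⟨0, two_pos, rfl⟩
    · exact ⟨hx₀.1.trans hx.1.le, hx.2.le.trans hr.le⟩
    · intro j hj x hx
      obtain rfl | rfl : j = 0 ∨ j = 1 := by omega
      · exact hx.2.ne
      · exact (aA x hx).2.1.ne'
    · intro x hx x' hx' hle
      exact hf.strictMonoOn_right.monotoneOn ⟨(aA x hx).2.1, (aA x hx).2.2.le⟩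
        ⟨(aA x' hx').2.1, (aA x' hx').2.2.le⟩
        (hf.strictMonoOn_left.monotoneOn (aA x hx).1 (aA x' hx').1 hle)
  have bB : IsBranch (-1) r f 3 (Ioo 0 x₁) := by
    refine IsMonotoneInterval.isBranch hx₁.1 ⟨⟨0, x₁, hx₁.1, rfl⟩, fun x hx => ?_, ?_, ?_⟩
      ⟨0, three_pos, rfl⟩ ⟨2, by norm_num, ?_⟩
    · exact ⟨by linarith [hx.1], hx.2.le.trans hx₁.2⟩
    · intro j hj x hx
      obtain rfl | rfl | rfl : j = 0 ∨ j = 1 ∨ j = 2 := by omega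
      · exact hx.1.ne'
      · exact ((aB x hx).2.1.2.trans hx₀.2).ne
      · exact (aB x hx).2.2.2.ne
    · intro x hx x' hx' hle
      have h₁ : ∀ {x}, x ∈ Ioo 0 x₁ → f x ∈ Ico (-1) 0 := fun {x} hx =>
        ⟨(aB x hx).2.1.1.le, (aB x hx).2.1.2.trans hx₀.2⟩
      have h₂ : ∀ {x}, x ∈ Ioo 0 x₁ → f (f x) ∈ Ico (-1) 0 := fun {x} hx =>
        ⟨(aB x hx).2.2.1.le, (aB x hx).2.2.2⟩
      exact hf.strictMonoOn_left.monotoneOn (h₂ hx) (h₂ hx')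
        (hf.strictMonoOn_left.monotoneOn (h₁ hx) (h₁ hx')
          (hf.strictMonoOn_right.monotoneOn (aB x hx).1 (aB x' hx').1 hle))
    · change f (f x₁) = 0
      rw [hfx₁, hfx₀]
  have mL' : ∀ {x}, x ∈ Icc p q ∩ Ioo (-1) 0 → x ∈ Ico p 0 := fun hx => ⟨hx.1.1, hx.2.2⟩
  have mR' : ∀ {x}, x ∈ Icc p q ∩ Ioo 0 r → x ∈ Ioc 0 q := fun hx => ⟨hx.2.1, hx.1.2⟩
  refine ⟨hf, hg, p, q, ⟨?_, hret, ?_⟩, ⟨le_rfl, by norm_num, ?_, ?_, ?_, ?_⟩, ?_, ?_⟩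
  · refine ⟨Icc_subset_Icc hp1.le hqr.le, fun h => ?_⟩
    exact hp1.not_ge (h (show (-1 : ℝ) ∈ Icc (-1) r from ⟨le_rfl, by linarith⟩)).1
  · intro p' q' hs h
    have := h.subset_Icc hf hs hc (by rw [hp]; exact hp0) (by rw [hq]; exact hq0)
    rwa [hp, hq] at this
  · intro x hx
    exact returnTime_eq_two (nL x (mL' hx)) (uL x (mL' hx))
  · intro x hx
    exact returnTime_eq_three (nR x (mR' hx)) (nR₂ x (mR' hx)) (uR x (mR' hx))
  · refine ⟨_, bA, fun x hx => ⟨hx₀p.trans_le hx.1.1, hx.2.2⟩, fun j hj => ?_⟩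
    rintro _ ⟨x, hx, rfl⟩
    obtain rfl | rfl : j = 0 ∨ j = 1 := by
      simp only [List.length_cons, List.length_nil] at hj
      omega
    · simpa using ⟨hx₀1.trans hx.1, hx.2⟩
    · simpa using (aA x hx).2
  · refine ⟨_, bB, fun x hx => ⟨hx.2.1, hx.1.2.trans_lt hqx₁⟩, fun j hj => ?_⟩
    rintro _ ⟨x, hx, rfl⟩
    obtain rfl | rfl | rfl : j = 0 ∨ j = 1 ∨ j = 2 := by
      simp only [List.length_cons, List.length_nil] at hj
      omega
    · simpa using ⟨hx.1, hx.2.trans_le hx₁.2⟩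
    · simpa using ⟨(aB x hx).2.1.1, (aB x hx).2.1.2.trans hx₀.2⟩
    · simpa using (aB x hx).2.2
  · rw [div_neg, div_one, hr']
  · intro x hx
    have hxs : -p * x ∈ Icc p q \ {0} :=
      ⟨scaled hx.1, mul_ne_zero hcp.ne' (show x ≠ 0 from hx.2)⟩
    rw [div_neg, div_one, ret _ hxs, inv_mul_cancel_left₀ hcp.ne', inv_mul_cancel_left₀ hcp.ne']

end

end LorenzRenorm

namespace LorenzRenorm

open Set Filter Topology

open scoped X

noncomputable section

/-! ### Regularity of power series -/

/-- The value at a complex point of the function with Taylor coefficients `a`. -/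
def complexValue (a : X) (z : ℂ) : ℂ := ∑' k : ℕ, (a k : ℂ) * z ^ k

theorem complexValue_ofReal (a : X) (x : ℝ) : complexValue a x = value a x := by
  rw [complexValue, value, Complex.ofReal_tsum]
  simp

theorem complexValue_conj (a : X) (z : ℂ) :
    complexValue a (starRingEnd ℂ z) = starRingEnd ℂ (complexValue a z) := by
  rw [complexValue, complexValue, Complex.conj_tsum]
  simp

theorem differentiableOn_complexValue (a : X) :
    DifferentiableOn ℂ (complexValue a) (Metric.ball 0 1) := by
  refine Complex.differentiableOn_tsum_of_summable_norm (X.summable_abs a) (fun k => by fun_prop)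
    Metric.isOpen_ball fun k z hz => ?_
  rw [norm_mul, norm_pow, Complex.norm_real, Real.norm_eq_abs]
  exact mul_le_of_le_one_right (abs_nonneg _)
    (pow_le_one₀ (norm_nonneg _) (mem_ball_zero_iff.1 hz).le)

theorem continuousAt_value (a : X) {x : ℝ} (hx : |x| < 1) : ContinuousAt (value a) x := by
  have h : ContinuousOn (value a) (Metric.ball 0 1) := by
    refine continuousOn_tsum (fun k => by fun_prop) (X.summable_abs a) fun k z hz => ?_
    rw [norm_mul, norm_pow, Real.norm_eq_abs]
    exact mul_le_of_le_one_right (abs_nonneg _)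
      (pow_le_one₀ (norm_nonneg _) (mem_ball_zero_iff.1 hz).le)
  exact h.continuousAt (Metric.isOpen_ball.mem_nhds (mem_ball_zero_iff.2 hx))

/-- Powers are 1-Lipschitz on [-1/2, 1/2], because k / 2ᵏ⁻¹ ≤ 1. The induction replaces the
derivative by halving both terms of a product formula. -/
theorem abs_pow_sub_pow_le {x y : ℝ} (hx : |x| ≤ 1 / 2) (hy : |y| ≤ 1 / 2) (k : ℕ) :
    |x ^ k - y ^ k| ≤ |x - y| := by
  induction k with
  | zero => simp
  | succ k ih =>
    rcases k with _ | k
    · simp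
    have e : x ^ (k + 1 + 1) - y ^ (k + 1 + 1) =
        x * (x ^ (k + 1) - y ^ (k + 1)) + (x - y) * y ^ (k + 1) := by ring
    have h₁ : |y ^ (k + 1)| ≤ 1 / 2 := by
      rw [abs_pow, pow_succ]
      have := pow_le_one₀ (n := k) (abs_nonneg y) (hy.trans (by norm_num))
      nlinarith [abs_nonneg y]
    rw [e]
    refine (abs_add_le _ _).trans ?_
    rw [abs_mul, abs_mul]
    have h₂ := mul_le_mul hx ih (abs_nonneg _) (by norm_num)
    have h₃ := mul_le_mul_of_nonneg_left h₁ (abs_nonneg (x - y))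
    linarith

theorem abs_value_sub_value_le (a : X) {x y : ℝ} (hx : |x| ≤ 1 / 2) (hy : |y| ≤ 1 / 2) :
    |value a x - value a y| ≤ ‖a‖ * |x - y| := by
  have hx1 := (summable_value a (hx.trans (by norm_num : (1 / 2 : ℝ) ≤ 1))).of_norm
  have hy1 := (summable_value a (hy.trans (by norm_num : (1 / 2 : ℝ) ≤ 1))).of_norm
  refine (hx1.hasSum.sub hy1.hasSum).norm_le_of_bounded ((X.hasSum_abs a).mul_right |x - y|)
    fun k => ?_
  rw [← mul_sub, norm_mul]
  exact mul_le_mul_of_nonneg_left (abs_pow_sub_pow_le hx hy k) (abs_nonneg _)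

/-- A power series whose linear term dominates the higher ones is strictly monotone. -/
theorem value_lt_value {a : X} (ha : ‖X.shift (X.shift a)‖ < a 1) {x y : ℝ} (hx : |x| ≤ 1 / 2)
    (hy : |y| ≤ 1 / 2) (hxy : x < y) : value a x < value a y := by
  have e : ∀ {x : ℝ}, |x| ≤ 1 / 2 → value a x =
      a 0 + a 1 * x + value (X.Z * (X.Z * X.shift (X.shift a))) x := by
    intro x hx
    have hx1 : |x| ≤ 1 := hx.trans (by norm_num)
    rw [value_shift a hx1, value_shift (X.shift a) hx1, value_mul _ _ hx1, value_mul _ _ hx1,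
      value_Z, X.shift_apply]
    ring
  have h₁ := abs_value_sub_value_le (X.Z * (X.Z * X.shift (X.shift a))) hx hy
  have h₂ : ‖X.Z * (X.Z * X.shift (X.shift a))‖ ≤ ‖X.shift (X.shift a)‖ :=
    (norm_Z_mul_le _).trans (norm_Z_mul_le _)
  rw [abs_sub_comm x y, abs_of_pos (sub_pos.2 hxy)] at h₁
  have h₃ := mul_lt_mul_of_pos_right (h₂.trans_lt ha) (sub_pos.2 hxy)
  have h₄ := (abs_le.1 h₁).2
  rw [e hx, e hy]
  linarith

/-! ### Lorenz maps represented by points of `Y` -/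

/-- Explicit inequalities that make the map with coordinates `y` a Lorenz map which is
renormalizable of type `(01, 100)`, as soon as its first-return map is a Lorenz map. -/
structure Good (y : Y) : Prop where
  left_slope : ‖X.shift (X.shift y.fst)‖ < -y.fst 1
  right_slope : ‖X.shift y.snd‖ < y.snd 0
  end_pos : 0 < rightEnd y
  end_lt : rightEnd y < 1 / 2
  crit_gt : -1 < leftPart y 1
  crit_lt : leftPart y 1 < 0
  p_gt : -1 < leftPart y (leftPart y 1 ^ 2)
  p_lt : leftPart y (leftPart y 1 ^ 2) < 0
  q_gt : 0 < rightPart y (rightEnd y ^ 2)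
  q_lt : rightPart y (rightEnd y ^ 2) < rightEnd y
  p_image : rightPart y (rightEnd y ^ 2) < leftPart y (leftPart y (leftPart y 1 ^ 2) ^ 2)
  q_image : rightPart y (rightPart y (rightEnd y ^ 2) ^ 2) < leftPart y (leftPart y 1 ^ 2)
  q_image₂ : leftPart y (rightPart y (rightPart y (rightEnd y ^ 2) ^ 2) ^ 2) <
    leftPart y (leftPart y 1 ^ 2)

/-- Since 1/s = 5/11 < 1/2, the left series is evaluated only on [-1/2, 1/2], where the monotonicity
criterion holds. For the right series the same follows from r < 1/2 and t = 1/2. -/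
theorem abs_sub_one_div_s_le {u : ℝ} (hu : u ∈ Icc 0 1) : |(u - 1) / s| ≤ 1 / 2 := by
  rw [abs_div, abs_of_nonpos (by linarith [hu.2] : u - 1 ≤ 0),
    abs_of_pos (by norm_num [s] : 0 < s), div_le_iff₀ (by norm_num [s])]
  norm_num [s]
  linarith [hu.1]

theorem abs_div_t_le {u : ℝ} (hu : u ∈ Icc 0 (1 / 4)) : |u / t| ≤ 1 / 2 := by
  rw [abs_div, abs_of_nonneg hu.1, abs_of_pos (by norm_num [t] : 0 < t),
    div_le_iff₀ (by norm_num [t])]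
  norm_num [t]
  linarith [hu.2]

theorem continuousAt_leftPart (y : Y) {u : ℝ} (hu : u ∈ Icc 0 1) : ContinuousAt (leftPart y) u :=
  ContinuousAt.comp (g := value y.fst) (f := fun u => (u - 1) / s)
    (continuousAt_value _ ((abs_sub_one_div_s_le hu).trans_lt (by norm_num))) (by fun_prop)

theorem continuousAt_rightPart (y : Y) {u : ℝ} (hu : u ∈ Icc 0 (1 / 4)) :
    ContinuousAt (rightPart y) u := by
  have := ContinuousAt.comp (g := value y.snd) (f := fun u => u / t)
    (continuousAt_value _ ((abs_div_t_le hu).trans_lt (by norm_num))) (by fun_prop)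
  exact continuousAt_const.add (continuousAt_id.mul this)

theorem toMap_of_neg (y : Y) {x : ℝ} (hx : x < 0) : toMap y x = leftPart y (x ^ 2) := if_pos hx

theorem toMap_of_pos (y : Y) {x : ℝ} (hx : 0 < x) : toMap y x = rightPart y (x ^ 2) :=
  if_neg hx.not_gt

theorem hasAnalyticPart_left (y : Y) :
    HasAnalyticPart 2 (|(-1 : ℝ)| ^ (2 : ℝ)) (Ioo (-1) 0) (toMap y) := by
  refine ⟨fun z => complexValue y.fst ((z - 1) / s), (fun z => (z - 1) / s) ⁻¹' Metric.ball 0 1,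
    Metric.isOpen_ball.preimage (by fun_prop), fun u hu => ?_, ?_, fun z hz => ?_, fun x hx => ?_⟩
  · have hu1 : u ∈ Icc 0 1 := by simpa using hu
    have : ((u : ℂ) - 1) / s = (((u - 1) / s : ℝ) : ℂ) := by push_cast; rfl
    rw [mem_preimage, this, mem_ball_zero_iff, Complex.norm_real]
    exact (abs_sub_one_div_s_le hu1).trans_lt (by norm_num)
  · have h₁ : DifferentiableOn ℂ (fun z : ℂ => (z - 1) / s)
        ((fun z : ℂ => (z - 1) / s) ⁻¹' Metric.ball 0 1) := by fun_prop
    exact (differentiableOn_complexValue y.fst).comp h₁ fun z hz => hz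
  · have e : (starRingEnd ℂ z - 1) / s = starRingEnd ℂ ((z - 1) / s) := by simp
    refine ⟨?_, ?_⟩
    · rw [mem_preimage, e, mem_ball_zero_iff, Complex.norm_conj]
      exact mem_ball_zero_iff.1 hz
    · change complexValue y.fst ((starRingEnd ℂ z - 1) / s) = _
      rw [e, complexValue_conj]
  · rw [toMap_of_neg y hx.2, leftPart, ← complexValue_ofReal, Real.rpow_two, sq_abs]
    push_cast
    rfl

theorem hasAnalyticPart_right (y : Y) {r : ℝ} (hr : 0 < r) (hr' : r < 1 / 2) :
    HasAnalyticPart 2 (r ^ (2 : ℝ)) (Ioo 0 r) (toMap y) := by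
  refine ⟨fun z => -1 + z * complexValue y.snd (z / t), (fun z => z / t) ⁻¹' Metric.ball 0 1,
    Metric.isOpen_ball.preimage (by fun_prop), fun u hu => ?_, ?_, fun z hz => ?_, fun x hx => ?_⟩
  · rw [Real.rpow_two] at hu
    have hu1 : u ∈ Icc 0 (1 / 4) := ⟨hu.1, hu.2.trans (by nlinarith)⟩
    have : (u : ℂ) / t = ((u / t : ℝ) : ℂ) := by push_cast; rfl
    rw [mem_preimage, this, mem_ball_zero_iff, Complex.norm_real]
    exact (abs_div_t_le hu1).trans_lt (by norm_num)
  · have h₁ : DifferentiableOn ℂ (fun z : ℂ => z / t)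
        ((fun z : ℂ => z / t) ⁻¹' Metric.ball 0 1) := by fun_prop
    exact ((differentiableOn_id.mul
      ((differentiableOn_complexValue y.snd).comp h₁ fun z hz => hz))).const_add _
  · have e : starRingEnd ℂ z / t = starRingEnd ℂ (z / t) := by simp
    refine ⟨?_, ?_⟩
    · rw [mem_preimage, e, mem_ball_zero_iff, Complex.norm_conj]
      exact mem_ball_zero_iff.1 hz
    · change -1 + starRingEnd ℂ z * complexValue y.snd (starRingEnd ℂ z / t) = _
      rw [e, complexValue_conj]
      simp
  · rw [toMap_of_pos y hx.1, rightPart, Real.rpow_two, sq_abs]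
    push_cast
    rw [← complexValue_ofReal]
    push_cast
    rfl

namespace Good

variable {y : Y}

theorem strictAntiOn_leftPart (hy : Good y) : StrictAntiOn (leftPart y) (Icc 0 1) := by
  intro u hu u' hu' hlt
  have h := value_lt_value (a := -y.fst) (x := (u - 1) / s) (y := (u' - 1) / s) (by
    rw [map_neg, map_neg, norm_neg]
    exact hy.left_slope) (abs_sub_one_div_s_le hu) (abs_sub_one_div_s_le hu')
    (div_lt_div_of_pos_right (by linarith) (by norm_num [s]))
  rw [value_neg _ ((abs_sub_one_div_s_le hu).trans (by norm_num)),
    value_neg _ ((abs_sub_one_div_s_le hu').trans (by norm_num))] at h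
  exact neg_lt_neg_iff.1 h

/-- The non-constant part is t times the series z g(z) at u/t. Its linear coefficient is g₀, and its
higher coefficients are those of the shifted g. -/
theorem strictMonoOn_rightPart (hy : Good y) : StrictMonoOn (rightPart y) (Icc 0 (1 / 4)) := by
  intro u hu u' hu' hlt
  have ht : (0 : ℝ) < t := by norm_num [t]
  have h := value_lt_value (a := X.Z * y.snd) (x := u / t) (y := u' / t) (by
    rw [X.shift_Z_mul, X.Z_mul_succ]
    exact hy.right_slope) (abs_div_t_le hu) (abs_div_t_le hu')
    (div_lt_div_of_pos_right hlt ht)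
  rw [value_mul _ _ ((abs_div_t_le hu).trans (by norm_num)), value_Z,
    value_mul _ _ ((abs_div_t_le hu').trans (by norm_num)), value_Z] at h
  have e : ∀ u : ℝ, rightPart y u = -1 + t * (u / t * value y.snd (u / t)) := fun u => by
    rw [rightPart, ← mul_assoc, mul_div_cancel₀ _ ht.ne']
  rw [e, e]
  have := mul_lt_mul_of_pos_left h ht
  linarith

theorem sq_mem_left {x : ℝ} (hx : x ∈ Ico (-1) 0) : x ^ 2 ∈ Icc (0 : ℝ) 1 :=
  ⟨sq_nonneg x, by nlinarith [hx.1, hx.2]⟩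

theorem sq_mem_right (hy : Good y) {x : ℝ} (hx : x ∈ Ioc 0 (rightEnd y)) :
    x ^ 2 ∈ Icc (0 : ℝ) (1 / 4) :=
  ⟨sq_nonneg x, by nlinarith [hx.1, hx.2, hy.end_lt]⟩

theorem isLorenzMap (hy : Good y) : IsLorenzMap 2 (-1) (rightEnd y) (toMap y) := by
  have hr := hy.end_pos
  have hcont : ∀ x ∈ Icc (-1) (rightEnd y) \ {0}, ContinuousAt (toMap y) x := by
    intro x hx
    rcases lt_or_gt_of_ne (show x ≠ 0 from hx.2) with h | h
    · have h₁ : ContinuousAt (fun x => leftPart y (x ^ 2)) x :=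
        ContinuousAt.comp (g := leftPart y) (f := fun x => x ^ 2)
          (continuousAt_leftPart y (sq_mem_left ⟨hx.1.1, h⟩)) (by fun_prop)
      refine h₁.congr ?_
      filter_upwards [eventually_lt_nhds h] with z hz using (toMap_of_neg y hz).symm
    · have h₁ : ContinuousAt (fun x => rightPart y (x ^ 2)) x :=
        ContinuousAt.comp (g := rightPart y) (f := fun x => x ^ 2)
          (continuousAt_rightPart y (hy.sq_mem_right ⟨h, hx.1.2⟩)) (by fun_prop)
      refine h₁.congr ?_
      filter_upwards [eventually_gt_nhds h] with z hz using (toMap_of_pos y hz).symm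
  refine ⟨by norm_num, by norm_num, hr, fun x hx => ?_,
    fun x hx => (hcont x hx).continuousWithinAt, fun x hx x' hx' hlt => ?_,
    fun x hx x' hx' hlt => ?_, ?_, ?_, hasAnalyticPart_left y,
    hasAnalyticPart_right y hr hy.end_lt⟩
  · rcases lt_or_gt_of_ne (show x ≠ 0 from hx.2) with h | h
    · rw [toMap_of_neg y h]
      have hm := sq_mem_left ⟨hx.1.1, h⟩
      have h₁ := hy.strictAntiOn_leftPart.antitoneOn hm ⟨zero_le_one, le_rfl⟩ hm.2
      have h₂ := hy.strictAntiOn_leftPart.antitoneOn ⟨le_rfl, zero_le_one⟩ hm hm.1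
      exact ⟨hy.crit_gt.le.trans h₁, h₂⟩
    · rw [toMap_of_pos y h]
      have hm := hy.sq_mem_right ⟨h, hx.1.2⟩
      have hm' := hy.sq_mem_right ⟨hr, le_rfl⟩
      have h₁ := hy.strictMonoOn_rightPart.monotoneOn ⟨le_rfl, by norm_num⟩ hm hm.1
      have h₂ := hy.strictMonoOn_rightPart.monotoneOn hm hm'
        (pow_le_pow_left₀ h.le hx.1.2 2)
      rw [rightPart_zero] at h₁
      exact ⟨h₁, h₂.trans hy.q_lt.le⟩
  · rw [toMap_of_neg y hx.2, toMap_of_neg y hx'.2]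
    exact hy.strictAntiOn_leftPart (sq_mem_left hx') (sq_mem_left hx)
      (by nlinarith [hx.2, hx'.2])
  · rw [toMap_of_pos y hx.1, toMap_of_pos y hx'.1]
    exact hy.strictMonoOn_rightPart (hy.sq_mem_right hx) (hy.sq_mem_right hx')
      (pow_lt_pow_left₀ hlt hx.1.le two_ne_zero)
  · have h₁ : ContinuousAt (fun x => leftPart y (x ^ 2)) 0 :=
      ContinuousAt.comp (g := leftPart y) (f := fun x => x ^ 2)
        (continuousAt_leftPart y (by norm_num)) (by fun_prop)
    have h₂ := h₁.tendsto.mono_left (nhdsWithin_le_nhds (s := Iio 0))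
    rw [zero_pow two_ne_zero] at h₂
    refine h₂.congr' ?_
    filter_upwards [self_mem_nhdsWithin] with z hz using (toMap_of_neg y hz).symm
  · have h₁ : ContinuousAt (fun x => rightPart y (x ^ 2)) 0 :=
      ContinuousAt.comp (g := rightPart y) (f := fun x => x ^ 2)
        (continuousAt_rightPart y (by norm_num)) (by fun_prop)
    have h₂ := h₁.tendsto.mono_left (nhdsWithin_le_nhds (s := Ioi 0))
    rw [zero_pow two_ne_zero, rightPart_zero] at h₂
    refine h₂.congr' ?_
    filter_upwards [self_mem_nhdsWithin] with z hz using (toMap_of_pos y hz).symm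

/-- The inequalities fix the sign of every intermediate iterate, so `toMap` unfolds to the left and
right parts in the order prescribed by 01 and 100, and the formulas for `opT` give the rescaled
return map. That this map is a Lorenz map is read off from `Good (opT y)`. -/
theorem renormRel (hy : Good y) (ha : Admissible y) (hy' : Good (opT y)) :
    RenormRel [0, 1] [1, 0, 0] y (opT y) := by
  have hf := hy.isLorenzMap
  have hg := hy'.isLorenzMap
  obtain ⟨p, hp⟩ : ∃ p, p = leftPart y (leftPart y 1 ^ 2) := ⟨_, rfl⟩
  obtain ⟨q, hq⟩ : ∃ q, q = rightPart y (rightEnd y ^ 2) := ⟨_, rfl⟩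
  have hl : lam y = -p := by rw [lam, hp]
  have hp1 := hy.p_gt
  have hp0 := hy.p_lt
  have hq0 := hy.q_gt
  have hqr := hy.q_lt
  have hfp := hy.p_image
  have hfq := hy.q_image
  have hffq := hy.q_image₂
  rw [← hp] at hp1 hp0 hfp hfq hffq
  rw [← hq] at hq0 hqr hfp hfq hffq
  have hcp : 0 < -p := neg_pos.2 hp0
  have e₁ : toMap y (-1) = leftPart y 1 := by
    rw [toMap_of_neg y (by norm_num)]
    norm_num
  have e₂ : toMap y (toMap y (-1)) = p := by rw [e₁, toMap_of_neg y hy.crit_lt, hp]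
  have e₃ : toMap y (rightEnd y) = q := by rw [toMap_of_pos y hy.end_pos, hq]
  have e₄ : toMap y p = leftPart y (p ^ 2) := toMap_of_neg y hp0
  have e₅ : toMap y q = rightPart y (q ^ 2) := toMap_of_pos y hq0
  have e₆ : toMap y (toMap y q) = leftPart y (rightPart y (q ^ 2) ^ 2) := by
    rw [e₅, toMap_of_neg y (hfq.trans hp0)]
  rw [← e₄] at hfp
  rw [← e₆] at hffq
  rw [← e₅] at hfq
  have hr' : -p * rightEnd (opT y) = q := by
    have h0 : |((0 : ℝ) - 1) / s| ≤ 1 := (abs_sub_one_div_s_le (by norm_num)).trans (by norm_num)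
    have := leftPart_opT ha h0
    rw [rightEnd, this, hl, mul_inv_cancel_left₀ hcp.ne', mul_zero]
    exact hq.symm
  have hlt : ∀ {z : Y}, Good z → rightEnd z ^ 2 < t := fun {z} hz => by
    have h₁ := hz.end_pos
    have h₂ := hz.end_lt
    norm_num [t]
    nlinarith
  refine ⟨hlt hy, hlt hy', isRenormalization_of_bounds hf hg (by rw [e₁]; exact hy.crit_lt) e₂ e₃
    hp1 hp0 hq0 hqr hfp hfq hffq hr' (fun x hx => ?_) fun x hx => ?_⟩
  · have hx2 := (abs_sub_one_div_s_le (sq_mem_left hx)).trans (by norm_num : (1 / 2 : ℝ) ≤ 1)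
    have h₁ : -p * x < 0 := mul_neg_of_pos_of_neg hcp hx.2
    have h₂ : p ≤ -p * x := by nlinarith [hx.1]
    have h₃ : 0 < toMap y (-p * x) := (hq0.trans hfp).trans_le
      (hf.strictMonoOn_left.monotoneOn ⟨hp1.le, hp0⟩ ⟨hp1.le.trans h₂, h₁⟩ h₂)
    rw [toMap_of_neg _ hx.2, leftPart_opT ha hx2, hl, toMap_of_pos y h₃, toMap_of_neg y h₁,
      mul_pow]
  · have hx2 := (abs_div_t_le (hy'.sq_mem_right hx)).trans (by norm_num : (1 / 2 : ℝ) ≤ 1)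
    have h₁ : 0 < -p * x := mul_pos hcp hx.1
    have h₂ : -p * x ≤ q := hr' ▸ mul_le_mul_of_nonneg_left hx.2 hcp.le
    have m₁ : -p * x ∈ Ioc 0 (rightEnd y) := ⟨h₁, h₂.trans hqr.le⟩
    have m₂ : q ∈ Ioc 0 (rightEnd y) := ⟨hq0, hqr.le⟩
    have h₃ := hf.strictMonoOn_right.monotoneOn m₁ m₂ h₂
    have h₄ : toMap y (-p * x) < 0 := (h₃.trans_lt hfq).trans hp0
    have h₅ : toMap y (toMap y (-p * x)) < 0 :=
      ((hf.strictMonoOn_left.monotoneOn ⟨(hf.left_lt m₁).le, h₄⟩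
        ⟨(hf.left_lt m₂).le, hfq.trans hp0⟩ h₃).trans_lt hffq).trans hp0
    rw [toMap_of_pos _ hx.1, rightPart_opT ha hx2, hl, toMap_of_neg y h₅, toMap_of_neg y h₄,
      toMap_of_pos y h₁, mul_pow]

end Good

end

end LorenzRenorm

namespace LorenzRenorm

open Set Filter Topology

open scoped X

/-! ### The dynamics near the fixed point -/

namespace Ball

/-- `φ (v ^ 2)` for a constant `v`. -/
def leftBall (n : ℕ) (f v : Ball) : Ball := comp n f (sqN n v)

/-- `ψ (v ^ 2)` for a constant `v`. -/
def rightBall (n : ℕ) (g v : Ball) : Ball :=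
  (mul n v v).seq fun w => subOne (mul n w (comp n g (add w w)))

/-- The constant term exceeds `m`. -/
def dominates (b : Ball) (m : ℕ) : Bool := (m : ℤ) + b.e < b.c.headD 0

def one : Ball := ofPoly [281474976710656]

def half : Ball := ofPoly [140737488355328]

/-- Enclosures of the orbits that appear in `Good`. -/
def goodOK : Bool :=
  -- All quantities here are constants in `X`, so truncation to two coefficients loses nothing.
  (leftBall 2 nearFst zero).seq fun r =>
  (const nearFst).seq fun c =>
  (leftBall 2 nearFst c).seq fun p =>
  (rightBall 2 nearSnd r).seq fun q =>
  (leftBall 2 nearFst p).seq fun fp =>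
  (rightBall 2 nearSnd q).seq fun fq =>
  (leftBall 2 nearFst fq).seq fun ffq =>
  (small (sqN 2 zero) && small (sqN 2 c) && small (sqN 2 p) && small (sqN 2 fq) &&
    small (add (mul 2 r r) (mul 2 r r)) && small (add (mul 2 q q) (mul 2 q q))) &&
  (dominates (neg (const (shift nearFst))) (bound (shift (shift nearFst))) &&
    dominates (const nearSnd) (bound (shift nearSnd))) &&
  ([r, sub half r, add c one, neg c, add p one, neg p, q, sub r q, sub fp q, sub p fq,
    sub p ffq].all fun b => dominates b 0)

theorem goodOK_eq : goodOK = true := by decide +kernel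

end Ball

/-! ### Soundness of the orbit enclosures -/

noncomputable section

namespace Ball

theorem toX_zero (p : List ℤ) : toX p 0 = (p.headD 0 : ℤ) := by
  cases p with
  | nil => simp [toX]
  | cons a p => exact toX_cons_zero a p

theorem Has.lt_of_dominates {b : Ball} {x : X} (h : b.Has x) {m : ℕ}
    (hd : dominates b m = true) : (m : ℝ) < unit * x 0 := by
  have h₁ : ((m : ℤ) : ℝ) + ((b.e : ℤ) : ℝ) < ((b.c.headD 0 : ℤ) : ℝ) := by
    exact_mod_cast of_decide_eq_true hd
  have h₂ := (X.abs_apply_le ((unit : ℝ) • x - toX b.c) 0).trans h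
  rw [X.sub_apply', X.smul_apply', toX_zero] at h₂
  have h₃ := (abs_le.1 h₂).1
  push_cast at h₁
  linarith

theorem Has.pos {b : Ball} {x : ℝ} (h : b.Has (x • (1 : X))) (hd : dominates b 0 = true) :
    0 < x := by
  have := h.lt_of_dominates hd
  rw [X.smul_apply', X.coeff_one, if_pos rfl, mul_one, Nat.cast_zero] at this
  exact pos_of_mul_pos_right this unit_pos.le

theorem Has.leftBall {f v : Ball} {y : Y} {x : ℝ} (n : ℕ) (hf : f.Has y.fst)
    (hv : v.Has (x • (1 : X))) (hs : small (Ball.sqN n v) = true) :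
    (leftBall n f v).Has (leftPart y (x ^ 2) • (1 : X)) := by
  have h := hv.sqN n
  refine (hf.comp h ((h.norm_le_of_small hs).trans (by norm_num)) n).of_eq ?_
  rw [sqNormalize_smul_one, comp_smul_one]
  rfl

theorem Has.rightBall {g v : Ball} {y : Y} {x : ℝ} (n : ℕ) (hg : g.Has y.snd)
    (hv : v.Has (x • (1 : X))) (hs : small (Ball.add (Ball.mul n v v) (Ball.mul n v v)) = true) :
    (rightBall n g v).Has (rightPart y (x ^ 2) • (1 : X)) := by
  have h₁ := (hv.mul hv n).of_eq (x' := (x ^ 2) • (1 : X)) (by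
    rw [smul_mul_smul_comm, mul_one, sq])
  have h₂ := (h₁.add h₁).of_eq (x' := (x ^ 2 / t) • (1 : X)) (by
    rw [← add_smul]
    congr 1
    unfold t
    ring)
  have h₃ := hg.comp h₂ ((h₂.norm_le_of_small hs).trans (by norm_num)) n
  rw [Ball.rightBall, seq_eq]
  refine (h₁.mul h₃ n).subOne.of_eq ?_
  rw [comp_smul_one, smul_mul_smul_comm, mul_one, rightPart]
  module

theorem has_one : one.Has ((1 : ℝ) • (1 : X)) := by
  simp [Has, one, ofPoly, toX, unit]

theorem has_half : half.Has ((1 / 2 : ℝ) • (1 : X)) := by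
  rw [Has, half, ofPoly, toX, toX, mul_zero, add_zero, smul_smul, ← sub_smul]
  norm_num [unit]

theorem Has.sub_smul {a b : Ball} {u v : ℝ} (ha : a.Has (u • (1 : X))) (hb : b.Has (v • (1 : X))) :
    (Ball.sub a b).Has ((u - v) • (1 : X)) :=
  (ha.sub hb).of_eq (_root_.sub_smul u v 1).symm

theorem Has.add_smul {a b : Ball} {u v : ℝ} (ha : a.Has (u • (1 : X))) (hb : b.Has (v • (1 : X))) :
    (Ball.add a b).Has ((u + v) • (1 : X)) :=
  (ha.add hb).of_eq (_root_.add_smul u v 1).symm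

theorem Has.neg_smul {a : Ball} {u : ℝ} (ha : a.Has (u • (1 : X))) :
    (Ball.neg a).Has ((-u) • (1 : X)) :=
  ha.neg.of_eq (_root_.neg_smul u 1).symm

/-- The ball computation in `goodOK` is sound. -/
theorem good_of_goodOK {f g r c p q fp fq ffq : Ball} {n : ℕ} {y : Y} (hf : f.Has y.fst)
    (hg : g.Has y.snd) (er : r = Ball.leftBall n f zero) (ec : c = const f)
    (ep : p = Ball.leftBall n f c) (eq : q = Ball.rightBall n g r)
    (efp : fp = Ball.leftBall n f p) (efq : fq = Ball.rightBall n g q)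
    (effq : ffq = Ball.leftBall n f fq)
    (hok : ((small (sqN n zero) && small (sqN n c) && small (sqN n p) && small (sqN n fq) &&
    small (Ball.add (mul n r r) (mul n r r)) && small (Ball.add (mul n q q) (mul n q q))) &&
  (dominates (Ball.neg (const (shift f))) (bound (shift (shift f))) &&
    dominates (const g) (bound (shift g))) &&
  ([r, Ball.sub half r, Ball.add c one, Ball.neg c, Ball.add p one, Ball.neg p, q, Ball.sub r q,
    Ball.sub fp q, Ball.sub p fq, Ball.sub p ffq].all fun b => dominates b 0)) = true) :
    Good y := by
  simp only [List.all_cons, List.all_nil, Bool.and_eq_true, Bool.and_true] at hok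
  obtain ⟨⟨⟨⟨⟨⟨⟨s₁, s₂⟩, s₃⟩, s₄⟩, s₅⟩, s₆⟩, d₁, d₂⟩, e₁, e₂, e₃, e₄, e₅, e₆, e₇, e₈, e₉, e₁₀,
    e₁₁⟩ := hok
  have R : r.Has (rightEnd y • (1 : X)) := er ▸
    (hf.leftBall n (x := 0) (has_zero.of_eq (zero_smul ℝ (1 : X)).symm) s₁).of_eq (by
      rw [rightEnd, zero_pow two_ne_zero])
  have C : c.Has (leftPart y 1 • (1 : X)) := ec ▸ hf.const.of_eq (by
    rw [X.constPart_apply, leftPart_one])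
  have P := ep ▸ hf.leftBall n C s₂
  have Q := eq ▸ hg.rightBall n R s₅
  have FP := efp ▸ hf.leftBall n P s₃
  have FQ := efq ▸ hg.rightBall n Q s₆
  have FFQ := effq ▸ hf.leftBall n FQ s₄
  refine ⟨?_, ?_, R.pos e₁, sub_pos.1 ((has_half.sub_smul R).pos e₂), ?_,
    neg_pos.1 (C.neg_smul.pos e₄), ?_, neg_pos.1 (P.neg_smul.pos e₆), Q.pos e₇,
    sub_pos.1 ((R.sub_smul Q).pos e₈), sub_pos.1 ((FP.sub_smul Q).pos e₉),
    sub_pos.1 ((P.sub_smul FQ).pos e₁₀), sub_pos.1 ((P.sub_smul FFQ).pos e₁₁)⟩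
  · have h₁ := hf.shift.const.neg.lt_of_dominates d₁
    have h₂ := hf.shift.shift.unit_mul_norm_le
    have h₃ : (-X.constPart (X.shift y.fst)) 0 = -y.fst 1 := by
      rw [X.constPart_apply, ← _root_.neg_smul, X.smul_apply', X.coeff_one, if_pos rfl, mul_one,
        X.shift_apply]
    rw [h₃] at h₁
    exact lt_of_mul_lt_mul_left (h₂.trans_lt h₁) unit_pos.le
  · have h₁ := hg.const.lt_of_dominates d₂
    have h₂ := hg.shift.unit_mul_norm_le
    rw [X.constPart_apply, X.smul_apply', X.coeff_one, if_pos rfl, mul_one] at h₁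
    exact lt_of_mul_lt_mul_left (h₂.trans_lt h₁) unit_pos.le
  · have := (C.add_smul has_one).pos e₃
    linarith
  · have := (P.add_smul has_one).pos e₅
    linarith

end Ball

theorem Near.good {y : Y} (hy : Near y) : Good y := by
  have h := Ball.goodOK_eq
  simp only [Ball.goodOK, Ball.seq_eq] at h
  exact Ball.good_of_goodOK hy.1 hy.2 rfl rfl rfl rfl rfl rfl rfl h

/-! ### Transfer from `opT` to the renormalization operator -/

theorem renormOp_eq {α β : List (Fin 2)} {y y' : Y} (h : RenormRel α β y y') :
    renormOp α β y = y' := by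
  have hex : ∃ y', RenormRel α β y y' := ⟨y', h⟩
  rw [renormOp, dif_pos hex]
  exact renormRel_unique hex.choose_spec h

/-- The renormalization operator of type `(01, 100)` has a hyperbolic fixed point. -/
theorem exists_isHyperbolicFixedPoint :
    ∃ y : Y, IsHyperbolicFixedPoint (renormDomain [0, 1] [1, 0, 0])
        (renormOp [0, 1] [1, 0, 0]) y ∧
      IsCompactOperator (fderiv ℝ (renormOp [0, 1] [1, 0, 0]) y) := by
  obtain ⟨y, hfix, hnear⟩ := exists_fixed
  have hy : Near y := hnear.self_of_nhds
  have hcont : Tendsto opT (𝓝 y) (𝓝 y) := by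
    have := (hasFDerivAt_opT hy.admissible).continuousAt.tendsto
    rwa [hfix] at this
  -- By continuity at the fixed point, both z and `opT z` lie in the numerical neighbourhood, so
  -- both represent Lorenz maps satisfying `Good`.
  have hrel : ∀ᶠ z in 𝓝 y, RenormRel [0, 1] [1, 0, 0] z (opT z) := by
    filter_upwards [hnear, hcont.eventually hnear] with z h₁ h₂
    exact h₁.good.renormRel h₁.admissible h₂.good
  -- Renormalizations are unique, so the chosen value is `opT z`; equality of germs then transfers
  -- derivative and smoothness.
  have heq : renormOp [0, 1] [1, 0, 0] =ᶠ[𝓝 y] opT := hrel.mono fun z hz => renormOp_eq hz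
  have hder : fderiv ℝ (renormOp [0, 1] [1, 0, 0]) y = dT y :=
    heq.fderiv_eq.trans (hasFDerivAt_opT hy.admissible).fderiv
  refine ⟨y, ⟨hrel.mono fun z hz => ⟨_, hz⟩, heq.self_of_nhds.trans hfix,
    (contDiffAt_opT hy.admissible).congr_of_eventuallyEq heq, ?_⟩, ?_⟩
  · rw [hder]
    exact hy.disjoint_complexSpectrum
  · rw [hder]
    exact isCompactOperator_dT hy.admissible

end

end LorenzRenorm

theorem theorem2p11 :
    ∃ y : LorenzRenorm.Y,
      LorenzRenorm.IsHyperbolicFixedPoint (LorenzRenorm.renormDomain [0, 1] [1, 0, 0])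
        (LorenzRenorm.renormOp [0, 1] [1, 0, 0]) y ∧
      IsCompactOperator (fderiv ℝ (LorenzRenorm.renormOp [0, 1] [1, 0, 0]) y) := by
  exact LorenzRenorm.exists_isHyperbolicFixedPoint
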